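/- **Theorem (age-dependent processes are semi-Markov).** Let $(\Omega,\mathcal F,(\mathcal F_t)_{t\ge 0},P)$ be a filtered probability space, let $\chi=\{1,\dots,k\}\subset\mathbb R$, and for $i\ne j$ in $\chi$ let $\lambda_{ij}:(0,\infty)\to[0,\infty)$ be measurable functions such that for every $i\in\chi$ $$\sup_{y>0}\sum_{j\ne i}\lambda_{ij}(y)<\infty ,\qquad \lim_{y\to\infty}\int_0^y\sum_{j\neq i}\lambda_{ij}(v)\,dv=\infty .$$ For $y>0$ let $\Lambda_{ij}(y)$, $i\neq j$, be the consecutive left-closed, right-open intervals of length $\lambda_{ij}(y)$, arranged in the lexicographic order of the pairs $(i,j)$ and starting at $0$ (and put $\Lambda_{ij}(y)=\emptyset$ for $y\le 0$), and set $$h(i,y,z)=\sum_{j\ne i}(j-i)\mathbf 1_{\Lambda_{ij}(y)}(z),\qquad g(i,y,z)=y\sum_{j\neq i}\mathbf 1_{\Lambda_{ij}(y)}(z).$$ Let $\wp$ be a Poisson random measure on $\mathbb R_+\times\mathbb R$ with intensity $du\,dz$ such that, for every $t\ge0$, $\wp((0,t]\times B)$ is $\mathcal F_t$-measurable for all Borel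 sets $B$, and the restriction of $\wp$ to $(t,\infty)\times\mathbb R$ is independent of $\mathcal F_t$. Let $(X_t,Y_t)_{t\ge 0}$ be an $(\mathcal F_t)$-adapted process with values in $\chi\times\mathbb R$ and $Y_0\ge 0$ a.s. which solves, almost surely for all $t\ge0$ (the integrals being absolutely convergent), $$X_t=X_0+\int_{(0,t]}\int_{\mathbb R}h(X_{u-},Y_{u-},z)\,\wp(du,dz),\qquad Y_t=Y_0+t-\int_{(0,t]}\int_{\mathbb R}g(X_{u-},Y_{u-},z)\,\wp(du,dz).$$ Then the age-dependent process $X$ is a semi-Markov process, in the following sense. Almost surely, $X$ is right-continuous with left limits and piecewise constant, and its discontinuities form a strictly increasing infinite sequence $0<T_1<T_2<\cdots$ with $T_n\to\infty$. Put $T_0:=-Y_0$ and let $\xi_0:=X_0$, $\xi_n:=X_{T_n}$ for $n\ge1$. Then for every $n\ge 1$, every $j\in\chi$ and every $y\in\mathbb R$, almost surely $$P\big[\xi_{n+1}=j,\ T_{n+1}-T_n\le y\,\big|\,(\xi_0,T_0),\dots,(\xi_n,T_n)\big]=P\big[\xi_{n+1}=j,\ T_{n+1}-T_n\le y\,\big|\,\xi_n\big].$$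 The same identity holds for $n=0$ whenever $Y_0$ is almost surely equal to a function of $X_0$, in particular when $Y_0$ is deterministic. -/

import Mathlib

open MeasureTheory ProbabilityTheory Filter Set Topology
open scoped NNReal ENNReal

namespace AgeDependent

noncomputable section

/-- `N` is a Poisson random measure on `E` with mean measure `μ`: a measurable random
`ℕ ∪ {∞}`-valued measure such that `N(A)` is Poisson distributed with parameter `μ A`
(and a.s. infinite when `μ A = ∞`), and such that the values on disjoint sets are independent. -/
structure IsPoissonRandomMeasure {Ω E : Type*} [MeasurableSpace Ω] [MeasurableSpace E]
    (P : Measure Ω) (N : Ω → Measure E) (μ : Measure E) : Prop where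
  measurable : Measurable N
  integerValued : ∀ (ω : Ω) (A : Set E), MeasurableSet A → ∃ n : ℕ∞, N ω A = (n : ℝ≥0∞)
  poisson : ∀ A : Set E, MeasurableSet A → μ A ≠ ∞ → ∀ k : ℕ,
    P {ω | N ω A = (k : ℝ≥0∞)} =
      ENNReal.ofReal (Real.exp (-(μ A).toReal) * (μ A).toReal ^ k / (k.factorial : ℝ))
  infinite : ∀ A : Set E, MeasurableSet A → μ A = ∞ → ∀ k : ℕ,
    P {ω | N ω A = (k : ℝ≥0∞)} = 0
  independent : ∀ (m : ℕ) (A : Fin m → Set E), (∀ a, MeasurableSet (A a)) →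
    Pairwise (fun a b => Disjoint (A a) (A b)) →
    iIndepFun (fun (a : Fin m) (ω : Ω) => N ω (A a)) P

/-- The Lebesgue intensity `du × dz` on `ℝ₊ × ℝ`. -/
def lebesgueIntensity : Measure (ℝ≥0 × ℝ) :=
  (Measure.comap (fun u : ℝ≥0 => (u : ℝ)) volume).prod volume

/-- A Poisson random measure on `ℝ₊ × ℝ` with intensity `du × dz` relative to the filtration `𝓕`:
for every `t`, the measures `N((0,t] × B)` are `𝓕 t`-measurable and the restriction of `N`
to `(t,∞) × ℝ` is independent of `𝓕 t`. -/
structure IsPoissonNoise {Ω : Type*} {mΩ : MeasurableSpace Ω} (P : Measure Ω)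
    (𝓕 : Filtration ℝ≥0 mΩ) (N : Ω → Measure (ℝ≥0 × ℝ)) : Prop where
  poisson : IsPoissonRandomMeasure P N lebesgueIntensity
  adapted : ∀ (t : ℝ≥0) (B : Set ℝ), MeasurableSet B →
    Measurable[𝓕 t] (fun ω => N ω (Ioc 0 t ×ˢ B))
  indep_future : ∀ t : ℝ≥0,
    Indep (𝓕 t)
      (MeasurableSpace.comap (fun ω => (N ω).restrict (Ioi t ×ˢ (univ : Set ℝ))) inferInstance) P

/-- The state `i : Fin k`, seen as one of the real numbers `1, …, k`. -/
def stateVal {k : ℕ} (i : Fin k) : ℝ := (i : ℝ) + 1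

/-- The total rate `∑_{j ≠ i} λ_{ij}(y)` of leaving the state `i` at age `y`. -/
def exitRate {k : ℕ} (lam : Fin k → Fin k → ℝ → ℝ) (i : Fin k) (y : ℝ) : ℝ :=
  ∑ j ∈ Finset.univ.filter (fun j => j ≠ i), lam i j y

/-- The standing assumptions on the rate functions. Only the off-diagonal entries and only ages
`y > 0` matter. -/
structure IsRateFunction {k : ℕ} (lam : Fin k → Fin k → ℝ → ℝ) : Prop where
  measurable : ∀ i j, i ≠ j → Measurable (fun y : Ioi (0 : ℝ) => lam i j y)
  nonneg : ∀ i j, i ≠ j → ∀ y : ℝ, 0 < y → 0 ≤ lam i j y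
  bounded : ∀ i, BddAbove ((fun y => exitRate lam i y) '' Ioi (0 : ℝ))
  divergent : ∀ i, Tendsto (fun y : ℝ => ∫ v in Ioc 0 y, exitRate lam i v) atTop atTop

/-- The left end point of `Λ_{ij}(y)`: the total length of the intervals `Λ_{i'j'}(y)` with
`i' ≠ j'` and `(i',j')` before `(i,j)` in the lexicographic order. -/
def leftEnd {k : ℕ} (lam : Fin k → Fin k → ℝ → ℝ) (i j : Fin k) (y : ℝ) : ℝ :=
  ∑ p ∈ Finset.univ.filter
    (fun p : Fin k × Fin k => p.1 ≠ p.2 ∧ toLex p < toLex (i, j)), lam p.1 p.2 y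

open scoped Classical in
/-- The intervals `Λ_{ij}(y)`, for `y > 0`: consecutive in the lexicographic order of the pairs
`(i,j)`, `i ≠ j`, starting at `0`, left-closed and right-open, of length `λ_{ij}(y)`. -/
def rateInterval {k : ℕ} (lam : Fin k → Fin k → ℝ → ℝ) (i j : Fin k) (y : ℝ) : Set ℝ :=
  if 0 < y then Ico (leftEnd lam i j y) (leftEnd lam i j y + lam i j y) else ∅

/-- `h(i,y,z) = ∑_{j ≠ i} (j - i) 1_{Λ_{ij}(y)}(z)`. -/
def hFun {k : ℕ} (lam : Fin k → Fin k → ℝ → ℝ) (i : Fin k) (y z : ℝ) : ℝ :=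
  ∑ j ∈ Finset.univ.filter (fun j => j ≠ i),
    (stateVal j - stateVal i) * (rateInterval lam i j y).indicator (fun _ => (1 : ℝ)) z

/-- `g(i,y,z) = y ∑_{j ≠ i} 1_{Λ_{ij}(y)}(z)`. -/
def gFun {k : ℕ} (lam : Fin k → Fin k → ℝ → ℝ) (i : Fin k) (y z : ℝ) : ℝ :=
  y * ∑ j ∈ Finset.univ.filter (fun j => j ≠ i),
    (rateInterval lam i j y).indicator (fun _ => (1 : ℝ)) z

/-- `f(X_{u-}, Y_{u-}, z)` as a function of `(u,z)`, along one pair of paths `x`, `y`. -/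
def alongPath {k : ℕ} (f : Fin k → ℝ → ℝ → ℝ) (x : ℝ≥0 → Fin k) (y : ℝ≥0 → ℝ) :
    ℝ≥0 × ℝ → ℝ :=
  fun p => f (Function.leftLim x p.1) (Function.leftLim y p.1) p.2

/-- `(X,Y)` is a strong solution of the coupled equations
`X_t = X_0 + ∫_{(0,t]} ∫_ℝ h(X_{u-},Y_{u-},z) N(du,dz)` and
`Y_t = Y_0 + t - ∫_{(0,t]} ∫_ℝ g(X_{u-},Y_{u-},z) N(du,dz)` driven by `N`, with `Y_0 ≥ 0`. The
existence of the integrals is part of the notion; the right-hand sides are then right-continuous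
with left limits in `t`, so that `Function.leftLim` is a genuine left limit on such paths. -/
structure IsStrongSolution {Ω : Type*} {mΩ : MeasurableSpace Ω} (P : Measure Ω)
    (𝓕 : Filtration ℝ≥0 mΩ) (N : Ω → Measure (ℝ≥0 × ℝ)) {k : ℕ}
    (lam : Fin k → Fin k → ℝ → ℝ) (X : ℝ≥0 → Ω → Fin k) (Y : ℝ≥0 → Ω → ℝ) : Prop where
  adapted_X : ∀ t, Measurable[𝓕 t] (X t)
  adapted_Y : ∀ t, Measurable[𝓕 t] (Y t)
  nonneg_Y_zero : ∀ᵐ ω ∂P, 0 ≤ Y 0 ω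
  equation_X : ∀ᵐ ω ∂P, ∀ t : ℝ≥0,
    IntegrableOn (alongPath (hFun lam) (fun s => X s ω) (fun s => Y s ω))
      (Ioc 0 t ×ˢ univ) (N ω) ∧
    stateVal (X t ω) = stateVal (X 0 ω) +
      ∫ p in Ioc 0 t ×ˢ univ, alongPath (hFun lam) (fun s => X s ω) (fun s => Y s ω) p ∂(N ω)
  equation_Y : ∀ᵐ ω ∂P, ∀ t : ℝ≥0,
    IntegrableOn (alongPath (gFun lam) (fun s => X s ω) (fun s => Y s ω))
      (Ioc 0 t ×ˢ univ) (N ω) ∧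
    Y t ω = Y 0 ω + (t : ℝ) -
      ∫ p in Ioc 0 t ×ˢ univ, alongPath (gFun lam) (fun s => X s ω) (fun s => Y s ω) p ∂(N ω)

/-- Almost surely, `X` is right-continuous with left limits and piecewise constant, its
discontinuities are exactly the times `T 1 < T 2 < …`, which are finite and increase to `∞`, and
`ξ n` is its value on `[T n, T (n+1))`, so that `ξ n = X_{T n}` for `n ≥ 1` and `ξ 0 = X_0`;
`T 0 ≤ 0` is a reference time. -/
structure IsPiecewiseConstant {Ω : Type*} [MeasurableSpace Ω] (P : Measure Ω) {k : ℕ}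
    (X : ℝ≥0 → Ω → Fin k) (T : ℕ → Ω → ℝ) (ξ : ℕ → Ω → Fin k) : Prop where
  measurable_T : ∀ n, Measurable (T n)
  measurable_state : ∀ n, Measurable (ξ n)
  rcll : ∀ᵐ ω ∂P, ∀ t : ℝ≥0, ContinuousWithinAt (fun s => X s ω) (Ici t) t ∧
    ∃ l : Fin k, Tendsto (fun s => X s ω) (𝓝[<] t) (𝓝 l)
  start : ∀ᵐ ω ∂P, T 0 ω ≤ 0 ∧ 0 < T 1 ω
  increasing : ∀ᵐ ω ∂P, StrictMono (fun n => T n ω) ∧ Tendsto (fun n => T n ω) atTop atTop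
  discontinuities : ∀ᵐ ω ∂P,
    {s : ℝ | ∃ t : ℝ≥0, (t : ℝ) = s ∧ ¬ ContinuousAt (fun u => X u ω) t} =
      {s : ℝ | ∃ n : ℕ, 1 ≤ n ∧ s = T n ω}
  constant : ∀ᵐ ω ∂P, ∀ (n : ℕ) (t : ℝ≥0), T n ω ≤ (t : ℝ) → (t : ℝ) < T (n + 1) ω →
    X t ω = ξ n ω

/-- The semi-Markov property at the `n`-th transition: for all `j` and `y`,
`P[ξ_{n+1} = j, T_{n+1} - T_n ≤ y | (ξ_0,T_0),…,(ξ_n,T_n)]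
  = P[ξ_{n+1} = j, T_{n+1} - T_n ≤ y | ξ_n]` almost surely. -/
def SemiMarkovPropertyAt {Ω : Type*} [MeasurableSpace Ω] (P : Measure Ω) {k : ℕ}
    (T : ℕ → Ω → ℝ) (ξ : ℕ → Ω → Fin k) (n : ℕ) : Prop :=
  ∀ (j : Fin k) (y : ℝ),
    P⟦{ω | ξ (n + 1) ω = j ∧ T (n + 1) ω - T n ω ≤ y} |
      MeasurableSpace.comap (fun ω (m : Fin (n + 1)) => (ξ m ω, T m ω)) inferInstance⟧
    =ᵐ[P]
    P⟦{ω | ξ (n + 1) ω = j ∧ T (n + 1) ω - T n ω ≤ y} |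
      MeasurableSpace.comap (ξ n) inferInstance⟧

/-- `X` is a semi-Markov process with reference time `T₀`, where the semi-Markov property is
claimed at the transitions number `n₀, n₀ + 1, …`; `n₀ = 0` is the full notion. -/
def IsSemiMarkovFrom {Ω : Type*} [MeasurableSpace Ω] (P : Measure Ω) {k : ℕ}
    (n₀ : ℕ) (X : ℝ≥0 → Ω → Fin k) (T₀ : Ω → ℝ) : Prop :=
  ∃ (T : ℕ → Ω → ℝ) (ξ : ℕ → Ω → Fin k), T 0 = T₀ ∧ IsPiecewiseConstant P X T ξ ∧
    ∀ n, n₀ ≤ n → SemiMarkovPropertyAt P T ξ n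

end

end AgeDependent

/-! The process `t - Y_t` is constant while the age grows with slope one and equals `t` when the age
restarts from `0`. It is therefore the time of the last jump, with starting value `-Y_0`. While the
state is `i` and the last jump time is `l`, a jump to `j` occurs at time `u` exactly when the noise
has a point in `{u} × Λ_{ij}(u - l)`. All intervals lie in a common bounded strip, where the noise
almost surely is locally finite and has at most one point at each time. Hence almost every path is a
step path (`SolvesEquations.exists_left`).

The probabilistic input is the compensation formula `E N(S) = E Leb(S)` for predictable sets `S`
(`IsPoissonNoise.lintegral_pathSection`). Let `n ≥ 1`, let `A` be an event in the history up to
`T_n` contained in `{ξ_n = i}`, and let `D = T_{n+1} - T_n`. Take for `S` the points `(u, z)` with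
`T_n < u`, no jump in `(T_n, u)`, `u - T_n ∈ R` and `z ∈ Λ_{ij}(u - T_n)`, on the event `A`. The
number of noise points in `S` is almost surely the indicator of `A ∩ {ξ_{n+1} = j, D ∈ R}`, while
the Lebesgue measure of the section is the integral of `λ_{ij}` over `R ∩ (0, D]` on `A`. This gives
`measure_transition`: `P(A, ξ_{n+1} = j, D ∈ R) = ∫_{R ∩ (0,∞)} λ_{ij}(v) P(A, D ≥ v) dv`.

Summing over `j` with `R = (-∞, y)` gives a linear Volterra equation for `y ↦ P(A, D ≥ y)`, whose
coefficients depend on `i` only. Bounded solutions are unique (`eq_zero_of_volterra`), so `P(A, D ≥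
y)` is proportional to `P(A)`. Inserting this in the formula above shows that `(ξ_{n+1}, D)` is
independent of the history given `ξ_n` (`measure_transition_mul`). No explicit survival function and
no strong Markov property of the noise are needed.

The same formula, started at a deterministic time, yields infinitely many jumps. At most one point
produces the next jump, so the Lebesgue measure of the corresponding region is almost surely finite.
In the absence of further jumps the divergence of the integrated exit rate would make it infinite
for some target state.

The age need not vanish at time `0`, so `n = 0` is different: if `Y_0` is a function of `X_0`, the
initial history carries no information beyond `ξ_0`. Path properties hold only almost surely, so
predictability is taken with respect to the filtration augmented by null sets. -/

namespace AgeDependent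

/-! ### Rates and the intervals `Λ_{ij}` -/

/-- The rates, cut off to `0` on the diagonal and for ages `y ≤ 0`. -/
noncomputable def cutRate {k : ℕ} (lam : Fin k → Fin k → ℝ → ℝ) (i j : Fin k) (y : ℝ) : ℝ :=
  open Classical in if i ≠ j ∧ 0 < y then lam i j y else 0

section Rates

variable {k : ℕ} {lam : Fin k → Fin k → ℝ → ℝ}

lemma cutRate_of_pos {i j : Fin k} {y : ℝ} (hij : i ≠ j) (hy : 0 < y) :
    cutRate lam i j y = lam i j y := by
  simp [cutRate, hij, hy]

lemma IsRateFunction.measurable_cutRate (h : IsRateFunction lam) (i j : Fin k) :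
    Measurable (cutRate lam i j) := by
  classical
  by_cases hij : i = j
  · have : cutRate lam i j = fun _ => 0 := by ext y; simp [cutRate, hij]
    rw [this]
    exact measurable_const
  · have : cutRate lam i j = fun y => if y ∈ Ioi (0 : ℝ) then lam i j y else 0 := by
      ext y; simp [cutRate, hij]
    rw [this]
    refine measurable_of_restrict_of_restrict_compl (s := Ioi (0 : ℝ)) measurableSet_Ioi ?_ ?_
    · convert h.measurable i j hij using 1
      ext y; exact if_pos y.2
    · convert measurable_const (a := (0 : ℝ)) using 1
      ext y; exact if_neg y.2

lemma IsRateFunction.cutRate_nonneg (h : IsRateFunction lam) (i j : Fin k) (y : ℝ) :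
    0 ≤ cutRate lam i j y := by
  unfold cutRate
  split_ifs with hc
  · exact h.nonneg i j hc.1 y hc.2
  · exact le_rfl

lemma leftEnd_eq_sum_cutRate {y : ℝ} (hy : 0 < y) (i j : Fin k) :
    leftEnd lam i j y = ∑ p ∈ Finset.univ.filter
      (fun p : Fin k × Fin k => p.1 ≠ p.2 ∧ toLex p < toLex (i, j)), cutRate lam p.1 p.2 y := by
  refine Finset.sum_congr rfl fun p hp => ?_
  rw [cutRate_of_pos (Finset.mem_filter.1 hp).2.1 hy]

lemma exitRate_eq_sum_cutRate {y : ℝ} (hy : 0 < y) (i : Fin k) :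
    exitRate lam i y = ∑ j, cutRate lam i j y := by
  rw [exitRate, Finset.sum_filter]
  refine Finset.sum_congr rfl fun j _ => ?_
  by_cases hij : j = i
  · subst hij; simp [cutRate]
  · rw [if_pos hij, cutRate_of_pos (Ne.symm hij) hy]

/-- The point `z` belongs to `Λ_{ij}(y)` jointly measurably in `(y, z)`. -/
lemma IsRateFunction.measurableSet_rateInterval (h : IsRateFunction lam) {i j : Fin k}
    (hij : i ≠ j) : MeasurableSet {p : ℝ × ℝ | p.2 ∈ rateInterval lam i j p.1} := by
  let L : ℝ → ℝ := fun y => ∑ p ∈ Finset.univ.filter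
      (fun p : Fin k × Fin k => p.1 ≠ p.2 ∧ toLex p < toLex (i, j)), cutRate lam p.1 p.2 y
  have hL : Measurable L := Finset.measurable_sum _ fun p _ => h.measurable_cutRate _ _
  have : {p : ℝ × ℝ | p.2 ∈ rateInterval lam i j p.1} =
      {p | 0 < p.1} ∩ ({p | L p.1 ≤ p.2} ∩ {p | p.2 < L p.1 + cutRate lam i j p.1}) := by
    ext p
    by_cases hp : 0 < p.1
    · simp [rateInterval, hp, leftEnd_eq_sum_cutRate hp, L, cutRate_of_pos hij hp]
    · simp [rateInterval, hp]
  rw [this]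
  have hl := h.measurable_cutRate i j
  refine (measurableSet_lt measurable_const measurable_fst).inter
    ((measurableSet_le (hL.comp measurable_fst) measurable_snd).inter
    (measurableSet_lt measurable_snd ((hL.add hl).comp measurable_fst)))

lemma IsRateFunction.measurableSet_rateInterval_apply (h : IsRateFunction lam) {i j : Fin k}
    (hij : i ≠ j) (y : ℝ) : MeasurableSet (rateInterval lam i j y) :=
  measurable_prodMk_left (h.measurableSet_rateInterval hij)

lemma volume_rateInterval {i j : Fin k} (hij : i ≠ j) (y : ℝ) :
    volume (rateInterval lam i j y) = ENNReal.ofReal (cutRate lam i j y) := by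
  by_cases hy : 0 < y
  · simp [rateInterval, hy, cutRate_of_pos hij hy]
  · simp [rateInterval, hy, cutRate]

/-- For `j < j'`, the pair `(i, j)` and all its predecessors are predecessors of `(i, j')`. As the
rates are nonnegative, the first interval ends before the second one starts. -/
lemma IsRateFunction.disjoint_rateInterval (h : IsRateFunction lam) {i j j' : Fin k}
    (hij : i ≠ j) (hij' : i ≠ j') (hjj' : j ≠ j') (y : ℝ) :
    Disjoint (rateInterval lam i j y) (rateInterval lam i j' y) := by
  wlog hlt : j < j' generalizing j j'
  · exact (this hij' hij hjj'.symm (lt_of_le_of_ne (not_lt.1 hlt) hjj'.symm)).symm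
  by_cases hy : 0 < y
  swap
  · simp [rateInterval, hy]
  have key : leftEnd lam i j y + lam i j y ≤ leftEnd lam i j' y := by
    rw [leftEnd_eq_sum_cutRate hy, leftEnd_eq_sum_cutRate hy, ← cutRate_of_pos (lam := lam) hij hy]
    have hnot : (i, j) ∉ Finset.univ.filter
        (fun p : Fin k × Fin k => p.1 ≠ p.2 ∧ toLex p < toLex (i, j)) := by simp
    rw [add_comm, ← Finset.sum_insert (f := fun p : Fin k × Fin k => cutRate lam p.1 p.2 y) hnot]
    refine Finset.sum_le_sum_of_subset_of_nonneg ?_ fun p _ _ => h.cutRate_nonneg _ _ _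
    have hlt' : toLex (i, j) < toLex (i, j') := Prod.Lex.toLex_lt_toLex.2 (Or.inr ⟨rfl, hlt⟩)
    intro p hp
    simp only [Finset.mem_insert, Finset.mem_filter, Finset.mem_univ, true_and] at hp ⊢
    rcases hp with rfl | hp
    · exact ⟨hij, hlt'⟩
    · exact ⟨hp.1, hp.2.trans hlt'⟩
  simp only [rateInterval, hy, if_true]
  rw [Set.disjoint_left]
  intro z hz hz'
  exact absurd (hz.2.trans_le key) (not_lt.2 hz'.1)

/-- All the intervals lie in a common strip. -/
lemma IsRateFunction.exists_strip (h : IsRateFunction lam) :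
    ∃ K : ℝ, 0 ≤ K ∧ (∀ i j y, i ≠ j → rateInterval lam i j y ⊆ Ico 0 K) ∧
      ∀ i y, ∑ j, cutRate lam i j y ≤ K := by
  choose C hC using fun i => h.bounded i
  have hC' : ∀ i y, 0 < y → exitRate lam i y ≤ C i := fun i y hy => hC i ⟨y, hy, rfl⟩
  have hsum : ∀ i y, ∑ j, cutRate lam i j y ≤ max (C i) 0 := by
    intro i y
    by_cases hy : 0 < y
    · rw [← exitRate_eq_sum_cutRate hy]
      exact (hC' i y hy).trans (le_max_left _ _)
    · simp [cutRate, hy]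
  -- The total length of all the intervals is the sum over `i` of the exit rates; the maximum with
  -- `0` keeps the bound valid for ages `y ≤ 0`, where the cut-off rates vanish.
  refine ⟨∑ i, max (C i) 0, Finset.sum_nonneg fun i _ => le_max_right _ _, ?_, fun i y => ?_⟩
  · intro i j y hij
    by_cases hy : 0 < y
    swap
    · simp [rateInterval, hy]
    simp only [rateInterval, hy, if_true]
    have hnot : (i, j) ∉ Finset.univ.filter
        (fun p : Fin k × Fin k => p.1 ≠ p.2 ∧ toLex p < toLex (i, j)) := by simp
    refine Ico_subset_Ico ?_ ?_
    · rw [leftEnd_eq_sum_cutRate hy]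
      exact Finset.sum_nonneg fun p _ => h.cutRate_nonneg _ _ _
    · rw [leftEnd_eq_sum_cutRate hy, ← cutRate_of_pos (lam := lam) hij hy, add_comm,
        ← Finset.sum_insert (f := fun p : Fin k × Fin k => cutRate lam p.1 p.2 y) hnot]
      calc _ ≤ ∑ p : Fin k × Fin k, cutRate lam p.1 p.2 y :=
            Finset.sum_le_sum_of_subset_of_nonneg (Finset.subset_univ _)
              fun p _ _ => h.cutRate_nonneg _ _ _
        _ = ∑ i, ∑ j, cutRate lam i j y := Fintype.sum_prod_type _
        _ ≤ _ := Finset.sum_le_sum fun i _ => hsum i y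
  · exact (hsum i y).trans (Finset.single_le_sum (f := fun i => max (C i) 0)
      (fun i _ => le_max_right _ _) (Finset.mem_univ i))

end Rates

/-! ### Step paths -/

/-- Induction along `[a, ∞)`: a property which holds at `a`, propagates to the right of each time
at which it holds, and is closed from the left, holds on all of `[a, ∞)`. -/
lemma nnreal_induction {p : ℝ≥0 → Prop} {a : ℝ≥0} (ha : p a)
    (right : ∀ t, a ≤ t → p t → ∃ r > t, ∀ s, t ≤ s → s < r → p s)
    (left : ∀ t, a < t → (∀ s, a ≤ s → s < t → p s) → p t) : ∀ t, a ≤ t → p t := by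
  by_contra! hcon
  obtain ⟨t₀, hat₀, ht₀⟩ := hcon
  set B : Set ℝ≥0 := {t | a ≤ t ∧ ¬ p t} with hB
  have hne : B.Nonempty := ⟨t₀, hat₀, ht₀⟩
  have hbd : BddBelow B := OrderBot.bddBelow B
  set u := sInf B with hu
  have hau : a ≤ u := le_csInf hne fun t ht => ht.1
  have hlt : ∀ s, a ≤ s → s < u → p s := by
    intro s has hsu
    by_contra hs
    exact absurd (csInf_le hbd ⟨has, hs⟩) (not_le.2 hsu)
  have hpu : p u := by
    rcases hau.eq_or_lt with h | h
    · rwa [← h]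
    · exact left u h hlt
  obtain ⟨r, hr, hpr⟩ := right u hau hpu
  obtain ⟨b, hbB, hbr⟩ := exists_lt_of_csInf_lt hne hr
  exact hbB.2 (hpr b (csInf_le hbd hbB) hbr)

/-- A pair of step paths: `x` is the state and `l t` the time of the last jump before `t`, so that
`x` changes exactly when `l` does, and `l t = t` at a jump time `t`. -/
structure IsStepPath {α : Type*} (x : ℝ≥0 → α) (l : ℝ≥0 → ℝ) : Prop where
  init : l 0 ≤ 0
  right : ∀ t, ∃ r > t, ∀ s, t ≤ s → s < r → x s = x t ∧ l s = l t
  left : ∀ t, 0 < t → ∃ s < t, (∀ r, s ≤ r → r < t → x r = x s ∧ l r = l s) ∧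
    ((x t = x s ∧ l t = l s) ∨ (x t ≠ x s ∧ l t = t))

namespace IsStepPath

variable {α : Type*} {x : ℝ≥0 → α} {l : ℝ≥0 → ℝ}

lemma le_self (h : IsStepPath x l) (t : ℝ≥0) : l t ≤ t := by
  refine nnreal_induction (p := fun t => l t ≤ t) (a := 0) (by simpa using h.init) ?_ ?_ t
    (zero_le)
  · intro t _ ht
    obtain ⟨r, hr, H⟩ := h.right t
    refine ⟨r, hr, fun s hts hsr => ?_⟩
    rw [(H s hts hsr).2]
    exact ht.trans (by exact_mod_cast hts)
  · intro t ht hlt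
    obtain ⟨s, hst, -, (⟨-, h2⟩ | ⟨-, h2⟩)⟩ := h.left t ht
    · rw [h2]
      exact (hlt s zero_le hst).trans (by exact_mod_cast hst.le)
    · exact h2.le

/-- Induction along `[s, ∞)`: the alternative persists as long as the path is constant, and a jump
at a time `t > s` sets `l t = t > s`. -/
lemma eq_or_lt (h : IsStepPath x l) {s t : ℝ≥0} (hst : s ≤ t) :
    (x t = x s ∧ l t = l s) ∨ (s : ℝ) < l t := by
  refine nnreal_induction (p := fun t => (x t = x s ∧ l t = l s) ∨ (s : ℝ) < l t) (a := s)
    (Or.inl ⟨rfl, rfl⟩) ?_ ?_ t hst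
  · intro t _ ht
    obtain ⟨r, hr, H⟩ := h.right t
    refine ⟨r, hr, fun v hv hvr => ?_⟩
    rwa [(H v hv hvr).1, (H v hv hvr).2]
  · intro t ht hlt
    obtain ⟨v, hvt, hv, (⟨h1, h2⟩ | ⟨-, h2⟩)⟩ := h.left t (zero_le.trans_lt ht)
    · have hm := hlt (max s v) (le_max_left _ _) (max_lt ht hvt)
      have hv' := hv (max s v) (le_max_right _ _) (max_lt ht hvt)
      rw [hv'.1, hv'.2] at hm
      rwa [h1, h2]
    · right
      rw [h2]
      exact_mod_cast ht

lemma monotone (h : IsStepPath x l) : Monotone l := by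
  intro s t hst
  rcases h.eq_or_lt hst with h1 | h1
  · exact h1.2.ge
  · exact (h.le_self s).trans h1.le

/-- A jump in between would give `s < l t = l s ≤ s`. Thus the last jump time determines the state,
and later arguments need only follow `l`. -/
lemma state_eq_of_eq (h : IsStepPath x l) {s t : ℝ≥0} (hst : l s = l t) : x s = x t := by
  wlog hle : s ≤ t generalizing s t
  · exact (this hst.symm (le_of_not_ge hle)).symm
  rcases h.eq_or_lt hle with h1 | h1
  · exact h1.1.symm
  · exact absurd (h1.trans_le (hst ▸ h.le_self s)) (lt_irrefl _)

/-- `u` is the first jump time after `t`. -/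
def IsNext (x : ℝ≥0 → α) (l : ℝ≥0 → ℝ) (t u : ℝ≥0) : Prop :=
  t < u ∧ (∀ s, t ≤ s → s < u → l s = l t) ∧ l u = u ∧ x u ≠ x t

/-- After each time there is either a next jump, or no jump at all. -/
lemma const_or_exists_isNext (h : IsStepPath x l) (t : ℝ≥0) :
    (∀ s, t ≤ s → l s = l t) ∨ ∃ u, IsNext x l t u := by
  by_cases hE : ∀ s, t ≤ s → l s = l t
  · exact Or.inl hE
  right
  push Not at hE
  set B : Set ℝ≥0 := {s | t ≤ s ∧ l s ≠ l t} with hB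
  have hne : B.Nonempty := hE
  have hbd : BddBelow B := OrderBot.bddBelow B
  set u := sInf B with hu
  have hlt : ∀ s, t ≤ s → s < u → l s = l t := by
    intro s hts hsu
    by_contra hs
    exact absurd (csInf_le hbd ⟨hts, hs⟩) (not_le.2 hsu)
  have htu : t ≤ u := le_csInf hne fun s hs => hs.1
  -- The infimum of the times with a different value is attained, because `l` is constant
  -- immediately to the right of `u`.
  have hlu : l u ≠ l t := by
    intro hlu
    obtain ⟨r, hr, H⟩ := h.right u
    obtain ⟨b, hbB, hbr⟩ := exists_lt_of_csInf_lt hne hr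
    exact hbB.2 ((H b (csInf_le hbd hbB) hbr).2.trans hlu)
  have htu' : t < u := lt_of_le_of_ne htu fun h0 => hlu (by rw [← h0])
  obtain ⟨v, hvu, hv, h12⟩ := h.left u (zero_le.trans_lt htu')
  have hm := hlt (max t v) (le_max_left _ _) (max_lt htu' hvu)
  have hv' := hv (max t v) (le_max_right _ _) (max_lt htu' hvu)
  have hlv : l v = l t := hv'.2.symm.trans hm
  rcases h12 with ⟨-, h2⟩ | ⟨h1, h2⟩
  · exact absurd (h2.trans hlv) hlu
  · exact ⟨u, htu', hlt, h2, by rwa [← h.state_eq_of_eq hlv]⟩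

end IsStepPath

/-! ### Simple configurations of points -/

/-- A realization of the noise which is integer-valued, finite on bounded pieces of the strip
`ℝ₊ × [0, K)`, and has at most one point in the strip at each time. -/
structure IsSimpleConfiguration (m : Measure (ℝ≥0 × ℝ)) (K : ℝ) : Prop where
  integer : ∀ A : Set (ℝ≥0 × ℝ), MeasurableSet A → ∃ n : ℕ∞, m A = (n : ℝ≥0∞)
  finite : ∀ t : ℝ≥0, m (Ioc 0 t ×ˢ Ico 0 K) ≠ ∞
  simple : ∀ t : ℝ≥0, 0 < t → m ({t} ×ˢ Ico 0 K) ≤ 1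

namespace IsSimpleConfiguration

variable {m : Measure (ℝ≥0 × ℝ)} {K : ℝ}

lemma eq_zero_or_one_le (h : IsSimpleConfiguration m K) {A : Set (ℝ≥0 × ℝ)}
    (hA : MeasurableSet A) : m A = 0 ∨ 1 ≤ m A := by
  obtain ⟨n, hn⟩ := h.integer A hA
  rcases eq_or_ne n 0 with h0 | h0
  · left; rw [hn, h0]; simp
  · right
    rw [hn]
    exact_mod_cast Order.one_le_iff_ne_zero.2 h0

/-- The masses tend to `0` by continuity from above, and an integer below `1` is `0`. This turns
local finiteness into intervals free of points on either side of a given time. -/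
lemma exists_null_of_antitone (h : IsSimpleConfiguration m K) {A : ℕ → Set (ℝ≥0 × ℝ)}
    (hA : ∀ n, MeasurableSet (A n)) (hanti : Antitone A) (hfin : m (A 0) ≠ ∞)
    (hempty : ⋂ n, A n = ∅) : ∃ n, m (A n) = 0 := by
  have := tendsto_measure_iInter_atTop (μ := m) (fun n => (hA n).nullMeasurableSet) hanti
    ⟨0, hfin⟩
  rw [hempty, measure_empty] at this
  obtain ⟨n, hn⟩ := (this.eventually (gt_mem_nhds zero_lt_one)).exists
  exact ⟨n, (h.eq_zero_or_one_le (hA n)).resolve_right (not_le.2 hn)⟩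

lemma exists_left_null (h : IsSimpleConfiguration m K) {t : ℝ≥0} (ht : 0 < t) :
    ∃ s < t, m (Ioo s t ×ˢ Ico 0 K) = 0 := by
  obtain ⟨u, hu, hut, hlim⟩ := exists_seq_strictMono_tendsto' ht
  have hempty : ⋂ n, (Ioo (u n) t ×ˢ Ico 0 K : Set (ℝ≥0 × ℝ)) = ∅ := by
    refine eq_empty_of_forall_notMem fun p hp => ?_
    rw [mem_iInter] at hp
    have h1 : t ≤ p.1 := le_of_tendsto' hlim fun n => (hp n).1.1.le
    exact absurd (hp 0).1.2 (not_lt.2 h1)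
  obtain ⟨n, hn⟩ := h.exists_null_of_antitone (A := fun n => Ioo (u n) t ×ˢ Ico 0 K)
    (fun n => measurableSet_Ioo.prod measurableSet_Ico)
    (fun a b hab => Set.prod_mono (Ioo_subset_Ioo_left (hu.monotone hab)) subset_rfl)
    (measure_ne_top_of_subset (Set.prod_mono (show Ioo (u 0) t ⊆ Ioc 0 t from fun v hv => ⟨(hut 0).1.trans hv.1, hv.2.le⟩) subset_rfl)
      (h.finite t)) hempty
  exact ⟨u n, (hut n).2, hn⟩

lemma exists_right_null (h : IsSimpleConfiguration m K) (t : ℝ≥0) :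
    ∃ r > t, m (Ioc t r ×ˢ Ico 0 K) = 0 := by
  obtain ⟨u, hu, hut, hlim⟩ := exists_seq_strictAnti_tendsto' (show t < t + 1 by simp)
  have hempty : ⋂ n, (Ioc t (u n) ×ˢ Ico 0 K : Set (ℝ≥0 × ℝ)) = ∅ := by
    refine eq_empty_of_forall_notMem fun p hp => ?_
    rw [mem_iInter] at hp
    have h1 : p.1 ≤ t := ge_of_tendsto' hlim fun n => (hp n).1.2
    exact absurd (hp 0).1.1 (not_lt.2 h1)
  obtain ⟨n, hn⟩ := h.exists_null_of_antitone (A := fun n => Ioc t (u n) ×ˢ Ico 0 K)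
    (fun n => measurableSet_Ioc.prod measurableSet_Ico)
    (fun a b hab => Set.prod_mono (Ioc_subset_Ioc_right (hu.antitone hab)) subset_rfl)
    (measure_ne_top_of_subset (Set.prod_mono
      (show Ioc t (u 0) ⊆ Ioc 0 (u 0) from fun v hv => ⟨zero_le.trans_lt hv.1, hv.2⟩) subset_rfl) (h.finite (u 0))) hempty
  exact ⟨u n, (hut n).1, hn⟩

/-- Over a time interval whose interior carries no point of the strip, the integral of a function
supported in the strip reduces to the last time. -/
lemma setIntegral_Ioc_eq_sum (h : IsSimpleConfiguration m K) {F : ℝ≥0 × ℝ → ℝ}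
    (hF : ∀ p : ℝ≥0 × ℝ, p.2 ∉ Ico 0 K → F p = 0) {s t : ℝ≥0} (hst : s < t)
    (hnull : m (Ioo s t ×ˢ Ico 0 K) = 0) {ι : Type*} (J : Finset ι) (c : ι → ℝ) (Λ : ι → Set ℝ)
    (hΛ : ∀ j ∈ J, MeasurableSet (Λ j)) (hΛK : ∀ j ∈ J, Λ j ⊆ Ico 0 K)
    (hFt : ∀ z, F (t, z) = ∑ j ∈ J, c j * (Λ j).indicator (fun _ => (1 : ℝ)) z) :
    ∫ p in Ioc s t ×ˢ univ, F p ∂m = ∑ j ∈ J, c j * m.real ({t} ×ˢ Λ j) := by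
  have h1 : ∫ p in Ioc s t ×ˢ univ, F p ∂m = ∫ p in Ioc s t ×ˢ Ico 0 K, F p ∂m := by
    refine setIntegral_eq_of_subset_of_forall_sdiff_eq_zero
      (measurableSet_Ioc.prod MeasurableSet.univ) (Set.prod_mono subset_rfl (subset_univ _)) ?_
    intro p hp
    exact hF p fun hpK => hp.2 ⟨hp.1.1, hpK⟩
  have hsplit : Ioc s t ×ˢ Ico 0 K = Ioo s t ×ˢ Ico 0 K ∪ {t} ×ˢ Ico (0 : ℝ) K := by
    rw [← union_prod, Ioo_union_right hst]
  have h2 : (Ioc s t ×ˢ Ico 0 K : Set (ℝ≥0 × ℝ)) =ᵐ[m] ({t} ×ˢ Ico 0 K : Set (ℝ≥0 × ℝ)) := by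
    rw [hsplit]
    exact union_ae_eq_right_of_ae_eq_empty (ae_eq_empty.2 hnull)
  have hmeas : MeasurableSet ({t} ×ˢ Ico 0 K : Set (ℝ≥0 × ℝ)) :=
    (measurableSet_singleton t).prod measurableSet_Ico
  have hJm : ∀ j ∈ J, MeasurableSet ({t} ×ˢ Λ j : Set (ℝ≥0 × ℝ)) := fun j hj =>
    (measurableSet_singleton t).prod (hΛ j hj)
  have h3 : EqOn F (fun p => ∑ j ∈ J, ({t} ×ˢ Λ j : Set (ℝ≥0 × ℝ)).indicator (fun _ => c j) p)
      ({t} ×ˢ Ico 0 K) := by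
    rintro ⟨u, z⟩ ⟨hu, hz⟩
    obtain rfl : u = t := hu
    simp only [hFt]
    refine Finset.sum_congr rfl fun j _ => ?_
    by_cases hzj : z ∈ Λ j <;> simp [hzj]
  have hfin : m ({t} ×ˢ Ico 0 K) ≠ ∞ :=
    ((h.simple t (zero_le.trans_lt hst)).trans_lt ENNReal.one_lt_top).ne
  rw [h1, setIntegral_congr_set h2, setIntegral_congr_fun hmeas h3, integral_finsetSum]
  · refine Finset.sum_congr rfl fun j hj => ?_
    rw [setIntegral_indicator (hJm j hj), ← prod_inter, inter_eq_right.2 (hΛK j hj),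
      setIntegral_const, smul_eq_mul, mul_comm]
  · intro j hj
    have : IsFiniteMeasure (m.restrict ({t} ×ˢ Ico 0 K)) :=
      ⟨by rw [Measure.restrict_apply_univ]; exact hfin.lt_top⟩
    exact (integrable_const (c j)).indicator (hJm j hj)

end IsSimpleConfiguration

lemma setIntegral_Ioc_add {m : Measure (ℝ≥0 × ℝ)} {F : ℝ≥0 × ℝ → ℝ} {s t : ℝ≥0} (hst : s ≤ t)
    (hF : IntegrableOn F (Ioc 0 t ×ˢ univ) m) :
    ∫ p in Ioc 0 t ×ˢ univ, F p ∂m =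
      ∫ p in Ioc 0 s ×ˢ univ, F p ∂m + ∫ p in Ioc s t ×ˢ univ, F p ∂m := by
  have hun : (Ioc 0 t ×ˢ univ : Set (ℝ≥0 × ℝ)) = Ioc 0 s ×ˢ univ ∪ Ioc s t ×ˢ univ := by
    rw [← union_prod, Ioc_union_Ioc_eq_Ioc zero_le hst]
  rw [hun] at hF ⊢
  refine setIntegral_union ?_ (measurableSet_Ioc.prod MeasurableSet.univ)
    (hF.mono_set subset_union_left) (hF.mono_set subset_union_right)
  rw [Set.disjoint_prod]
  exact Or.inl (Set.Ioc_disjoint_Ioc_of_le le_rfl)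

/-! ### Pathwise analysis of the equations -/

section Path

variable {k : ℕ} {lam : Fin k → Fin k → ℝ → ℝ} {m : Measure (ℝ≥0 × ℝ)} {K : ℝ}
  {x : ℝ≥0 → Fin k} {y : ℝ≥0 → ℝ}

/-- The pathwise form of the equations for `(X, Y)`. -/
structure SolvesEquations (lam : Fin k → Fin k → ℝ → ℝ) (m : Measure (ℝ≥0 × ℝ))
    (x : ℝ≥0 → Fin k) (y : ℝ≥0 → ℝ) : Prop where
  nonneg : 0 ≤ y 0
  integrable_h : ∀ t, IntegrableOn (alongPath (hFun lam) x y) (Ioc 0 t ×ˢ univ) m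
  integrable_g : ∀ t, IntegrableOn (alongPath (gFun lam) x y) (Ioc 0 t ×ˢ univ) m
  eq_h : ∀ t, stateVal (x t) = stateVal (x 0) +
    ∫ p in Ioc 0 t ×ˢ univ, alongPath (hFun lam) x y p ∂m
  eq_g : ∀ t, y t = y 0 + (t : ℝ) - ∫ p in Ioc 0 t ×ˢ univ, alongPath (gFun lam) x y p ∂m

lemma stateVal_injective : Function.Injective (stateVal (k := k)) := by
  intro i j hij
  simp only [stateVal, add_left_inj, Nat.cast_inj] at hij
  exact Fin.ext hij

lemma hFun_eq_zero (hstrip : ∀ i j y, i ≠ j → rateInterval lam i j y ⊆ Ico 0 K) (i : Fin k)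
    (v : ℝ) {z : ℝ} (hz : z ∉ Ico 0 K) : hFun lam i v z = 0 := by
  refine Finset.sum_eq_zero fun j hj => ?_
  rw [indicator_of_notMem fun h => hz (hstrip i j v (Finset.mem_filter.1 hj).2.symm h), mul_zero]

lemma gFun_eq_zero (hstrip : ∀ i j y, i ≠ j → rateInterval lam i j y ⊆ Ico 0 K) (i : Fin k)
    (v : ℝ) {z : ℝ} (hz : z ∉ Ico 0 K) : gFun lam i v z = 0 := by
  rw [gFun, Finset.sum_eq_zero, mul_zero]
  intro j hj
  rw [indicator_of_notMem fun h => hz (hstrip i j v (Finset.mem_filter.1 hj).2.symm h)]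

namespace SolvesEquations

lemma state_increment (h : SolvesEquations lam m x y) {s t : ℝ≥0} (hst : s ≤ t) :
    stateVal (x t) = stateVal (x s) +
      ∫ p in Ioc s t ×ˢ univ, alongPath (hFun lam) x y p ∂m := by
  have h1 := h.eq_h t
  rw [setIntegral_Ioc_add hst (h.integrable_h t), ← add_assoc, ← h.eq_h s] at h1
  exact h1

lemma age_increment (h : SolvesEquations lam m x y) {s t : ℝ≥0} (hst : s ≤ t) :
    (t : ℝ) - y t = (s - y s) +
      ∫ p in Ioc s t ×ˢ univ, alongPath (gFun lam) x y p ∂m := by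
  have h1 := h.eq_g t
  have h2 := h.eq_g s
  rw [setIntegral_Ioc_add hst (h.integrable_g t)] at h1
  linarith

lemma const_of_null (h : SolvesEquations lam m x y)
    (hstrip : ∀ i j y, i ≠ j → rateInterval lam i j y ⊆ Ico 0 K) {s t : ℝ≥0} (hst : s ≤ t)
    (hnull : m (Ioc s t ×ˢ Ico 0 K) = 0) : x t = x s ∧ (t : ℝ) - y t = s - y s := by
  have hint : ∀ F : ℝ≥0 × ℝ → ℝ, (∀ p : ℝ≥0 × ℝ, p.2 ∉ Ico 0 K → F p = 0) →
      ∫ p in Ioc s t ×ˢ univ, F p ∂m = 0 := by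
    intro F hF
    rw [setIntegral_eq_of_subset_of_forall_sdiff_eq_zero (s := Ioc s t ×ˢ Ico 0 K)
      (measurableSet_Ioc.prod MeasurableSet.univ) (Set.prod_mono subset_rfl (subset_univ _))]
    · exact setIntegral_measure_zero F hnull
    · intro p hp
      exact hF p fun hpK => hp.2 ⟨hp.1.1, hpK⟩
  constructor
  · apply stateVal_injective
    rw [h.state_increment hst, hint (alongPath (hFun lam) x y) fun p hp => hFun_eq_zero hstrip _ _ hp, add_zero]
  · rw [h.age_increment hst, hint (alongPath (gFun lam) x y) fun p hp => gFun_eq_zero hstrip _ _ hp, add_zero]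

/-- The behaviour of a solution at the time `t > 0`: there is a jump to `j` if the configuration
has a point in `{t} × Λ_{ij}(t - l)`, where `i` is the state and `l` the time of the last jump
before `t`, and no jump if there is no such point. -/
lemma exists_left (h : SolvesEquations lam m x y) (hm : IsSimpleConfiguration m K)
    (hlam : IsRateFunction lam)
    (hstrip : ∀ i j y, i ≠ j → rateInterval lam i j y ⊆ Ico 0 K) {t : ℝ≥0} (ht : 0 < t) :
    ∃ s < t, (∀ r, s ≤ r → r < t → x r = x s ∧ (r : ℝ) - y r = s - y s) ∧
      m (Ioo s t ×ˢ Ico 0 K) = 0 ∧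
      (((∀ j, x s ≠ j → m ({t} ×ˢ rateInterval lam (x s) j (t - (s - y s))) = 0) ∧
          x t = x s ∧ t - y t = s - y s) ∨
        ∃ j, x s ≠ j ∧ x t = j ∧ (t : ℝ) - y t = t ∧ ∀ j', x s ≠ j' →
          m ({t} ×ˢ rateInterval lam (x s) j' (t - (s - y s))) = if j' = j then 1 else 0) := by
  obtain ⟨s, hst, hnull⟩ := hm.exists_left_null ht
  have hconst : ∀ r, s ≤ r → r < t → x r = x s ∧ (r : ℝ) - y r = s - y s := fun r hsr hrt =>
    h.const_of_null hstrip hsr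
      (measure_mono_null (Set.prod_mono (show Ioc s r ⊆ Ioo s t from fun v hv => ⟨hv.1, hv.2.trans_lt hrt⟩) subset_rfl) hnull)
  refine ⟨s, hst, hconst, hnull, ?_⟩
  have hnebot : (𝓝[<] t).NeBot := nhdsLT_neBot_of_exists_lt ⟨0, ht⟩
  have hmem : Ioo s t ∈ 𝓝[<] t := Ioo_mem_nhdsLT hst
  have hxl : Function.leftLim x t = x s := by
    refine leftLim_eq_of_tendsto (tendsto_const_nhds.congr' ?_)
    filter_upwards [hmem] with r hr using (hconst r hr.1.le hr.2).1.symm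
  -- `η` is the age just before `t`: on `[s, t)` the age has slope one.
  set η : ℝ := t - (s - y s) with hη
  have hyl : Function.leftLim y t = η := by
    refine leftLim_eq_of_tendsto ?_
    have hlim : Tendsto (fun r : ℝ≥0 => (r : ℝ) - (s - y s)) (𝓝[<] t) (𝓝 η) :=
      ((NNReal.continuous_coe.tendsto t).mono_left nhdsWithin_le_nhds).sub_const _
    refine hlim.congr' ?_
    filter_upwards [hmem] with r hr
    have := (hconst r hr.1.le hr.2).2
    linarith
  set i := x s with hi
  set J := Finset.univ.filter (fun j : Fin k => j ≠ i) with hJ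
  have hJi : ∀ j ∈ J, i ≠ j := fun j hj => (Finset.mem_filter.1 hj).2.symm
  set p : Fin k → ℝ≥0∞ := fun j => m ({t} ×ˢ rateInterval lam i j η) with hp
  have hΛ : ∀ j ∈ J, MeasurableSet (rateInterval lam i j η) := fun j hj =>
    hlam.measurableSet_rateInterval_apply (hJi j hj) η
  have hX : stateVal (x t) = stateVal i + ∑ j ∈ J, (stateVal j - stateVal i) * (p j).toReal := by
    rw [h.state_increment hst.le, hm.setIntegral_Ioc_eq_sum (F := alongPath (hFun lam) x y)
      (fun q hq => hFun_eq_zero hstrip _ _ hq) hst hnull J (fun j => stateVal j - stateVal i)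
      (fun j => rateInterval lam i j η) hΛ (fun j hj => hstrip i j η (hJi j hj))]
    · rfl
    · intro z
      simp only [alongPath, hxl, hyl, hFun, hJ]
  have hY : (t : ℝ) - y t = s - y s + ∑ j ∈ J, η * (p j).toReal := by
    rw [h.age_increment hst.le, hm.setIntegral_Ioc_eq_sum (F := alongPath (gFun lam) x y)
      (fun q hq => gFun_eq_zero hstrip _ _ hq) hst hnull J (fun j => η)
      (fun j => rateInterval lam i j η) hΛ (fun j hj => hstrip i j η (hJi j hj))]
    · rfl
    · intro z
      simp only [alongPath, hxl, hyl, gFun, hJ, Finset.mul_sum]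
  by_cases hall : ∀ j, i ≠ j → p j = 0
  · left
    refine ⟨hall, stateVal_injective ?_, ?_⟩
    · rw [hX, Finset.sum_eq_zero, add_zero]
      intro j hj
      rw [hall j (hJi j hj)]; simp
    · rw [hY, Finset.sum_eq_zero, add_zero]
      intro j hj
      rw [hall j (hJi j hj)]; simp
  · right
    push Not at hall
    obtain ⟨j, hij, hj0⟩ := hall
    have hms : ∀ j, i ≠ j → MeasurableSet ({t} ×ˢ rateInterval lam i j η : Set (ℝ≥0 × ℝ)) :=
      fun j hj => (measurableSet_singleton t).prod (hlam.measurableSet_rateInterval_apply hj η)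
    have hj1 : 1 ≤ p j := (hm.eq_zero_or_one_le (hms j hij)).resolve_left hj0
    -- Points in two disjoint intervals at the same time `t` would give the strip mass at least `2`
    -- at that time.
    have hother : ∀ j', i ≠ j' → j' ≠ j → p j' = 0 := by
      intro j' hij' hne
      refine (hm.eq_zero_or_one_le (hms j' hij')).resolve_right fun hj'1 => ?_
      have hdisj : Disjoint ({t} ×ˢ rateInterval lam i j η : Set (ℝ≥0 × ℝ))
          ({t} ×ˢ rateInterval lam i j' η) :=
        Set.disjoint_prod.2 (Or.inr (hlam.disjoint_rateInterval hij hij' hne.symm η))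
      have h2 : p j + p j' ≤ 1 := by
        rw [hp, ← measure_union hdisj (hms j' hij')]
        refine (measure_mono ?_).trans (hm.simple t ht)
        rw [← prod_union]
        exact Set.prod_mono subset_rfl (union_subset (hstrip i j η hij) (hstrip i j' η hij'))
      have h3 : (1 : ℝ≥0∞) + 1 ≤ 1 := (add_le_add hj1 hj'1).trans h2
      norm_num at h3
    have hj1' : p j = 1 := by
      refine le_antisymm ((measure_mono ?_).trans (hm.simple t ht)) hj1
      exact Set.prod_mono subset_rfl (hstrip i j η hij)
    have hjJ : j ∈ J := Finset.mem_filter.2 ⟨Finset.mem_univ _, hij.symm⟩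
    refine ⟨j, hij, stateVal_injective ?_, ?_, fun j' hij' => ?_⟩
    · rw [hX, Finset.sum_eq_single_of_mem j hjJ, hj1']
      · simp
      · intro j' hj' hne
        rw [hother j' (hJi j' hj') hne]; simp
    -- The jump adds exactly `η` to `s - y s`, and `η = t - (s - y s)`: the age restarts at `0`.
    · rw [hY, Finset.sum_eq_single_of_mem j hjJ, hj1']
      · simp [hη]
      · intro j' hj' hne
        rw [hother j' (hJi j' hj') hne]; simp
    · split_ifs with hjj
      · rw [hjj]; exact hj1'
      · exact hother j' hij' hjj

/-- The local description of `exists_left` on the left of each time and a point-free interval on the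
right give the step structure; the initial condition is `-Y_0 ≤ 0`. -/
lemma isStepPath (h : SolvesEquations lam m x y) (hm : IsSimpleConfiguration m K)
    (hlam : IsRateFunction lam)
    (hstrip : ∀ i j y, i ≠ j → rateInterval lam i j y ⊆ Ico 0 K) :
    IsStepPath x (fun t => (t : ℝ) - y t) where
  init := by simpa using h.nonneg
  right t := by
    obtain ⟨r, hr, hnull⟩ := hm.exists_right_null t
    exact ⟨r, hr, fun s hts hsr => h.const_of_null hstrip hts
      (measure_mono_null (Set.prod_mono (Ioc_subset_Ioc_right hsr.le) subset_rfl) hnull)⟩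
  left t ht := by
    obtain ⟨s, hst, hconst, -, h12⟩ := h.exists_left hm hlam hstrip ht
    refine ⟨s, hst, hconst, ?_⟩
    rcases h12 with ⟨-, h1, h2⟩ | ⟨j, hj, h1, h2, -⟩
    · exact Or.inl ⟨h1, h2⟩
    · exact Or.inr ⟨by rw [h1]; exact hj.symm, h2⟩

end SolvesEquations

end Path

/-! ### Points of the noise which cause the next jump -/

section JumpRegion

variable {k : ℕ} {lam : Fin k → Fin k → ℝ → ℝ} {m : Measure (ℝ≥0 × ℝ)} {K : ℝ}
  {x : ℝ≥0 → Fin k} {y : ℝ≥0 → ℝ}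

/-- The region in which a point of the configuration produces the first jump after `σ`, when this
jump comes from `Λ` and occurs at a time `u` with `u - σ ∈ R`. -/
def jumpRegion (l : ℝ≥0 → ℝ) (σ : ℝ≥0) (R : Set ℝ) (Λ : ℝ → Set ℝ) : Set (ℝ≥0 × ℝ) :=
  {p | σ < p.1 ∧ (∀ s, σ ≤ s → s < p.1 → l s = l σ) ∧ (p.1 : ℝ) - σ ∈ R ∧ p.2 ∈ Λ (p.1 - l σ)}

namespace SolvesEquations

/-- Null sets can be recognized locally, which also avoids measurability questions. Near a time `u`
of the set, the strip has no points just before or just after `u`; at `u` itself there is no jump,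
so the relevant slice is empty of points. -/
lemma measure_no_jump (h : SolvesEquations lam m x y) (hm : IsSimpleConfiguration m K)
    (hlam : IsRateFunction lam) (hstrip : ∀ i j y, i ≠ j → rateInterval lam i j y ⊆ Ico 0 K)
    (σ : ℝ≥0) {j : Fin k} (hj : x σ ≠ j) :
    m {p : ℝ≥0 × ℝ | σ < p.1 ∧ (p.1 : ℝ) - y p.1 = σ - y σ ∧
      p.2 ∈ rateInterval lam (x σ) j (p.1 - (σ - y σ))} = 0 := by
  have hstep := h.isStepPath hm hlam hstrip
  set W := {p : ℝ≥0 × ℝ | σ < p.1 ∧ (p.1 : ℝ) - y p.1 = σ - y σ ∧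
      p.2 ∈ rateInterval lam (x σ) j (p.1 - (σ - y σ))} with hW
  refine measure_null_of_locally_null W ?_
  rintro ⟨u, z⟩ ⟨hσu, hl, -⟩
  simp only at hσu hl
  obtain ⟨s, hsu, hconst, hnull, h12⟩ := h.exists_left hm hlam hstrip (zero_le.trans_lt hσu)
  obtain ⟨r, hur, hnull'⟩ := hm.exists_right_null u
  have hslice : m ({u} ×ˢ rateInterval lam (x σ) j (u - (σ - y σ))) = 0 := by
    rcases h12 with ⟨h0, h1, h2⟩ | ⟨-, -, -, h2, -⟩
    · have hls : (s : ℝ) - y s = σ - y σ := h2.symm.trans hl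
      have hxs : x s = x σ := hstep.state_eq_of_eq hls
      rw [hxs, hls] at h0
      exact h0 j hj
    -- A jump at `u` would set the last jump time to `u > σ`, against its being equal to the value
    -- at `σ`, which is at most `σ`.
    · have := hstep.le_self σ
      rw [← hl, h2] at this
      exact absurd hσu (not_lt.2 (by exact_mod_cast this))
  refine ⟨W ∩ (Ioo s r ×ˢ univ), ?_, ?_⟩
  · refine inter_mem self_mem_nhdsWithin (mem_nhdsWithin_of_mem_nhds ?_)
    exact prod_mem_nhds (Ioo_mem_nhds hsu hur) univ_mem
  · refine measure_mono_null ?_ (measure_union_null (measure_union_null hnull hslice) hnull')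
    rintro ⟨v, w⟩ ⟨⟨_, _, hw⟩, hv, -⟩
    simp only at hw hv
    have hwK : w ∈ Ico 0 K := hstrip _ _ _ hj hw
    rcases lt_trichotomy v u with hvu | hvu | hvu
    · exact Or.inl (Or.inl ⟨⟨hv.1, hvu⟩, hwK⟩)
    · subst hvu
      exact Or.inl (Or.inr ⟨rfl, hw⟩)
    · exact Or.inr ⟨⟨hvu, hv.2.le⟩, hwK⟩

lemma measure_jumpRegion_of_const (h : SolvesEquations lam m x y) (hm : IsSimpleConfiguration m K)
    (hlam : IsRateFunction lam) (hstrip : ∀ i j y, i ≠ j → rateInterval lam i j y ⊆ Ico 0 K)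
    {σ : ℝ≥0} (hσ : ∀ s, σ ≤ s → (s : ℝ) - y s = σ - y σ) (R : Set ℝ) {j : Fin k}
    (hj : x σ ≠ j) :
    m (jumpRegion (fun t => (t : ℝ) - y t) σ R (rateInterval lam (x σ) j)) = 0 :=
  measure_mono_null (t := {p : ℝ≥0 × ℝ | σ < p.1 ∧ (p.1 : ℝ) - y p.1 = σ - y σ ∧
      p.2 ∈ rateInterval lam (x σ) j (p.1 - (σ - y σ))})
    (fun _ hp => ⟨hp.1, hσ _ hp.1.le, hp.2.2.2⟩) (h.measure_no_jump hm hlam hstrip σ hj)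

-- The region contains no time after `u`, since the last jump time has changed by then. Before `u`
-- it carries no mass by `measure_no_jump`. The time `u` itself is included, as the condition on `l`
-- concerns only earlier times, and the slice at `u` has a point in the interval of `j` precisely
-- when the jump goes to `j`.
open scoped Classical in
lemma measure_jumpRegion_of_isNext (h : SolvesEquations lam m x y)
    (hm : IsSimpleConfiguration m K) (hlam : IsRateFunction lam)
    (hstrip : ∀ i j y, i ≠ j → rateInterval lam i j y ⊆ Ico 0 K) {σ u : ℝ≥0}
    (hu : IsStepPath.IsNext x (fun t => (t : ℝ) - y t) σ u) (R : Set ℝ) {j : Fin k}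
    (hj : x σ ≠ j) :
    m (jumpRegion (fun t => (t : ℝ) - y t) σ R (rateInterval lam (x σ) j)) =
      if x u = j ∧ (u : ℝ) - σ ∈ R then 1 else 0 := by
  have hstep := h.isStepPath hm hlam hstrip
  obtain ⟨hσu, hconst, hlu, hxu⟩ := hu
  have hWnull := h.measure_no_jump hm hlam hstrip σ hj
  have hcases : ∀ p ∈ jumpRegion (fun t => (t : ℝ) - y t) σ R (rateInterval lam (x σ) j),
      p.1 < u ∨ p.1 = u := by
    rintro ⟨v, w⟩ ⟨_, hv2, _, _⟩
    refine lt_or_eq_of_le (not_lt.1 fun huv => ?_)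
    have h1 := hv2 u hσu.le huv
    have h2 := hstep.le_self σ
    simp only at h1 h2 hlu
    rw [← h1, hlu] at h2
    exact absurd hσu (not_lt.2 (by exact_mod_cast h2))
  have hslice : m ({u} ×ˢ rateInterval lam (x σ) j (u - (σ - y σ))) =
      if j = x u then 1 else 0 := by
    obtain ⟨s, hsu, hs, -, h12⟩ := h.exists_left hm hlam hstrip (zero_le.trans_lt hσu)
    have hls : (s : ℝ) - y s = σ - y σ := by
      rw [← (hs (max s σ) (le_max_left _ _) (max_lt hsu hσu)).2]
      exact hconst _ (le_max_right _ _) (max_lt hsu hσu)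
    have hxs : x s = x σ := hstep.state_eq_of_eq hls
    rcases h12 with ⟨-, h1, -⟩ | ⟨j₀, -, h1, -, h3⟩
    · exact absurd (h1.trans hxs) hxu
    · rw [hls, hxs] at h3
      rw [h3 j hj, h1]
  by_cases hR : (u : ℝ) - σ ∈ R
  · have : m (jumpRegion (fun t => (t : ℝ) - y t) σ R (rateInterval lam (x σ) j)) =
        m ({u} ×ˢ rateInterval lam (x σ) j (u - (σ - y σ))) := by
      refine le_antisymm ?_ (measure_mono ?_)
      · rw [← zero_add (m ({u} ×ˢ _)), ← hWnull]
        refine (measure_mono ?_).trans (measure_union_le _ _)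
        rintro ⟨v, w⟩ hp
        rcases hcases _ hp with hv | hv
        · exact Or.inl ⟨hp.1, hconst _ hp.1.le hv, hp.2.2.2⟩
        · obtain rfl : v = u := hv
          exact Or.inr ⟨rfl, hp.2.2.2⟩
      · rintro ⟨v, w⟩ ⟨hv, hw⟩
        obtain rfl : v = u := hv
        exact ⟨hσu, hconst, hR, hw⟩
    rw [this, hslice]
    simp only [hR, and_true, eq_comm]
  · simp only [hR, and_false, if_false]
    refine measure_mono_null ?_ hWnull
    rintro ⟨v, w⟩ hp
    rcases hcases _ hp with hv | hv
    · exact ⟨hp.1, hconst _ hp.1.le hv, hp.2.2.2⟩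
    · obtain rfl : v = u := hv
      exact absurd hp.2.2.1 hR

end SolvesEquations

end JumpRegion

/-! ### The Lebesgue intensity on the half-line -/

section Intensity

lemma measurableEmbedding_nnreal_coe : MeasurableEmbedding (fun u : ℝ≥0 => (u : ℝ)) :=
  NNReal.isClosedEmbedding_coe.measurableEmbedding

lemma lintegral_comap_nnreal_coe (f : ℝ → ℝ≥0∞) :
    ∫⁻ u : ℝ≥0, f u ∂(Measure.comap (fun u : ℝ≥0 => (u : ℝ)) volume) = ∫⁻ x in Ici 0, f x := by
  rw [← measurableEmbedding_nnreal_coe.lintegral_map, measurableEmbedding_nnreal_coe.map_comap]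
  congr 2
  ext x
  exact ⟨fun ⟨u, hu⟩ => hu ▸ u.2, fun hx => ⟨⟨x, hx⟩, rfl⟩⟩

instance : SigmaFinite (Measure.comap (fun u : ℝ≥0 => (u : ℝ)) volume) := by
  have h := measurableEmbedding_nnreal_coe
  have : IsLocallyFiniteMeasure (Measure.comap (fun u : ℝ≥0 => (u : ℝ)) volume) := by
    have : IsFiniteMeasureOnCompacts (Measure.comap (fun u : ℝ≥0 => (u : ℝ)) volume) :=
      .comap' _ NNReal.continuous_coe h
    infer_instance
  infer_instance

lemma comap_nnreal_coe_Ioc (s t : ℝ≥0) :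
    Measure.comap (fun u : ℝ≥0 => (u : ℝ)) volume (Ioc s t) = ENNReal.ofReal (t - s) := by
  rw [measurableEmbedding_nnreal_coe.comap_apply, ← Real.volume_Ioc]
  congr 1
  ext x
  constructor
  · rintro ⟨u, hu, rfl⟩
    exact ⟨by exact_mod_cast hu.1, by exact_mod_cast hu.2⟩
  · intro hx
    exact ⟨⟨x, s.2.trans hx.1.le⟩, ⟨hx.1, hx.2⟩, rfl⟩

instance : SigmaFinite lebesgueIntensity := by
  unfold lebesgueIntensity; infer_instance

lemma lebesgueIntensity_Ioc_prod (s t : ℝ≥0) (B : Set ℝ) :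
    lebesgueIntensity (Ioc s t ×ˢ B) = ENNReal.ofReal (t - s) * volume B := by
  rw [lebesgueIntensity, Measure.prod_prod, comap_nnreal_coe_Ioc]

end Intensity

/-! ### Moment bounds for Poisson random measures -/

namespace IsPoissonRandomMeasure

variable {Ω E : Type*} [MeasurableSpace Ω] [MeasurableSpace E] {P : Measure Ω}
  {N : Ω → Measure E} {μ : Measure E}

lemma measurable_apply (h : IsPoissonRandomMeasure P N μ) {A : Set E} (hA : MeasurableSet A) :
    Measurable fun ω => N ω A :=
  (Measure.measurable_coe hA).comp h.measurable

lemma measure_eq_natCast (h : IsPoissonRandomMeasure P N μ) {A : Set E} (hA : MeasurableSet A)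
    (hμA : μ A ≠ ∞) (n : ℕ) :
    P {ω | N ω A = (n : ℝ≥0∞)} = poissonMeasure (μ A).toNNReal {n} := by
  rw [h.poisson A hA hμA, poissonMeasure_singleton]
  rfl

/-- The expected number of points in a set is its intensity. -/
lemma lintegral_apply [IsProbabilityMeasure P] (h : IsPoissonRandomMeasure P N μ) {A : Set E}
    (hA : MeasurableSet A) (hμA : μ A ≠ ∞) : ∫⁻ ω, N ω A ∂P = μ A := by
  set r := (μ A).toNNReal with hr
  have hm := h.measurable_apply hA
  have hms : ∀ n : ℕ, MeasurableSet {ω | N ω A = (n : ℝ≥0∞)} := fun n =>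
    hm (measurableSet_singleton _)
  have hdisj : Pairwise (Function.onFun Disjoint fun n : ℕ => {ω | N ω A = (n : ℝ≥0∞)}) := by
    intro a b hab
    refine Set.disjoint_left.2 fun ω (ha : N ω A = a) (hb : N ω A = b) => hab ?_
    exact_mod_cast ha.symm.trans hb
  -- The Poisson weights of the finite values already add up to `1`, which excludes the value `∞`.
  have hfull : ∀ᵐ ω ∂P, ∃ n : ℕ, N ω A = n := by
    have h1 : P (⋃ n : ℕ, {ω | N ω A = (n : ℝ≥0∞)}) = 1 := by
      rw [measure_iUnion hdisj hms]
      simp_rw [h.measure_eq_natCast hA hμA]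
      rw [← measure_iUnion (fun a b hab => by simpa using hab) (fun n => measurableSet_singleton n),
        iUnion_of_singleton, measure_univ]
    have h2 := (prob_compl_eq_zero_iff (MeasurableSet.iUnion hms)).2 h1
    filter_upwards [measure_eq_zero_iff_ae_notMem.1 h2] with ω hω
    simpa using hω
  have hsum : ∀ᵐ ω ∂P, N ω A =
      ∑' n : ℕ, {ω | N ω A = (n : ℝ≥0∞)}.indicator (fun _ => (n : ℝ≥0∞)) ω := by
    filter_upwards [hfull] with ω ⟨n, hn⟩
    rw [tsum_eq_single n]
    · rw [indicator_of_mem (show ω ∈ {ω | N ω A = (n : ℝ≥0∞)} from hn), hn]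
    · intro b hb
      have hb' : ω ∉ {ω | N ω A = (b : ℝ≥0∞)} := fun hb' : N ω A = b =>
        hb (by exact_mod_cast hb'.symm.trans hn)
      rw [indicator_of_notMem hb']
  rw [lintegral_congr_ae hsum, lintegral_tsum fun n =>
    (measurable_const.indicator (hms n)).aemeasurable]
  have hterm : ∀ n : ℕ, ∫⁻ ω, {ω | N ω A = (n : ℝ≥0∞)}.indicator (fun _ => (n : ℝ≥0∞)) ω ∂P =
      n * poissonMeasure r {n} := fun n => by
    rw [lintegral_indicator_const (hms n), h.measure_eq_natCast hA hμA]
  simp_rw [hterm]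
  rw [tsum_eq_zero_add' ENNReal.summable]
  -- The identity `(n + 1) p_{n+1} = r p_n` for Poisson weights reduces the mean to `r` times the
  -- total mass.
  have hshift : ∀ n : ℕ, ((n + 1 : ℕ) : ℝ≥0∞) * poissonMeasure r {n + 1} =
      r * poissonMeasure r {n} := fun n => by
    rw [poissonMeasure_singleton, poissonMeasure_singleton, ← ENNReal.ofReal_natCast,
      ← ENNReal.ofReal_mul (by positivity), ← ENNReal.ofReal_coe_nnreal (p := r),
      ← ENNReal.ofReal_mul (by positivity)]
    congr 1
    rw [Nat.factorial_succ]
    push_cast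
    field_simp
    ring
  simp_rw [hshift]
  rw [ENNReal.tsum_mul_left, ← measure_iUnion (fun a b hab => by simpa using hab)
    (fun n => measurableSet_singleton n), iUnion_of_singleton, measure_univ]
  simp [hr, ENNReal.coe_toNNReal hμA]

/-- The probability of two or more points is at most the square of the intensity. -/
lemma measure_two_le [IsProbabilityMeasure P] (h : IsPoissonRandomMeasure P N μ) {A : Set E}
    (hA : MeasurableSet A) (hμA : μ A ≠ ∞) : P {ω | 2 ≤ N ω A} ≤ μ A ^ 2 := by
  set r := (μ A).toReal with hr
  have hr0 : 0 ≤ r := ENNReal.toReal_nonneg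
  have hm := h.measurable_apply hA
  have hms : ∀ n : ℕ, MeasurableSet {ω | N ω A = (n : ℝ≥0∞)} := fun n =>
    hm (measurableSet_singleton _)
  have hdisj : Disjoint {ω | N ω A = ((0 : ℕ) : ℝ≥0∞)} {ω | N ω A = ((1 : ℕ) : ℝ≥0∞)} := by
    refine Set.disjoint_left.2 fun ω (h0 : _ = _) (h1 : _ = _) => ?_
    rw [h0] at h1
    norm_num at h1
  have hsub : {ω | 2 ≤ N ω A} ⊆
      ({ω | N ω A = ((0 : ℕ) : ℝ≥0∞)} ∪ {ω | N ω A = ((1 : ℕ) : ℝ≥0∞)})ᶜ := by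
    rintro ω (h2 : 2 ≤ N ω A) (h0 | h0) <;>
    · rw [mem_ofPred_eq] at h0
      rw [h0] at h2
      norm_num at h2
  refine (measure_mono hsub).trans ?_
  rw [prob_compl_eq_one_sub ((hms 0).union (hms 1)), measure_union hdisj (hms 1),
    h.poisson A hA hμA, h.poisson A hA hμA, ← ENNReal.ofReal_add (by positivity) (by positivity),
    ← ENNReal.ofReal_toReal hμA, ← hr, ← ENNReal.ofReal_pow hr0, ← ENNReal.ofReal_one,
    ← ENNReal.ofReal_sub _ (by positivity)]
  refine ENNReal.ofReal_le_ofReal ?_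
  -- From `e^{-r} ≥ 1 - r` follows `1 - (1 + r) e^{-r} ≤ 1 - (1 + r)(1 - r) = r²`.
  have := Real.add_one_le_exp (-r)
  simp only [ENNReal.toReal_ofReal hr0]
  norm_num
  nlinarith [mul_le_mul_of_nonneg_left this hr0]

end IsPoissonRandomMeasure

/-! ### Almost every realization is simple in the strip -/

namespace IsPoissonRandomMeasure

variable {Ω : Type*} [MeasurableSpace Ω] {P : Measure Ω} [IsProbabilityMeasure P]
  {N : Ω → Measure (ℝ≥0 × ℝ)}

lemma ae_finite (h : IsPoissonRandomMeasure P N lebesgueIntensity) (K : ℝ) :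
    ∀ᵐ ω ∂P, ∀ t : ℝ≥0, N ω (Ioc 0 t ×ˢ Ico 0 K) ≠ ∞ := by
  have hn : ∀ᵐ ω ∂P, ∀ n : ℕ, N ω (Ioc 0 (n : ℝ≥0) ×ˢ Ico 0 K) < ∞ := by
    rw [ae_all_iff]
    intro n
    have hms : MeasurableSet (Ioc 0 (n : ℝ≥0) ×ˢ Ico 0 K) :=
      measurableSet_Ioc.prod measurableSet_Ico
    have hfin : lebesgueIntensity (Ioc 0 (n : ℝ≥0) ×ˢ Ico 0 K) ≠ ∞ := by
      rw [lebesgueIntensity_Ioc_prod, Real.volume_Ico]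
      exact ENNReal.mul_ne_top ENNReal.ofReal_ne_top ENNReal.ofReal_ne_top
    exact ae_lt_top (h.measurable_apply hms) (by rwa [h.lintegral_apply hms hfin])
  filter_upwards [hn] with ω hω t
  obtain ⟨n, hn⟩ := exists_nat_ge t
  exact measure_ne_top_of_subset (Set.prod_mono (Ioc_subset_Ioc_right hn) subset_rfl) (hω n).ne

/-- Almost surely there are no two points of the strip at the same time. -/
lemma ae_simple (h : IsPoissonRandomMeasure P N lebesgueIntensity) (K : ℝ) :
    ∀ᵐ ω ∂P, ∀ t : ℝ≥0, 0 < t → N ω ({t} ×ˢ Ico 0 K) ≤ 1 := by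
  have hn : ∀ n : ℕ, ∀ᵐ ω ∂P, ∀ t : ℝ≥0, 0 < t → t ≤ n → N ω ({t} ×ˢ Ico 0 K) ≤ 1 := by
    intro n
    rw [ae_iff]
    set C : ℝ≥0∞ := (ENNReal.ofReal n * ENNReal.ofReal (K - 0)) ^ 2 with hC
    have hCtop : C ≠ ∞ :=
      ENNReal.pow_ne_top (ENNReal.mul_ne_top ENNReal.ofReal_ne_top ENNReal.ofReal_ne_top)
    -- The time interval `(0, n]` is cut into `M + 1` cells. Two simultaneous points fall into one
    -- cell, which has probability of order `(M + 1)⁻²`; the union bound `C / (M + 1)` tends to `0`.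
    set I : ℕ → ℕ → Set (ℝ≥0 × ℝ) := fun M i =>
      Ioc ((n : ℝ≥0) * i / (M + 1)) ((n : ℝ≥0) * (i + 1) / (M + 1)) ×ˢ Ico 0 K with hI
    have hIm : ∀ M i, MeasurableSet (I M i) := fun M i => measurableSet_Ioc.prod measurableSet_Ico
    have hIμ : ∀ M i, lebesgueIntensity (I M i) =
        ENNReal.ofReal n * ENNReal.ofReal (K - 0) / (M + 1 : ℕ) := by
      intro M i
      rw [hI, lebesgueIntensity_Ioc_prod, Real.volume_Ico]
      have : ((((n : ℝ≥0) * (i + 1) / (M + 1) : ℝ≥0) : ℝ) - ((n : ℝ≥0) * i / (M + 1) : ℝ≥0)) =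
          n / (M + 1 : ℕ) := by
        push_cast
        field_simp
        ring
      rw [this, ENNReal.ofReal_div_of_pos (by positivity), ENNReal.ofReal_natCast (M + 1),
        ENNReal.mul_div_right_comm]
    have hIfin : ∀ M i, lebesgueIntensity (I M i) ≠ ∞ := by
      intro M i
      rw [hIμ]
      exact ENNReal.div_ne_top (ENNReal.mul_ne_top ENNReal.ofReal_ne_top ENNReal.ofReal_ne_top)
        (by simp)
    have hbound : ∀ M : ℕ, P {ω | ¬ ∀ t : ℝ≥0, 0 < t → t ≤ n → N ω ({t} ×ˢ Ico 0 K) ≤ 1} ≤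
        C / (M + 1 : ℕ) := by
      intro M
      have hcover : {ω | ¬ ∀ t : ℝ≥0, 0 < t → t ≤ n → N ω ({t} ×ˢ Ico 0 K) ≤ 1} ⊆
          ⋃ i ∈ Finset.range (M + 1), {ω | 2 ≤ N ω (I M i)} := by
        intro ω hω
        simp only [mem_ofPred_eq, not_forall, not_le] at hω
        obtain ⟨t, ht0, htn, ht⟩ := hω
        have hn0 : (0 : ℝ≥0) < n := ht0.trans_le htn
        have hv0 : 0 < t * (M + 1) / n := by positivity
        -- The cells are open on the left and closed on the right, so the cell containing `t` is
        -- found by rounding up.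
        obtain ⟨i, hi⟩ : ∃ i : ℕ, i + 1 = ⌈t * (M + 1) / n⌉₊ :=
          ⟨⌈t * (M + 1) / n⌉₊ - 1, Nat.sub_add_cancel (Nat.ceil_pos.2 hv0)⟩
        have hle : t * (M + 1) / n ≤ (i : ℝ≥0) + 1 := by
          have := Nat.le_ceil (t * (M + 1) / n)
          rw [← hi] at this
          exact_mod_cast this
        have hlt : (i : ℝ≥0) < t * (M + 1) / n := Nat.lt_ceil.1 (by omega)
        have hiM : i < M + 1 := by
          have h1 : (i : ℝ≥0) < (M + 1 : ℕ) := by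
            refine hlt.trans_le ?_
            rw [div_le_iff₀ hn0, mul_comm]
            push_cast
            gcongr
          exact_mod_cast h1
        simp only [mem_iUnion, Finset.mem_range]
        refine ⟨i, hiM, ?_⟩
        have hsub : ({t} ×ˢ Ico 0 K : Set (ℝ≥0 × ℝ)) ⊆ I M i := by
          refine Set.prod_mono (singleton_subset_iff.2 ⟨?_, ?_⟩) subset_rfl
          · rw [div_lt_iff₀ (by positivity), mul_comm]
            rwa [lt_div_iff₀ hn0] at hlt
          · rw [le_div_iff₀ (by positivity), mul_comm (n : ℝ≥0)]
            rwa [div_le_iff₀ hn0] at hle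
        refine le_trans ?_ (measure_mono hsub)
        obtain ⟨c, hc⟩ := h.integerValued ω ({t} ×ˢ Ico 0 K)
          ((measurableSet_singleton t).prod measurableSet_Ico)
        rw [hc] at ht ⊢
        have h1 : (1 : ℕ∞) < c := by exact_mod_cast ht
        have h2 : (2 : ℕ∞) ≤ c := by
          rw [← one_add_one_eq_two]
          exact Order.add_one_le_of_lt h1
        exact_mod_cast h2
      refine (measure_mono hcover).trans ((measure_biUnion_finset_le _ _).trans ?_)
      calc ∑ i ∈ Finset.range (M + 1), P {ω | 2 ≤ N ω (I M i)}
          ≤ ∑ i ∈ Finset.range (M + 1), C / ((M + 1 : ℕ) : ℝ≥0∞) ^ 2 := by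
            refine Finset.sum_le_sum fun i _ => (h.measure_two_le (hIm M i) (hIfin M i)).trans ?_
            rw [hIμ, hC, div_eq_mul_inv, mul_pow, ← ENNReal.inv_pow, div_eq_mul_inv]
        _ = C / (M + 1 : ℕ) := by
            rw [Finset.sum_const, Finset.card_range, nsmul_eq_mul, sq, div_eq_mul_inv,
              div_eq_mul_inv, ENNReal.mul_inv (by simp) (by simp), mul_left_comm,
              ← mul_assoc ((M + 1 : ℕ) : ℝ≥0∞), ENNReal.mul_inv_cancel (by simp) (by simp), one_mul]
    have hlim : Tendsto (fun M : ℕ => C / ((M + 1 : ℕ) : ℝ≥0∞)) atTop (𝓝 0) := by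
      have := (ENNReal.Tendsto.const_div (a := C) ENNReal.tendsto_nat_nhds_top (Or.inr hCtop))
      rw [ENNReal.div_top] at this
      exact this.comp (tendsto_add_atTop_nat 1)
    exact le_antisymm (ge_of_tendsto' hlim hbound) zero_le
  filter_upwards [ae_all_iff.2 hn] with ω hω t ht
  obtain ⟨n, hn⟩ := exists_nat_ge t
  exact hω n t ht hn

lemma ae_isSimpleConfiguration (h : IsPoissonRandomMeasure P N lebesgueIntensity) (K : ℝ) :
    ∀ᵐ ω ∂P, IsSimpleConfiguration (N ω) K := by
  filter_upwards [h.ae_finite K, h.ae_simple K] with ω h1 h2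
  exact ⟨h.integerValued ω, h1, h2⟩

end IsPoissonRandomMeasure

/-! ### Augmented filtration and predictable sets -/

/-- The filtration augmented by the (measurable) null sets. -/
def augmentedFiltration {Ω : Type*} {mΩ : MeasurableSpace Ω} (𝓕 : Filtration ℝ≥0 mΩ)
    (P : Measure Ω) : Filtration ℝ≥0 mΩ where
  seq t := eventuallyMeasurableSpace (𝓕 t) (ae P) ⊓ mΩ
  mono' s t hst := by
    refine inf_le_inf_right _ ?_
    rintro A ⟨B, hB, hAB⟩
    exact ⟨B, 𝓕.mono hst B hB, hAB⟩
  le' t := inf_le_right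

lemma measurableSet_augmentedFiltration {Ω : Type*} {mΩ : MeasurableSpace Ω}
    {𝓕 : Filtration ℝ≥0 mΩ} {P : Measure Ω} {t : ℝ≥0} {A : Set Ω} :
    MeasurableSet[augmentedFiltration 𝓕 P t] A ↔
      (∃ B, MeasurableSet[𝓕 t] B ∧ A =ᵐ[P] B) ∧ MeasurableSet A :=
  MeasurableSpace.measurableSet_inf

lemma le_augmentedFiltration {Ω : Type*} {mΩ : MeasurableSpace Ω}
    (𝓕 : Filtration ℝ≥0 mΩ) (P : Measure Ω) (t : ℝ≥0) : 𝓕 t ≤ augmentedFiltration 𝓕 P t :=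
  fun A hA => measurableSet_augmentedFiltration.2 ⟨⟨A, hA, ae_eq_refl _⟩, 𝓕.le t A hA⟩

/-- The parameter space is cut according to the integer part of the total mass; on each piece the
kernel is bounded. -/
lemma isSFiniteKernel_of_finite {α β : Type*} [MeasurableSpace α] [MeasurableSpace β]
    (κ : Kernel α β) (h : ∀ a, κ a univ < ∞) : IsSFiniteKernel κ := by
  classical
  have hm : Measurable fun a => κ a univ := κ.measurable_coe MeasurableSet.univ
  have hs : ∀ n : ℕ, MeasurableSet {a | κ a univ ∈ Ico (n : ℝ≥0∞) (n + 1)} := fun n =>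
    hm measurableSet_Ico
  have hsum : κ = Kernel.sum fun n : ℕ => Kernel.piecewise (hs n) κ 0 := by
    ext a A hA
    rw [Kernel.sum_apply' _ _ hA, tsum_eq_single ⌊(κ a univ).toNNReal⌋₊]
    · rw [Kernel.piecewise_apply', if_pos]
      have h1 := Nat.floor_le (zero_le : 0 ≤ (κ a univ).toNNReal)
      have h2 := Nat.lt_floor_add_one (κ a univ).toNNReal
      rw [mem_ofPred_eq, ← ENNReal.coe_toNNReal (h a).ne]
      exact ⟨by exact_mod_cast h1, by exact_mod_cast h2⟩
    · intro n hn
      rw [Kernel.piecewise_apply', if_neg]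
      · simp
      · intro hmem
        rw [mem_ofPred_eq, ← ENNReal.coe_toNNReal (h a).ne] at hmem
        refine hn ((Nat.floor_eq_iff zero_le).2 ⟨?_, ?_⟩).symm
        · exact_mod_cast hmem.1
        · exact_mod_cast hmem.2
  rw [hsum]
  refine Kernel.isSFiniteKernel_sum (hκs := fun n => ?_)
  have : IsFiniteKernel (Kernel.piecewise (hs n) κ 0) := by
    refine ⟨⟨n + 1, by simp [lt_top_iff_ne_top], fun a => ?_⟩⟩
    rw [Kernel.piecewise_apply']
    split_ifs with ha
    · exact ha.2.le
    · simp
  infer_instance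

/-- Two finite measures which agree on a π-system agree on the σ-algebra generated by it. -/
lemma measure_eq_of_generateFrom_le {α : Type*} {m m' : MeasurableSpace α} (hm : m' ≤ m)
    {μ ν : Measure[m] α} [IsFiniteMeasure μ] {C : Set (Set α)}
    (hC : m' = MeasurableSpace.generateFrom C) (hpi : IsPiSystem C)
    (h : ∀ s ∈ C, μ s = ν s) (huniv : μ univ = ν univ) {s : Set α} (hs : MeasurableSet[m'] s) :
    μ s = ν s := by
  have : μ.trim hm = ν.trim hm := by
    have : IsFiniteMeasure (μ.trim hm) := isFiniteMeasure_trim hm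
    refine ext_of_generate_finite C hC hpi (fun A hA => ?_) ?_
    · have hA' : MeasurableSet[m'] A := hC ▸ MeasurableSpace.measurableSet_generateFrom hA
      rw [trim_measurableSet_eq hm hA', trim_measurableSet_eq hm hA', h A hA]
    · rw [trim_measurableSet_eq hm MeasurableSet.univ, trim_measurableSet_eq hm MeasurableSet.univ,
        huniv]
  rw [← trim_measurableSet_eq hm hs, this, trim_measurableSet_eq hm hs]

section Predictable

variable {Ω : Type*} {mΩ : MeasurableSpace Ω} {𝓖 : Filtration ℝ≥0 mΩ}

lemma isPiSystem_predictable : IsPiSystem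
    ({s | ∃ A, MeasurableSet[𝓖 ⊥] A ∧ s = {⊥} ×ˢ A} ∪
      {s : Set (ℝ≥0 × Ω) | ∃ i A, MeasurableSet[𝓖 i] A ∧ s = Set.Ioi i ×ˢ A}) := by
  have hdisj : ∀ i : ℝ≥0, ∀ A B : Set Ω, ({⊥} ×ˢ A ∩ Ioi i ×ˢ B : Set (ℝ≥0 × Ω)) = ∅ := by
    intro i A B
    refine eq_empty_of_forall_notMem ?_
    rintro ⟨u, ω⟩ ⟨⟨hu, -⟩, ⟨hu', -⟩⟩
    obtain rfl : u = ⊥ := hu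
    exact not_lt_bot (show i < (⊥ : ℝ≥0) from hu')
  rintro s (⟨A, hA, rfl⟩ | ⟨i, A, hA, rfl⟩) t (⟨B, hB, rfl⟩ | ⟨j, B, hB, rfl⟩) hne
  · exact Or.inl ⟨A ∩ B, hA.inter hB, by rw [prod_inter_prod, inter_self]⟩
  · rw [hdisj] at hne; exact absurd hne not_nonempty_empty
  · rw [inter_comm, hdisj] at hne; exact absurd hne not_nonempty_empty
  · refine Or.inr ⟨max i j, A ∩ B, ?_, by rw [prod_inter_prod, Ioi_inter_Ioi]⟩
    exact (𝓖.mono (le_max_left i j) _ hA).inter (𝓖.mono (le_max_right i j) _ hB)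

lemma predictable_le : 𝓖.predictable ≤ (inferInstance : MeasurableSpace (ℝ≥0 × Ω)) := by
  refine MeasurableSpace.generateFrom_le ?_
  rintro s (⟨A, hA, rfl⟩ | ⟨i, A, hA, rfl⟩)
  · exact (measurableSet_singleton _).prod (𝓖.le _ _ hA)
  · exact measurableSet_Ioi.prod (𝓖.le _ _ hA)

lemma predictable_prod_le : 𝓖.predictable.prod (inferInstance : MeasurableSpace ℝ) ≤
    (inferInstance : MeasurableSpace ((ℝ≥0 × Ω) × ℝ)) :=
  sup_le_sup_right (MeasurableSpace.comap_mono predictable_le) _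

end Predictable

/-! ### The compensation formula -/

/-- The section of a subset of `(ℝ₊ × Ω) × ℝ` at `ω`. -/
def pathSection {Ω : Type*} (S : Set ((ℝ≥0 × Ω) × ℝ)) (ω : Ω) : Set (ℝ≥0 × ℝ) :=
  {p | ((p.1, ω), p.2) ∈ S}

namespace IsPoissonNoise

variable {Ω : Type*} {mΩ : MeasurableSpace Ω} {P : Measure Ω} [IsProbabilityMeasure P]
  {𝓕 : Filtration ℝ≥0 mΩ} {N : Ω → Measure (ℝ≥0 × ℝ)}

/-- The expected number of points in `(s, t] × B`, restricted to an event known at time `s`. -/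
lemma setLIntegral_Ioc_prod (hN : IsPoissonNoise P 𝓕 N) {s t : ℝ≥0} {B : Set ℝ}
    (hB : MeasurableSet B) (hfin : volume B ≠ ∞) {A : Set Ω}
    (hA : MeasurableSet[augmentedFiltration 𝓕 P s] A) :
    ∫⁻ ω in A, N ω (Ioc s t ×ˢ B) ∂P = P A * lebesgueIntensity (Ioc s t ×ˢ B) := by
  obtain ⟨⟨A', hA', hAA'⟩, -⟩ := measurableSet_augmentedFiltration.1 hA
  have hIB : MeasurableSet (Ioc s t ×ˢ B) := measurableSet_Ioc.prod hB
  have hI : lebesgueIntensity (Ioc s t ×ˢ B) ≠ ∞ := by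
    rw [lebesgueIntensity_Ioc_prod]
    exact ENNReal.mul_ne_top ENNReal.ofReal_ne_top hfin
  rw [setLIntegral_congr hAA', measure_congr hAA', ← lintegral_indicator (𝓕.le s _ hA')]
  -- The count in `(s, t] × B` is a function of the noise after `s`, hence independent of `𝓕 s`. The
  -- augmented event was first replaced by an equivalent one from `𝓕 s`.
  have hfm : Measurable[MeasurableSpace.comap
      (fun ω => (N ω).restrict (Ioi s ×ˢ (univ : Set ℝ))) inferInstance] fun ω => N ω (Ioc s t ×ˢ B) := by
    have h1 : (fun ω => N ω (Ioc s t ×ˢ B)) = (fun μ : Measure (ℝ≥0 × ℝ) => μ (Ioc s t ×ˢ B)) ∘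
        fun ω => (N ω).restrict (Ioi s ×ˢ (univ : Set ℝ)) := by
      ext ω
      simp only [Function.comp_apply]
      rw [Measure.restrict_apply hIB, inter_eq_left.2]
      exact Set.prod_mono Ioc_subset_Ioi_self (subset_univ _)
    rw [h1]
    exact (Measure.measurable_coe hIB).comp (comap_measurable _)
  have hle : MeasurableSpace.comap
      (fun ω => (N ω).restrict (Ioi s ×ˢ (univ : Set ℝ))) inferInstance ≤ mΩ := by
    refine Measurable.comap_le ?_
    refine Measure.measurable_of_measurable_coe _ fun E hE => ?_
    simp_rw [Measure.restrict_apply hE]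
    exact hN.poisson.measurable_apply (hE.inter (measurableSet_Ioi.prod MeasurableSet.univ))
  have hind := lintegral_mul_eq_lintegral_mul_lintegral_of_independent_measurableSpace
    (𝓕.le s) hle (hN.indep_future s) (f := A'.indicator fun _ => 1)
    (measurable_const.indicator hA') hfm
  have hprod : ∀ ω, A'.indicator (fun ω => N ω (Ioc s t ×ˢ B)) ω =
      A'.indicator (fun _ => 1) ω * N ω (Ioc s t ×ˢ B) := by
    intro ω
    by_cases hω : ω ∈ A' <;> simp [hω]
  simp_rw [hprod]
  rw [hind, lintegral_indicator_const (𝓕.le s _ hA'), one_mul, hN.poisson.lintegral_apply hIB hI]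

open scoped Classical in
/-- The points of the noise in `(0, t] × [0, K)`, if there are finitely many of them. -/
noncomputable def boxKernel (N : Ω → Measure (ℝ≥0 × ℝ)) (hN : Measurable N) (t : ℝ≥0) (K : ℝ) :
    Kernel Ω (ℝ≥0 × ℝ) where
  toFun ω := if N ω (Ioc 0 t ×ˢ Ico 0 K) < ∞ then (N ω).restrict (Ioc 0 t ×ˢ Ico 0 K) else 0
  measurable' := by
    have hbox : MeasurableSet (Ioc 0 t ×ˢ Ico 0 K) := measurableSet_Ioc.prod measurableSet_Ico
    refine Measurable.ite ?_ ?_ measurable_const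
    · exact ((Measure.measurable_coe hbox).comp hN) measurableSet_Iio
    · refine Measure.measurable_of_measurable_coe _ fun E hE => ?_
      simp_rw [Measure.restrict_apply hE]
      exact (Measure.measurable_coe (hE.inter hbox)).comp hN

instance (hN : Measurable N) (t : ℝ≥0) (K : ℝ) : IsSFiniteKernel (boxKernel N hN t K) := by
  refine isSFiniteKernel_of_finite _ fun ω => ?_
  change (if N ω (Ioc 0 t ×ˢ Ico 0 K) < ∞ then (N ω).restrict (Ioc 0 t ×ˢ Ico 0 K) else 0) univ < ∞
  split_ifs with h
  · rwa [Measure.restrict_apply_univ]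
  · simp

lemma boxKernel_ae_eq (hN : IsPoissonNoise P 𝓕 N) (t : ℝ≥0) (K : ℝ) :
    ∀ᵐ ω ∂P, boxKernel N hN.poisson.measurable t K ω = (N ω).restrict (Ioc 0 t ×ˢ Ico 0 K) := by
  filter_upwards [hN.poisson.ae_finite K] with ω hω
  exact if_pos (hω t).lt_top

/-- The compensation formula on a bounded piece of the strip. -/
lemma lintegral_pathSection_box (hN : IsPoissonNoise P 𝓕 N) {S : Set ((ℝ≥0 × Ω) × ℝ)}
    (hS : MeasurableSet[(augmentedFiltration 𝓕 P).predictable.prod inferInstance] S)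
    (t : ℝ≥0) (K : ℝ) :
    ∫⁻ ω, boxKernel N hN.poisson.measurable t K ω (pathSection S ω) ∂P =
      ∫⁻ ω, lebesgueIntensity (pathSection S ω ∩ Ioc 0 t ×ˢ Ico 0 K) ∂P := by
  classical
  set κ := boxKernel N hN.poisson.measurable t K with hκ
  set box : Set (ℝ≥0 × ℝ) := Ioc 0 t ×ˢ Ico 0 K with hbox
  have hboxm : MeasurableSet box := measurableSet_Ioc.prod measurableSet_Ico
  have hboxfin : lebesgueIntensity box ≠ ∞ := by
    rw [hbox, lebesgueIntensity_Ioc_prod, Real.volume_Ico]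
    exact ENNReal.mul_ne_top ENNReal.ofReal_ne_top ENNReal.ofReal_ne_top
  have hfinite : IsFiniteMeasure (lebesgueIntensity.restrict box) :=
    ⟨by rw [Measure.restrict_apply_univ]; exact hboxfin.lt_top⟩
  set η : Kernel Ω (ℝ≥0 × ℝ) := Kernel.const Ω (lebesgueIntensity.restrict box) with hη
  let φ : Ω × (ℝ≥0 × ℝ) → (ℝ≥0 × Ω) × ℝ := fun q => ((q.2.1, q.1), q.2.2)
  have hφ : Measurable φ := by fun_prop
  have happ : ∀ (κ : Kernel Ω (ℝ≥0 × ℝ)) [IsSFiniteKernel κ] {T : Set ((ℝ≥0 × Ω) × ℝ)},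
      MeasurableSet T → ((P ⊗ₘ κ).map φ) T = ∫⁻ ω, κ ω (pathSection T ω) ∂P := by
    intro κ _ T hT
    rw [Measure.map_apply hφ hT, Measure.compProd_apply (hφ hT)]
    rfl
  -- the measure of a predictable rectangle
  have hrect : ∀ {s : ℝ≥0} {A : Set Ω} {B : Set ℝ}, MeasurableSet[augmentedFiltration 𝓕 P s] A →
      MeasurableSet B → ∫⁻ ω, κ ω (pathSection ((Ioi s ×ˢ A) ×ˢ B) ω) ∂P =
        ∫⁻ ω, η ω (pathSection ((Ioi s ×ˢ A) ×ˢ B) ω) ∂P := by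
    intro s A B hA hB
    have hAm : MeasurableSet A := (augmentedFiltration 𝓕 P).le s A hA
    have hinter : (Ioi s ×ˢ B ∩ box : Set (ℝ≥0 × ℝ)) = Ioc s t ×ˢ (B ∩ Ico 0 K) := by
      rw [hbox, prod_inter_prod]
      congr 1
      ext u
      exact ⟨fun hu => ⟨hu.1, hu.2.2⟩, fun hu => ⟨hu.1, zero_le.trans_lt hu.1, hu.2⟩⟩
    have hsec : ∀ ω, pathSection ((Ioi s ×ˢ A) ×ˢ B) ω = if ω ∈ A then Ioi s ×ˢ B else ∅ := by
      intro ω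
      ext ⟨u, z⟩
      by_cases hω : ω ∈ A <;> simp [pathSection, hω]
    have hmeas : MeasurableSet (Ioi s ×ˢ B) := measurableSet_Ioi.prod hB
    have h1 : ∀ᵐ ω ∂P, κ ω (pathSection ((Ioi s ×ˢ A) ×ˢ B) ω) =
        A.indicator (fun ω => N ω (Ioc s t ×ˢ (B ∩ Ico 0 K))) ω := by
      filter_upwards [hN.boxKernel_ae_eq t K] with ω hω
      rw [hκ, hω, hsec]
      by_cases hωA : ω ∈ A
      · rw [if_pos hωA, indicator_of_mem hωA, Measure.restrict_apply hmeas, hinter]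
      · rw [if_neg hωA, indicator_of_notMem hωA, measure_empty]
    have h2 : ∀ ω, η ω (pathSection ((Ioi s ×ˢ A) ×ˢ B) ω) =
        A.indicator (fun _ => lebesgueIntensity (Ioc s t ×ˢ (B ∩ Ico 0 K))) ω := by
      intro ω
      rw [hη, Kernel.const_apply, hsec]
      by_cases hωA : ω ∈ A
      · rw [if_pos hωA, indicator_of_mem hωA, Measure.restrict_apply hmeas, hinter]
      · rw [if_neg hωA, indicator_of_notMem hωA, measure_empty]
    rw [lintegral_congr_ae h1, lintegral_congr h2, lintegral_indicator hAm,
      lintegral_indicator_const hAm, hN.setLIntegral_Ioc_prod (hB.inter measurableSet_Ico) ?_ hA,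
      mul_comm]
    exact measure_ne_top_of_subset inter_subset_right (by rw [Real.volume_Ico]; simp)
  -- the point `0` does not matter
  have hzero : ∀ {A : Set Ω} {B : Set ℝ},
      ∫⁻ ω, κ ω (pathSection (({⊥} ×ˢ A) ×ˢ B) ω) ∂P = 0 ∧
        ∫⁻ ω, η ω (pathSection (({⊥} ×ˢ A) ×ˢ B) ω) ∂P = 0 := by
    intro A B
    have hnull : ∀ (ν : Measure (ℝ≥0 × ℝ)) (ω : Ω),
        ν.restrict box (pathSection (({⊥} ×ˢ A) ×ˢ B) ω) = 0 := by
      intro ν ω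
      refine measure_mono_null (t := boxᶜ) ?_ (by rw [Measure.restrict_apply hboxm.compl]; simp)
      rintro ⟨u, z⟩ ⟨⟨hu, -⟩, -⟩ ⟨hu', -⟩
      obtain rfl : u = ⊥ := hu
      exact not_lt_bot hu'.1
    constructor
    · rw [lintegral_congr_ae (g := fun _ => 0), lintegral_zero]
      filter_upwards [hN.boxKernel_ae_eq t K] with ω hω
      rw [hκ, hω, hnull]
    · simp only [hη, Kernel.const_apply, hnull, lintegral_zero]
  -- The box omits time `0`, so the full time axis may be replaced by `(0, ∞)`, a predictable
  -- generator.
  have hunivrect : ∀ {B : Set ℝ}, MeasurableSet B →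
      ∫⁻ ω, κ ω (pathSection (univ ×ˢ B) ω) ∂P = ∫⁻ ω, η ω (pathSection (univ ×ˢ B) ω) ∂P := by
    intro B hB
    have hU : ∀ (ν : Measure (ℝ≥0 × ℝ)) (ω : Ω), ν.restrict box (pathSection (univ ×ˢ B) ω) =
        ν.restrict box (pathSection ((Ioi 0 ×ˢ univ) ×ˢ B) ω) := by
      intro ν ω
      have : (pathSection (univ ×ˢ B) ω ∩ box) = pathSection ((Ioi 0 ×ˢ univ) ×ˢ B) ω ∩ box := by
        ext ⟨u, z⟩
        constructor
        · rintro ⟨⟨-, hz⟩, hb⟩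
          exact ⟨⟨⟨hb.1.1, mem_univ _⟩, hz⟩, hb⟩
        · rintro ⟨⟨-, hz⟩, hb⟩
          exact ⟨⟨mem_univ _, hz⟩, hb⟩
      rw [Measure.restrict_apply' hboxm, this, Measure.restrict_apply' hboxm]
    rw [lintegral_congr_ae (g := fun ω => κ ω (pathSection ((Ioi 0 ×ˢ univ) ×ˢ B) ω)),
      hrect MeasurableSet.univ hB]
    · simp only [hη, Kernel.const_apply, hU]
    · filter_upwards [hN.boxKernel_ae_eq t K] with ω hω
      rw [hκ, hω, hU]
  -- Both sides of the formula are finite measures in `S`. They agree on the generators of the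
  -- predictable σ-algebra times a Borel set; two π-system arguments, one for the predictable factor
  -- and one for the product, extend this to all `S`.
  set M := (P ⊗ₘ κ).map φ with hM
  set M' := (P ⊗ₘ η).map φ with hM'
  have hMuniv : M univ = M' univ := by
    rw [hM, hM', happ κ MeasurableSet.univ, happ η MeasurableSet.univ, ← univ_prod_univ]
    exact hunivrect MeasurableSet.univ
  have hM'fin : IsFiniteMeasure M' := by
    rw [hM']; infer_instance
  have hMfin : IsFiniteMeasure M := ⟨by rw [hMuniv]; exact measure_lt_top _ _⟩
  have hfst : ∀ {Q : Set (ℝ≥0 × Ω)} {B : Set ℝ},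
      MeasurableSet[(augmentedFiltration 𝓕 P).predictable] Q → MeasurableSet B →
      M (Q ×ˢ B) = M' (Q ×ˢ B) := by
    intro Q B hQ hB
    have hconv : ∀ (ν : Measure ((ℝ≥0 × Ω) × ℝ)) {T : Set (ℝ≥0 × Ω)}, MeasurableSet T →
        (ν.restrict (univ ×ˢ B)).map Prod.fst T = ν (T ×ˢ B) := by
      intro ν T hT
      rw [Measure.map_apply measurable_fst hT, Measure.restrict_apply (measurable_fst hT)]
      congr 1
      ext ⟨a, z⟩
      simp
    rw [← hconv M (predictable_le _ hQ), ← hconv M' (predictable_le _ hQ)]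
    refine measure_eq_of_generateFrom_le predictable_le rfl isPiSystem_predictable ?_ ?_ hQ
    · rintro T hT
      have hTm : MeasurableSet T := predictable_le _ (MeasurableSpace.measurableSet_generateFrom hT)
      rw [hconv _ hTm, hconv _ hTm, hM, hM', happ κ (hTm.prod hB), happ η (hTm.prod hB)]
      rcases hT with ⟨A, hA, rfl⟩ | ⟨i, A, hA, rfl⟩
      · rw [hzero.1, hzero.2]
      · exact hrect hA hB
    · rw [hconv _ MeasurableSet.univ, hconv _ MeasurableSet.univ, hM, hM',
        happ κ (MeasurableSet.univ.prod hB), happ η (MeasurableSet.univ.prod hB)]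
      exact hunivrect hB
  have hSm : MeasurableSet S := predictable_prod_le _ hS
  have hfinal : M S = M' S := by
    refine measure_eq_of_generateFrom_le predictable_prod_le
      (@generateFrom_prod _ _ (augmentedFiltration 𝓕 P).predictable _).symm
      (@isPiSystem_prod _ _ (augmentedFiltration 𝓕 P).predictable _) ?_ hMuniv hS
    rintro T ⟨Q, hQ, B, hB, rfl⟩
    exact hfst hQ hB
  rw [hM, hM', happ κ hSm, happ η hSm] at hfinal
  rw [hfinal]
  refine lintegral_congr fun ω => ?_
  rw [hη, Kernel.const_apply, Measure.restrict_apply' hboxm]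

/-- The compensation formula for predictable sets in the strip. -/
theorem lintegral_pathSection (hN : IsPoissonNoise P 𝓕 N) {S : Set ((ℝ≥0 × Ω) × ℝ)}
    (hS : MeasurableSet[(augmentedFiltration 𝓕 P).predictable.prod inferInstance] S)
    {K : ℝ} (hSK : ∀ p ∈ S, 0 < p.1.1 ∧ p.2 ∈ Ico 0 K) :
    ∫⁻ ω, N ω (pathSection S ω) ∂P = ∫⁻ ω, lebesgueIntensity (pathSection S ω) ∂P := by
  have hSm : MeasurableSet S := predictable_prod_le _ hS
  set box : ℕ → Set (ℝ≥0 × ℝ) := fun n => Ioc 0 (n : ℝ≥0) ×ˢ Ico 0 K with hbox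
  have hboxm : ∀ n, MeasurableSet (box n) := fun n => measurableSet_Ioc.prod measurableSet_Ico
  have hmono : Monotone box := fun a b hab =>
    Set.prod_mono (Ioc_subset_Ioc_right (by exact_mod_cast hab)) subset_rfl
  have hunion : ∀ (ν : Measure (ℝ≥0 × ℝ)) (ω : Ω),
      ν (pathSection S ω) = ⨆ n, ν (pathSection S ω ∩ box n) := by
    intro ν ω
    rw [← Monotone.measure_iUnion fun a b hab => inter_subset_inter_right _ (hmono hab),
      ← inter_iUnion, inter_eq_left.2]
    rintro ⟨u, z⟩ hp
    obtain ⟨n, hn⟩ := exists_nat_ge u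
    exact mem_iUnion.2 ⟨n, ⟨(hSK _ hp).1, hn⟩, (hSK _ hp).2⟩
  have hpre : MeasurableSet {q : Ω × (ℝ≥0 × ℝ) | ((q.2.1, q.1), q.2.2) ∈ S} := by
    have : Measurable fun q : Ω × (ℝ≥0 × ℝ) => ((q.2.1, q.1), q.2.2) := by fun_prop
    exact this hSm
  have hker : ∀ n : ℕ, ∀ᵐ ω ∂P, boxKernel N hN.poisson.measurable n K ω (pathSection S ω) =
      N ω (pathSection S ω ∩ box n) := by
    intro n
    filter_upwards [hN.boxKernel_ae_eq n K] with ω hω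
    rw [hω, Measure.restrict_apply' (hboxm n)]
  have hmonoN : ∀ (ν : Measure (ℝ≥0 × ℝ)) (ω : Ω),
      Monotone fun n => ν (pathSection S ω ∩ box n) := fun ν ω a b hab =>
    measure_mono (inter_subset_inter_right _ (hmono hab))
  simp_rw [hunion]
  rw [lintegral_iSup', lintegral_iSup']
  · congr 1
    ext n
    rw [← lintegral_congr_ae (hker n), hN.lintegral_pathSection_box hS]
  · intro n
    refine Measurable.aemeasurable ?_
    have := Kernel.measurable_kernel_prodMk_left
      (κ := (Kernel.const Ω lebesgueIntensity).restrict (hboxm n)) hpre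
    simp only [Kernel.restrict_apply, Kernel.const_apply, Measure.restrict_apply' (hboxm n)] at this
    exact this
  · exact ae_of_all _ fun ω => hmonoN _ ω
  · intro n
    -- A single realization `N ω` need not be σ-finite, so measurability in `ω` is taken from the
    -- box kernel, which agrees with the noise almost surely.
    exact ⟨_, Kernel.measurable_kernel_prodMk_left hpre, EventuallyEq.symm (hker n)⟩
  · exact ae_of_all _ fun ω => hmonoN _ ω

end IsPoissonNoise

/-! ### Predictability of the jump regions -/

lemma measurable_ite_of_trace {α β : Type*} [MeasurableSpace α] [MeasurableSpace β] {C : Set α}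
    [DecidablePred (· ∈ C)] (hC : MeasurableSet C) {f : α → β} (c : β)
    (h : ∀ B, MeasurableSet B → MeasurableSet (C ∩ f ⁻¹' B)) :
    Measurable fun a => if a ∈ C then f a else c := by
  intro B hB
  by_cases hc : c ∈ B
  · have : (fun a => if a ∈ C then f a else c) ⁻¹' B = (C ∩ f ⁻¹' B) ∪ Cᶜ := by
      ext a
      by_cases ha : a ∈ C <;> simp [ha, hc]
    rw [this]
    exact (h B hB).union hC.compl
  · have : (fun a => if a ∈ C then f a else c) ⁻¹' B = C ∩ f ⁻¹' B := by
      ext a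
      by_cases ha : a ∈ C <;> simp [ha, hc]
    rw [this]
    exact h B hB

lemma IsRateFunction.measurableSet_region {k : ℕ} {lam : Fin k → Fin k → ℝ → ℝ}
    (hlam : IsRateFunction lam) {i j : Fin k} (hij : i ≠ j) {α : Type*} [MeasurableSpace α]
    {Q : Set α} (hQ : MeasurableSet Q) {a b : α → ℝ} (ha : Measurable a) (hb : Measurable b)
    {R : Set ℝ} (hR : MeasurableSet R) :
    MeasurableSet {p : α × ℝ | p.1 ∈ Q ∧ a p.1 ∈ R ∧ p.2 ∈ rateInterval lam i j (b p.1)} := by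
  have h : Measurable fun p : α × ℝ => (b p.1, p.2) :=
    (hb.comp measurable_fst).prodMk measurable_snd
  exact (measurable_fst hQ).inter (((ha.comp measurable_fst) hR).inter
    (h (hlam.measurableSet_rateInterval hij)))

section Region

variable {Ω : Type*} {mΩ : MeasurableSpace Ω}

/-- The points which produce the first jump after the random time `σ`, on the event `A`; here `L`
is the time of the last jump before `σ`, and it is enough to look at a countable dense set of
times in order to see that there is no jump. -/
def predictableRegion (A : Set Ω) (σ : Ω → ℝ≥0) (L : Ω → ℝ) (l : ℝ≥0 → Ω → ℝ) (R : Set ℝ)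
    (Λ : ℝ → Set ℝ) : Set ((ℝ≥0 × Ω) × ℝ) :=
  {p | p.1.2 ∈ A ∧ σ p.1.2 < p.1.1 ∧
    (∀ n, σ p.1.2 ≤ TopologicalSpace.denseSeq ℝ≥0 n → TopologicalSpace.denseSeq ℝ≥0 n < p.1.1 →
      l (TopologicalSpace.denseSeq ℝ≥0 n) p.1.2 = L p.1.2) ∧
    (p.1.1 : ℝ) - σ p.1.2 ∈ R ∧ p.2 ∈ Λ (p.1.1 - L p.1.2)}

/-- The strict inequality `σ < u` makes the region predictable: it is witnessed by a time `d n` of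
the dense sequence with `σ ≤ d n < u`, and whatever is known at `d n` may be used on `(d n, ∞)`. The
hypothesis on `A`, `σ` and `L` says that, on `A`, the pair `(σ, L)` is known once `σ` has passed. -/
lemma measurableSet_predictableRegion {𝓖 : Filtration ℝ≥0 mΩ} {k : ℕ}
    {lam : Fin k → Fin k → ℝ → ℝ} (hlam : IsRateFunction lam) {i j : Fin k} (hij : i ≠ j)
    {A : Set Ω} {σ : Ω → ℝ≥0} {L : Ω → ℝ} {l : ℝ≥0 → Ω → ℝ} (hl : ∀ t, Measurable[𝓖 t] (l t))
    (hA : ∀ (t : ℝ≥0) (B : Set (ℝ≥0 × ℝ)), MeasurableSet B →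
      MeasurableSet[𝓖 t] {ω | (ω ∈ A ∧ σ ω ≤ t) ∧ (σ ω, L ω) ∈ B})
    {R : Set ℝ} (hR : MeasurableSet R) :
    MeasurableSet[𝓖.predictable.prod inferInstance]
      (predictableRegion A σ L l R (rateInterval lam i j)) := by
  classical
  set d := TopologicalSpace.denseSeq ℝ≥0 with hd
  set Q : Set (ℝ≥0 × Ω) := {q | q.2 ∈ A ∧ σ q.2 < q.1} with hQ
  have hexists : ∀ s u : ℝ≥0, s < u → ∃ n, s ≤ d n ∧ d n < u := by
    intro s u hsu
    obtain ⟨n, hn⟩ := (TopologicalSpace.denseRange_denseSeq ℝ≥0).exists_mem_open isOpen_Ioo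
      (nonempty_Ioo.2 hsu)
    exact ⟨n, hn.1.le, hn.2⟩
  have hQB : ∀ B : Set (ℝ≥0 × ℝ), MeasurableSet B →
      MeasurableSet[𝓖.predictable] (Q ∩ (fun q : ℝ≥0 × Ω => (σ q.2, L q.2)) ⁻¹' B) := by
    intro B hB
    have : (Q ∩ (fun q : ℝ≥0 × Ω => (σ q.2, L q.2)) ⁻¹' B) =
        ⋃ n, Ioi (d n) ×ˢ {ω | (ω ∈ A ∧ σ ω ≤ d n) ∧ (σ ω, L ω) ∈ B} := by
      ext ⟨u, ω⟩
      simp only [hQ, mem_inter_iff, mem_ofPred_eq, mem_preimage, mem_iUnion, mem_prod, mem_Ioi]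
      constructor
      · rintro ⟨⟨h1, h2⟩, h3⟩
        obtain ⟨n, hn1, hn2⟩ := hexists _ _ h2
        exact ⟨n, hn2, ⟨h1, hn1⟩, h3⟩
      · rintro ⟨n, hn2, ⟨h1, hn1⟩, h3⟩
        exact ⟨⟨h1, hn1.trans_lt hn2⟩, h3⟩
    rw [this]
    exact MeasurableSet.iUnion fun n => measurableSet_predictable_Ioi_prod (hA (d n) B hB)
  have hQm : MeasurableSet[𝓖.predictable] Q := by
    simpa using hQB univ MeasurableSet.univ
  have hu : Measurable[𝓖.predictable] (fun q : ℝ≥0 × Ω => q.1) := by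
    refine @measurable_of_Ioi _ _ _ _ _ 𝓖.predictable _ _ _ _ fun a => ?_
    have : (fun q : ℝ≥0 × Ω => q.1) ⁻¹' Ioi a = Ioi a ×ˢ univ := by
      ext ⟨u, ω⟩; simp
    rw [this]
    exact measurableSet_predictable_Ioi_prod MeasurableSet.univ
  -- Outside `Q` nothing is known about `σ` and `L`, so they are replaced by the dummy value `0`.
  have hθ : Measurable[𝓖.predictable] (fun q : ℝ≥0 × Ω =>
      if q ∈ Q then (σ q.2, L q.2) else ((0, 0) : ℝ≥0 × ℝ)) :=
    @measurable_ite_of_trace _ _ 𝓖.predictable _ _ _ hQm _ _ hQB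
  have hlL : ∀ n, MeasurableSet[𝓖 (d n)] {ω | (ω ∈ A ∧ σ ω ≤ d n) ∧ l (d n) ω ≠ L ω} := by
    intro n
    set C : Set Ω := {ω | ω ∈ A ∧ σ ω ≤ d n} with hC
    have hCB : ∀ B : Set ℝ, MeasurableSet B → MeasurableSet[𝓖 (d n)] (C ∩ L ⁻¹' B) := by
      intro B hB
      exact hA (d n) (Prod.snd ⁻¹' B) (measurable_snd hB)
    have hCm : MeasurableSet[𝓖 (d n)] C := by
      simpa using hCB univ MeasurableSet.univ
    have hL' : Measurable[𝓖 (d n)] (fun ω => if ω ∈ C then L ω else 0) :=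
      @measurable_ite_of_trace _ _ (𝓖 (d n)) _ _ _ hCm _ _ hCB
    have : {ω | (ω ∈ A ∧ σ ω ≤ d n) ∧ l (d n) ω ≠ L ω} =
        C ∩ {ω | l (d n) ω = if ω ∈ C then L ω else 0}ᶜ := by
      ext ω
      by_cases hω : ω ∈ C
      · simp only [mem_inter_iff, mem_compl_iff, mem_ofPred_eq, hω, if_true, true_and]
        exact ⟨fun h => h.2, fun h => ⟨hω, h⟩⟩
      · simp only [mem_inter_iff, hω, false_and, iff_false]
        exact fun h => hω h.1
    rw [this]
    exact hCm.inter (measurableSet_eq_fun (hl (d n)) hL').compl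
  -- `J` records that a changed value of `l` has been observed at some time of the dense sequence in
  -- `[σ, u)`; it is removed from `Q`.
  set J : Set (ℝ≥0 × Ω) := ⋃ n, Ioi (d n) ×ˢ {ω | (ω ∈ A ∧ σ ω ≤ d n) ∧ l (d n) ω ≠ L ω} with hJ
  have hJm : MeasurableSet[𝓖.predictable] J :=
    MeasurableSet.iUnion fun n => measurableSet_predictable_Ioi_prod (hlL n)
  have hσ' : Measurable[𝓖.predictable] (fun q : ℝ≥0 × Ω =>
      (q.1 : ℝ) - ((if q ∈ Q then (σ q.2, L q.2) else ((0, 0) : ℝ≥0 × ℝ)).1 : ℝ)) :=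
    (NNReal.continuous_coe.measurable.comp hu).sub
      (NNReal.continuous_coe.measurable.comp (measurable_fst.comp hθ))
  have hL' : Measurable[𝓖.predictable] (fun q : ℝ≥0 × Ω =>
      (q.1 : ℝ) - (if q ∈ Q then (σ q.2, L q.2) else ((0, 0) : ℝ≥0 × ℝ)).2) :=
    (NNReal.continuous_coe.measurable.comp hu).sub (measurable_snd.comp hθ)
  have := @IsRateFunction.measurableSet_region k lam hlam i j hij (ℝ≥0 × Ω) 𝓖.predictable
    (Q \ J) (hQm.diff hJm) _ _ hσ' hL' R hR
  refine (congrArg (MeasurableSet[𝓖.predictable.prod inferInstance]) ?_).mpr this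
  refine Set.ext ?_
  rintro ⟨⟨u, ω⟩, z⟩
  simp only [predictableRegion, mem_ofPred_eq, hQ, hJ, Set.mem_sdiff, mem_iUnion, mem_prod, mem_Ioi,
    not_exists, not_and, not_not]
  constructor
  · rintro ⟨h1, h2, h3, h4, h5⟩
    refine ⟨⟨⟨h1, h2⟩, fun n hn h => h3 n h.2 hn⟩, ?_⟩
    rw [if_pos ⟨h1, h2⟩]
    exact ⟨h4, h5⟩
  · rintro ⟨⟨⟨h1, h2⟩, h3⟩, h45⟩
    rw [if_pos ⟨h1, h2⟩] at h45
    exact ⟨h1, h2, fun n hn hn' => h3 n hn' ⟨h1, hn⟩, h45.1, h45.2⟩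

lemma pathSection_predictableRegion_of_notMem {A : Set Ω} {ω : Ω} (hω : ω ∉ A) (σ : Ω → ℝ≥0)
    (L : Ω → ℝ) (l : ℝ≥0 → Ω → ℝ) (R : Set ℝ) (Λ : ℝ → Set ℝ) :
    pathSection (predictableRegion A σ L l R Λ) ω = ∅ :=
  eq_empty_of_forall_notMem fun _ hp => hω hp.1

/-- A step path is constant immediately to the right of every time, so its value at `s` is seen at a
time of the dense sequence slightly after `s` and still before `u`. This justifies testing only
countably many times. -/
lemma pathSection_predictableRegion_of_mem {A : Set Ω} {ω : Ω} (hω : ω ∈ A) {σ : Ω → ℝ≥0}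
    {L : Ω → ℝ} {l : ℝ≥0 → Ω → ℝ} (hL : L ω = l (σ ω) ω) {α : Type*} {x : ℝ≥0 → α}
    (hstep : IsStepPath x fun t => l t ω) (R : Set ℝ) (Λ : ℝ → Set ℝ) :
    pathSection (predictableRegion A σ L l R Λ) ω =
      jumpRegion (fun t => l t ω) (σ ω) R Λ := by
  ext ⟨u, z⟩
  simp only [pathSection, predictableRegion, jumpRegion, mem_ofPred_eq, hω, true_and, hL]
  refine and_congr_right fun hσu => and_congr_left fun _ => ⟨fun h s hs hsu => ?_,
    fun h n hn hn' => h _ hn hn'⟩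
  obtain ⟨r, hr, hconst⟩ := hstep.right s
  obtain ⟨n, hn⟩ := (TopologicalSpace.denseRange_denseSeq ℝ≥0).exists_mem_open isOpen_Ioo
    (nonempty_Ioo.2 (lt_min hsu hr))
  rw [← h n (hs.trans hn.1.le) (hn.2.trans_le (min_le_left _ _))]
  exact (hconst _ hn.1.le (hn.2.trans_le (min_le_right _ _))).2.symm

lemma measurable_lebesgueIntensity_pathSection {S : Set ((ℝ≥0 × Ω) × ℝ)} (hS : MeasurableSet S) :
    Measurable fun ω => lebesgueIntensity (pathSection S ω) := by
  have : Measurable fun q : Ω × (ℝ≥0 × ℝ) => ((q.2.1, q.1), q.2.2) := by fun_prop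
  exact Kernel.measurable_kernel_prodMk_left (κ := Kernel.const Ω lebesgueIntensity) (this hS)

end Region

/-! ### Lebesgue measure of the jump regions -/

section Lebesgue

variable {k : ℕ} {lam : Fin k → Fin k → ℝ → ℝ}

lemma lebesgueIntensity_region (hlam : IsRateFunction lam) {i j : Fin k} (hij : i ≠ j)
    (σ : ℝ≥0) (L : ℝ) {V : Set ℝ} (hV : MeasurableSet V) (hV0 : V ⊆ Ioi 0) :
    lebesgueIntensity {p : ℝ≥0 × ℝ | (p.1 : ℝ) - σ ∈ V ∧ p.2 ∈ rateInterval lam i j (p.1 - L)} =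
      ∫⁻ v in V, ENNReal.ofReal (cutRate lam i j (σ + v - L)) := by
  classical
  have hms : MeasurableSet
      {p : ℝ≥0 × ℝ | (p.1 : ℝ) - σ ∈ V ∧ p.2 ∈ rateInterval lam i j (p.1 - L)} := by
    have := hlam.measurableSet_region hij (α := ℝ≥0) MeasurableSet.univ
      (a := fun u => (u : ℝ) - σ) (b := fun u => (u : ℝ) - L)
      (NNReal.continuous_coe.measurable.sub_const _) (NNReal.continuous_coe.measurable.sub_const _)
      hV
    simpa using this
  set f : ℝ → ℝ≥0∞ := fun x => V.indicator
    (fun v => ENNReal.ofReal (cutRate lam i j (σ + v - L))) (x - σ) with hf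
  rw [lebesgueIntensity, Measure.prod_apply hms]
  have hslice : ∀ u : ℝ≥0, volume (Prod.mk u ⁻¹'
      {p : ℝ≥0 × ℝ | (p.1 : ℝ) - σ ∈ V ∧ p.2 ∈ rateInterval lam i j (p.1 - L)}) = f u := by
    intro u
    by_cases hu : (u : ℝ) - σ ∈ V
    · simp only [preimage_ofPred_eq, hu, true_and, hf, indicator_of_mem, add_sub_cancel]
      exact volume_rateInterval hij _
    · simp [hu, hf]
  simp_rw [hslice]
  rw [lintegral_comap_nnreal_coe f, setLIntegral_eq_of_support_subset, hf,
    lintegral_sub_right_eq_self (fun v => V.indicator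
      (fun v => ENNReal.ofReal (cutRate lam i j (σ + v - L))) v) (σ : ℝ), lintegral_indicator hV]
  -- `V ⊆ (0, ∞)` and `σ ≥ 0` force the time to be positive, so restricting to the half-line loses
  -- nothing.
  intro x hx
  by_contra hx0
  refine hx (indicator_of_notMem (fun h => ?_) _)
  have h1 : (0 : ℝ) < x - σ := hV0 h
  have h2 : (0 : ℝ) ≤ σ := σ.2
  exact hx0 (show (0 : ℝ) ≤ x by linarith)

variable {α : Type*} {x : ℝ≥0 → α} {l : ℝ≥0 → ℝ}

lemma lebesgueIntensity_jumpRegion_of_const (hlam : IsRateFunction lam) {i j : Fin k}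
    (hij : i ≠ j) {σ : ℝ≥0} (hσ : ∀ s, σ ≤ s → l s = l σ) :
    lebesgueIntensity (jumpRegion l σ univ (rateInterval lam i j)) =
      ∫⁻ v in Ioi 0, ENNReal.ofReal (cutRate lam i j (σ + v - l σ)) := by
  rw [← lebesgueIntensity_region hlam hij σ (l σ) measurableSet_Ioi subset_rfl]
  congr 1
  ext ⟨u, z⟩
  simp only [jumpRegion, mem_ofPred_eq, mem_univ, true_and, mem_Ioi, sub_pos, NNReal.coe_lt_coe]
  exact ⟨fun h => ⟨h.1, h.2.2⟩, fun h => ⟨h.1, fun s hs _ => hσ s hs, h.2⟩⟩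

/-- The condition that no jump occurs in `[σ, v)` after the start holds exactly up to and including
the next jump time `u`, so it truncates the elapsed time to `(0, u - σ]`. -/
lemma lebesgueIntensity_jumpRegion_of_isNext (hlam : IsRateFunction lam) {i j : Fin k}
    (hij : i ≠ j) (hstep : IsStepPath x l) {σ u : ℝ≥0} (hu : IsStepPath.IsNext x l σ u)
    {R : Set ℝ} (hR : MeasurableSet R) :
    lebesgueIntensity (jumpRegion l σ R (rateInterval lam i j)) =
      ∫⁻ v in R ∩ Ioc 0 ((u : ℝ) - σ), ENNReal.ofReal (cutRate lam i j (σ + v - l σ)) := by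
  rw [← lebesgueIntensity_region hlam hij σ (l σ) (hR.inter measurableSet_Ioc)
    fun v hv => hv.2.1]
  congr 1
  obtain ⟨hσu, hconst, hlu, -⟩ := hu
  ext ⟨v, z⟩
  simp only [jumpRegion, mem_ofPred_eq, mem_inter_iff, mem_Ioc, sub_pos, NNReal.coe_lt_coe,
    sub_le_sub_iff_right, NNReal.coe_le_coe]
  constructor
  · rintro ⟨h1, h2, h3, h4⟩
    refine ⟨⟨h3, h1, not_lt.1 fun huv => ?_⟩, h4⟩
    have h5 := h2 u hσu.le huv
    have h6 := hstep.le_self σ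
    rw [← h5, hlu] at h6
    exact absurd hσu (not_lt.2 (by exact_mod_cast h6))
  · rintro ⟨⟨h3, h1, h2⟩, h4⟩
    exact ⟨h1, fun s hs hsv => hconst s hs (hsv.trans_le h2), h3, h4⟩

/-- The total rate of leaving a state is not integrable. -/
lemma IsRateFunction.lintegral_eq_top (hlam : IsRateFunction lam) (i : Fin k) {a : ℝ}
    (ha : 0 ≤ a) : ∫⁻ v in Ioi 0, ENNReal.ofReal (∑ j, cutRate lam i j (a + v)) = ∞ := by
  obtain ⟨K, hK0, -, hK⟩ := hlam.exists_strip
  set r : ℝ → ℝ := fun v => ∑ j, cutRate lam i j v with hr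
  have hrm : Measurable r := Finset.measurable_sum _ fun j _ => hlam.measurable_cutRate i j
  have hr0 : ∀ v, 0 ≤ r v := fun v => Finset.sum_nonneg fun j _ => hlam.cutRate_nonneg i j v
  have hshift : ∫⁻ v in Ioi 0, ENNReal.ofReal (∑ j, cutRate lam i j (a + v)) =
      ∫⁻ v in Ioi a, ENNReal.ofReal (r v) := by
    rw [← lintegral_indicator measurableSet_Ioi, ← lintegral_indicator measurableSet_Ioi,
      ← lintegral_add_left_eq_self ((Ioi a).indicator fun v => ENNReal.ofReal (r v)) a]
    refine lintegral_congr fun v => ?_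
    by_cases hv : 0 < v <;> simp [hv, hr]
  rw [hshift]
  by_contra hne
  -- The shift discards only `(0, a]`, where the bounded rate has a finite integral.
  have hfin : ∫⁻ v in Ioi 0, ENNReal.ofReal (r v) ≠ ∞ := by
    rw [← Ioc_union_Ioi_eq_Ioi ha]
    refine ne_top_of_le_ne_top (ENNReal.add_ne_top.2 ⟨?_, hne⟩) (lintegral_union_le _ _ _)
    refine ne_top_of_le_ne_top (b := ∫⁻ v in Ioc 0 a, ENNReal.ofReal K) ?_
      (lintegral_mono fun v => ENNReal.ofReal_le_ofReal (hK i v))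
    rw [lintegral_const, Measure.restrict_apply_univ, Real.volume_Ioc]
    exact ENNReal.mul_ne_top ENNReal.ofReal_ne_top ENNReal.ofReal_ne_top
  have hle : ∀ y : ℝ, ∫ v in Ioc 0 y, exitRate lam i v ≤
      (∫⁻ v in Ioi 0, ENNReal.ofReal (r v)).toReal := by
    intro y
    rw [setIntegral_congr_fun (g := r) measurableSet_Ioc
      fun v hv => exitRate_eq_sum_cutRate hv.1 i,
      integral_eq_lintegral_of_nonneg_ae (ae_of_all _ hr0) hrm.aestronglyMeasurable]
    exact ENNReal.toReal_mono hfin (lintegral_mono_set Ioc_subset_Ioi_self)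
  obtain ⟨y, hy⟩ := ((hlam.divergent i).eventually_gt_atTop
    (∫⁻ v in Ioi 0, ENNReal.ofReal (r v)).toReal).exists
  exact absurd (hle y) (not_le.2 hy)

end Lebesgue

/-! ### There are infinitely many jumps -/

section InfinitelyManyJumps

variable {Ω : Type*} {mΩ : MeasurableSpace Ω} {P : Measure Ω}
  {𝓕 : Filtration ℝ≥0 mΩ} {N : Ω → Measure (ℝ≥0 × ℝ)} {k : ℕ} {lam : Fin k → Fin k → ℝ → ℝ}
  {X : ℝ≥0 → Ω → Fin k} {Y : ℝ≥0 → Ω → ℝ}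

lemma IsStrongSolution.ae_solvesEquations (h : IsStrongSolution P 𝓕 N lam X Y) :
    ∀ᵐ ω ∂P, SolvesEquations lam (N ω) (fun t => X t ω) (fun t => Y t ω) := by
  filter_upwards [h.nonneg_Y_zero, h.equation_X, h.equation_Y] with ω h0 hX hY
  exact ⟨h0, fun t => (hX t).1, fun t => (hY t).1, fun t => (hX t).2, fun t => (hY t).2⟩

lemma IsStrongSolution.measurable_lastJump (h : IsStrongSolution P 𝓕 N lam X Y) (t : ℝ≥0) :
    Measurable[𝓕 t] fun ω => (t : ℝ) - Y t ω :=
  (h.adapted_Y t).const_sub _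

/-- Almost surely, there is a next jump after each time. -/
lemma IsStrongSolution.ae_exists_isNext [IsProbabilityMeasure P] (hN : IsPoissonNoise P 𝓕 N)
    (hlam : IsRateFunction lam) (h : IsStrongSolution P 𝓕 N lam X Y) :
    ∀ᵐ ω ∂P, ∀ t, ∃ u, IsStepPath.IsNext (fun t => X t ω) (fun t : ℝ≥0 => (t : ℝ) - Y t ω) t u := by
  classical
  obtain ⟨K, hK0, hstrip, hK⟩ := hlam.exists_strip
  set l : ℝ≥0 → Ω → ℝ := fun t ω => (t : ℝ) - Y t ω with hl
  have hgood : ∀ᵐ ω ∂P, IsSimpleConfiguration (N ω) K ∧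
      SolvesEquations lam (N ω) (fun t => X t ω) (fun t => Y t ω) := by
    filter_upwards [hN.poisson.ae_isSimpleConfiguration K, h.ae_solvesEquations] with ω h1 h2
    exact ⟨h1, h2⟩
  have key : ∀ (q : ℝ≥0) (i j : Fin k), i ≠ j → ∀ᵐ ω ∂P, X q ω = i →
      lebesgueIntensity (jumpRegion (fun t => l t ω) q univ (rateInterval lam i j)) < ∞ := by
    intro q i j hij
    set S := predictableRegion {ω | X q ω = i} (fun _ => q) (l q) l univ (rateInterval lam i j)
      with hS
    have hSm : MeasurableSet[(augmentedFiltration 𝓕 P).predictable.prod inferInstance] S := by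
      refine measurableSet_predictableRegion hlam hij
        (fun t => (h.measurable_lastJump t).mono (le_augmentedFiltration 𝓕 P t) le_rfl)
        (fun t B hB => ?_) MeasurableSet.univ
      by_cases hqt : q ≤ t
      · refine (le_augmentedFiltration 𝓕 P t) _ (𝓕.mono hqt _ ?_)
        have h1 : MeasurableSet[𝓕 q] {ω | X q ω = i} := h.adapted_X q (measurableSet_singleton i)
        have h2 : Measurable[𝓕 q] fun ω => (q, l q ω) :=
          measurable_const.prodMk (h.measurable_lastJump q)
        simp only [hqt, and_true]
        exact h1.inter (h2 hB)
      · simp [hqt]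
    have hSK : ∀ p ∈ S, 0 < p.1.1 ∧ p.2 ∈ Ico 0 K := fun p hp =>
      ⟨zero_le.trans_lt hp.2.1, hstrip i j _ hij hp.2.2.2.2⟩
    have hsec : ∀ᵐ ω ∂P, X q ω = i →
        pathSection S ω = jumpRegion (fun t => l t ω) q univ (rateInterval lam i j) := by
      filter_upwards [hgood] with ω ⟨h1, h2⟩ hω
      exact pathSection_predictableRegion_of_mem (A := {ω | X q ω = i}) (σ := fun _ => q) hω rfl
        (h2.isStepPath h1 hlam hstrip) _ _
    -- At most one point causes the next jump after `q`. By compensation the Lebesgue measure of the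
    -- region has mean at most `1`, hence is almost surely finite.
    have hle : ∀ᵐ ω ∂P, N ω (pathSection S ω) ≤ 1 := by
      filter_upwards [hgood, hsec] with ω ⟨h1, h2⟩ h3
      by_cases hω : X q ω = i
      · rw [h3 hω]
        subst hω
        rcases (h2.isStepPath h1 hlam hstrip).const_or_exists_isNext q with hc | ⟨u, hu⟩
        · rw [h2.measure_jumpRegion_of_const h1 hlam hstrip hc univ hij]
          exact zero_le
        · rw [h2.measure_jumpRegion_of_isNext h1 hlam hstrip hu univ hij]
          split_ifs <;> simp
      · rw [hS, pathSection_predictableRegion_of_notMem (A := {ω | X q ω = i}) hω, measure_empty]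
        exact zero_le
    have hfin : ∫⁻ ω, lebesgueIntensity (pathSection S ω) ∂P ≠ ∞ := by
      rw [← hN.lintegral_pathSection hSm hSK]
      refine ne_top_of_le_ne_top ENNReal.one_ne_top ((lintegral_mono_ae hle).trans ?_)
      simp
    filter_upwards [hsec, ae_lt_top
      (measurable_lebesgueIntensity_pathSection (predictable_prod_le _ hSm)) hfin] with ω h1 h2 h3
    rwa [h1 h3] at h2
  -- Countably many starting times suffice: if no jump follows `t`, none follows a later time of the
  -- dense sequence.
  have key' : ∀ᵐ ω ∂P, ∀ (n : ℕ) (i j : Fin k), i ≠ j →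
      X (TopologicalSpace.denseSeq ℝ≥0 n) ω = i →
      lebesgueIntensity (jumpRegion (fun t => l t ω) (TopologicalSpace.denseSeq ℝ≥0 n) univ
        (rateInterval lam i j)) < ∞ := by
    rw [ae_all_iff]; intro n
    rw [ae_all_iff]; intro i
    rw [ae_all_iff]; intro j
    by_cases hij : i = j
    · simp [hij]
    · simpa [hij] using key (TopologicalSpace.denseSeq ℝ≥0 n) i j hij
  filter_upwards [hgood, key'] with ω ⟨h1, h2⟩ h3 t
  have hstep := h2.isStepPath h1 hlam hstrip
  refine (hstep.const_or_exists_isNext t).resolve_left fun hc => ?_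
  obtain ⟨n, hn⟩ := (TopologicalSpace.denseRange_denseSeq ℝ≥0).exists_mem_open isOpen_Ioi
    (nonempty_Ioi (a := t))
  set q := TopologicalSpace.denseSeq ℝ≥0 n with hq
  have hqt : t ≤ q := le_of_lt hn
  have hcq : ∀ s, q ≤ s → l s ω = l q ω := fun s hs => (hc s (hqt.trans hs)).trans (hc q hqt).symm
  have ha : 0 ≤ (q : ℝ) - l q ω := sub_nonneg.2 (hstep.le_self q)
  have htop := hlam.lintegral_eq_top (X q ω) ha
  have hsum : ∀ v, ENNReal.ofReal (∑ j, cutRate lam (X q ω) j (q - l q ω + v)) =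
      ∑ j, ENNReal.ofReal (cutRate lam (X q ω) j (q + v - l q ω)) := by
    intro v
    rw [ENNReal.ofReal_sum_of_nonneg fun j _ => hlam.cutRate_nonneg _ _ _]
    simp only [sub_add_eq_add_sub]
  simp_rw [hsum] at htop
  rw [lintegral_finsetSum] at htop
  -- The total exit rate has an infinite integral, so some single rate has one too, against the
  -- almost sure finiteness.
  · obtain ⟨j, -, hj⟩ := ENNReal.sum_eq_top.1 htop
    have hij : X q ω ≠ j := by
      rintro rfl
      simp [cutRate] at hj
    have := h3 n _ j hij rfl
    rw [lebesgueIntensity_jumpRegion_of_const hlam hij hcq, hj] at this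
    exact lt_irrefl _ this
  · intro j _
    exact ((hlam.measurable_cutRate _ j).comp (by fun_prop)).ennreal_ofReal

end InfinitelyManyJumps

/-! ### Measurable construction of jump times and states -/

/-- The successive values of a nondecreasing step function, starting with `b`, read off from a
sequence `a` of its values. -/
noncomputable def jumpTime (b : ℝ) (a : ℕ → ℝ) : ℕ → EReal
  | 0 => b
  | n + 1 => ⨅ m, open Classical in if jumpTime b a n < a m then (a m : EReal) else ⊤

/-- The second alternative makes the existence unconditional, so that the least index is defined,
with value `0`, even when the jump time is not among the sampled values. -/
lemma exists_index (b : ℝ) (a : ℕ → ℝ) (n : ℕ) :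
    ∃ m, (a m : EReal) = jumpTime b a n ∨ ∀ m', (a m' : EReal) ≠ jumpTime b a n := by
  by_cases h : ∃ m, (a m : EReal) = jumpTime b a n
  · exact h.imp fun m hm => Or.inl hm
  · exact ⟨0, Or.inr (by simpa using h)⟩

/-- The state which goes with the `n`-th value of a nondecreasing step function, read off from a
sequence `a` of its values and the corresponding sequence `x` of states. -/
noncomputable def jumpState {α : Type*} (b : ℝ) (a : ℕ → ℝ) (x : ℕ → α) (n : ℕ) : α :=
  open Classical in x (Nat.find (exists_index b a n))

section Measurability

variable {Ω : Type*} [MeasurableSpace Ω] {b : Ω → ℝ} {a : ℕ → Ω → ℝ}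

lemma measurable_jumpTime (hb : Measurable b) (ha : ∀ m, Measurable (a m)) (n : ℕ) :
    Measurable fun ω => jumpTime (b ω) (fun m => a m ω) n := by
  classical
  induction n with
  | zero => exact measurable_coe_real_ereal.comp hb
  | succ n ih =>
    refine Measurable.iInf fun m => ?_
    have hm : Measurable fun ω => (a m ω : EReal) := measurable_coe_real_ereal.comp (ha m)
    exact Measurable.ite (measurableSet_lt ih hm) hm measurable_const

lemma measurable_jumpState {α : Type*} [MeasurableSpace α] (hb : Measurable b)
    (ha : ∀ m, Measurable (a m)) {x : ℕ → Ω → α} (hx : ∀ m, Measurable (x m)) (n : ℕ) :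
    Measurable fun ω => jumpState (b ω) (fun m => a m ω) (fun m => x m ω) n := by
  classical
  have hT := measurable_jumpTime hb ha n
  have hm : ∀ m, MeasurableSet {ω | (a m ω : EReal) = jumpTime (b ω) (fun m => a m ω) n} :=
    fun m => measurableSet_eq_fun (measurable_coe_real_ereal.comp (ha m)) hT
  refine Measurable.find (f := x) (p := fun m ω =>
    (a m ω : EReal) = jumpTime (b ω) (fun m => a m ω) n ∨
      ∀ m', (a m' ω : EReal) ≠ jumpTime (b ω) (fun m => a m ω) n) hx (fun m => ?_) _
  refine (hm m).union ?_
  have : {ω | ∀ m', (a m' ω : EReal) ≠ jumpTime (b ω) (fun m => a m ω) n} =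
      ⋂ m', {ω | (a m' ω : EReal) = jumpTime (b ω) (fun m => a m ω) n}ᶜ := by
    ext ω; simp
  change MeasurableSet {ω | ∀ m', (a m' ω : EReal) ≠ jumpTime (b ω) (fun m => a m ω) n}
  rw [this]
  exact MeasurableSet.iInter fun m => (hm m).compl

end Measurability

/-- The sequence `c` accumulates at `u` from the right, or attains `u`. -/
def Approaches (c : ℕ → ℝ≥0) (u : ℝ≥0) : Prop := ∀ r > u, ∃ m, u ≤ c m ∧ c m < r

lemma approaches_denseSeq (u : ℝ≥0) : Approaches (TopologicalSpace.denseSeq ℝ≥0) u := by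
  intro r hr
  obtain ⟨n, hn⟩ := (TopologicalSpace.denseRange_denseSeq ℝ≥0).exists_mem_open isOpen_Ioo
    (nonempty_Ioo.2 hr)
  exact ⟨n, hn.1.le, hn.2⟩

/-- Freezing the sampling times at `t` uses the path up to `t` only, and still detects every `u ≤
t`; for `u = t` the value itself is attained. -/
lemma approaches_min_denseSeq {u t : ℝ≥0} (hut : u ≤ t) :
    Approaches (fun m => min (TopologicalSpace.denseSeq ℝ≥0 m) t) u := by
  intro r hr
  obtain ⟨m, h1, h2⟩ := approaches_denseSeq u r hr
  exact ⟨m, le_min h1 hut, (min_le_left _ _).trans_lt h2⟩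

/-! ### Jump sequences of step paths -/

namespace IsStepPath

variable {α : Type*} {x : ℝ≥0 → α} {l : ℝ≥0 → ℝ}

lemma isNext_le (h : IsStepPath x l) {s u : ℝ≥0} (hu : IsNext x l s u) {v : ℝ≥0} (huv : u ≤ v) :
    (u : ℝ) ≤ l v := by
  have := h.monotone huv
  rwa [hu.2.2.1] at this

lemma le_of_lt_isNext (h : IsStepPath x l) {s u : ℝ≥0} (hu : IsNext x l s u) {v : ℝ≥0}
    (hvu : v < u) : l v ≤ l s := by
  rcases le_total v s with hvs | hvs
  · exact h.monotone hvs
  · exact (hu.2.1 v hvs hvu).le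

-- Every value of `l` above `l s` is at least `u`, and the value `u` is taken on an interval
-- starting at `u`, which the samples meet.
open scoped Classical in
lemma iInf_eq_of_isNext (h : IsStepPath x l) {s u : ℝ≥0} (hu : IsNext x l s u) {c : ℕ → ℝ≥0}
    (hc : Approaches c u) :
    (⨅ m, if (l s : EReal) < l (c m) then (l (c m) : EReal) else ⊤) = ((u : ℝ) : EReal) := by
  refine le_antisymm ?_ (le_iInf fun m => ?_)
  · obtain ⟨r, hr, H⟩ := h.right u
    obtain ⟨m, hm1, hm2⟩ := hc r hr
    refine (iInf_le _ m).trans ?_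
    have h1 : l (c m) = u := (H _ hm1 hm2).2.trans hu.2.2.1
    have h2 : l s < u := (h.le_self s).trans_lt (by exact_mod_cast hu.1)
    rw [h1, if_pos (by exact_mod_cast h2)]
  · split_ifs with hlt
    · rcases lt_or_ge (c m) u with hcu | hcu
      · exact absurd (h.le_of_lt_isNext hu hcu) (not_le.2 (by exact_mod_cast hlt))
      · exact_mod_cast h.isNext_le hu hcu
    · exact le_top

open scoped Classical in
lemma iInf_eq_top_of_isNext (h : IsStepPath x l) {s u : ℝ≥0} (hu : IsNext x l s u) {c : ℕ → ℝ≥0}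
    (hc : ∀ m, c m < u) :
    (⨅ m, if (l s : EReal) < l (c m) then (l (c m) : EReal) else ⊤) = ⊤ := by
  refine iInf_eq_top.2 fun m => if_neg ?_
  rw [not_lt]
  exact_mod_cast h.le_of_lt_isNext hu (hc m)

/-- The sequence `0, τ 1, τ 2, …`, where `τ 1 < τ 2 < …` are the jump times. -/
structure IsJumpSequence (x : ℝ≥0 → α) (l : ℝ≥0 → ℝ) (τ : ℕ → ℝ≥0) : Prop where
  zero : τ 0 = 0
  next : ∀ n, IsNext x l (τ n) (τ (n + 1))

lemma exists_isJumpSequence (hnext : ∀ t, ∃ u, IsNext x l t u) :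
    ∃ τ, IsJumpSequence x l τ := by
  choose f hf using hnext
  refine ⟨fun n => f^[n] 0, rfl, fun n => ?_⟩
  simp only [Function.iterate_succ_apply']
  exact hf _

namespace IsJumpSequence

variable {τ : ℕ → ℝ≥0}

lemma strictMono (hτ : IsJumpSequence x l τ) : StrictMono τ :=
  strictMono_nat_of_lt_succ fun n => (hτ.next n).1

lemma apply_succ (hτ : IsJumpSequence x l τ) (n : ℕ) : l (τ (n + 1)) = τ (n + 1) :=
  (hτ.next n).2.2.1

lemma toNNReal_apply (hτ : IsJumpSequence x l τ) (h : IsStepPath x l) (n : ℕ) :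
    (l (τ n)).toNNReal = τ n := by
  cases n with
  | zero => rw [hτ.zero]; exact Real.toNNReal_of_nonpos h.init
  | succ n => rw [hτ.apply_succ]; exact Real.toNNReal_coe

lemma strictMono_apply (hτ : IsJumpSequence x l τ) (h : IsStepPath x l) :
    StrictMono fun n => l (τ n) := by
  refine strictMono_nat_of_lt_succ fun n => (h.le_self _).trans_lt ?_
  rw [hτ.apply_succ]
  exact_mod_cast (hτ.next n).1

/-- Jump times cannot accumulate: to the left of a finite limit the path would be constant on an
interval containing two consecutive jump times, although `l` increases strictly along the jumps. -/
lemma exists_lt (hτ : IsJumpSequence x l τ) (h : IsStepPath x l) (t : ℝ≥0) : ∃ n, t < τ n := by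
  by_contra! hcon
  have hbdd : BddAbove (range τ) := ⟨t, by rintro _ ⟨n, rfl⟩; exact hcon n⟩
  set u := ⨆ n, τ n with hu
  have hlt : ∀ n, τ n < u := fun n => (hτ.next n).1.trans_le (le_ciSup hbdd (n + 1))
  obtain ⟨s, hsu, hs, -⟩ := h.left u (zero_le.trans_lt (hlt 0))
  obtain ⟨n, hn⟩ := exists_lt_of_lt_ciSup hsu
  have h1 := (hs (τ n) hn.le (hlt n)).2
  have h2 := (hs (τ (n + 1)) (hn.le.trans (hτ.next n).1.le) (hlt (n + 1))).2
  exact (hτ.strictMono_apply h n.lt_succ_self).ne (h1.trans h2.symm)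

lemma exists_mem_Ico (hτ : IsJumpSequence x l τ) (h : IsStepPath x l) (t : ℝ≥0) :
    ∃ n, τ n ≤ t ∧ t < τ (n + 1) := by
  classical
  have hex := hτ.exists_lt h t
  have hpos : Nat.find hex ≠ 0 := by
    intro h0
    have := Nat.find_spec hex
    rw [h0, hτ.zero] at this
    exact not_lt_bot this
  obtain ⟨n, hn⟩ := Nat.exists_eq_succ_of_ne_zero hpos
  refine ⟨n, not_lt.1 (Nat.find_min hex (by omega)), ?_⟩
  have := Nat.find_spec hex
  rwa [hn] at this

lemma state_eq (hτ : IsJumpSequence x l τ) (h : IsStepPath x l) {n : ℕ} {t : ℝ≥0}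
    (h1 : τ n ≤ t) (h2 : t < τ (n + 1)) : x t = x (τ n) :=
  h.state_eq_of_eq ((hτ.next n).2.1 t h1 h2)

lemma jumpTime_eq (hτ : IsJumpSequence x l τ) (h : IsStepPath x l) {c : ℕ → ℝ≥0} {n : ℕ}
    (hc : ∀ m ≤ n, Approaches c (τ m)) :
    jumpTime (l 0) (fun m => l (c m)) n = (l (τ n) : EReal) := by
  induction n with
  | zero => rw [hτ.zero]; rfl
  | succ n ih =>
    rw [jumpTime, ih fun m hm => hc m (hm.trans n.le_succ), hτ.apply_succ]
    exact h.iInf_eq_of_isNext (hτ.next n) (hc _ le_rfl)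

lemma jumpState_eq (hτ : IsJumpSequence x l τ) (h : IsStepPath x l) {c : ℕ → ℝ≥0} {n : ℕ}
    (hc : ∀ m ≤ n, Approaches c (τ m)) :
    jumpState (l 0) (fun m => l (c m)) (fun m => x (c m)) n = x (τ n) := by
  classical
  have hT := hτ.jumpTime_eq h hc
  obtain ⟨m, hm1, hm2⟩ := hc n le_rfl _ (hτ.next n).1
  have hlm := (hτ.next n).2.1 _ hm1 hm2
  have hspec := Nat.find_spec (exists_index (l 0) (fun m => l (c m)) n)
  rcases hspec with hf | hf
  · exact h.state_eq_of_eq (by exact_mod_cast hf.trans hT)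
  · exact absurd (by rw [hlm, hT]) (hf m)

/-- Samples frozen at `t` show no value beyond the last jump before `t`, so the infimum is over an
empty set of candidates. The value `⊤` therefore marks the jumps which have not yet occurred at time
`t`. -/
lemma jumpTime_min_eq_top (hτ : IsJumpSequence x l τ) (h : IsStepPath x l) {d : ℕ → ℝ≥0}
    {t : ℝ≥0} (hc : ∀ u ≤ t, Approaches (fun m => min (d m) t) u) {n : ℕ} (hn : t < τ n) :
    jumpTime (l 0) (fun m => l (min (d m) t)) n = ⊤ := by
  induction n with
  | zero => rw [hτ.zero] at hn; exact absurd hn not_lt_bot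
  | succ n ih =>
    rcases lt_or_ge t (τ n) with hlt | hge
    · simp [jumpTime, ih hlt]
    · rw [jumpTime, hτ.jumpTime_eq h fun m hm => hc _ ((hτ.strictMono.monotone hm).trans hge)]
      exact h.iInf_eq_top_of_isNext (hτ.next n) fun m => (min_le_right _ _).trans_lt hn

lemma continuousAt_iff [TopologicalSpace α] [DiscreteTopology α] (hτ : IsJumpSequence x l τ)
    (h : IsStepPath x l) (t : ℝ≥0) : ¬ ContinuousAt x t ↔ ∃ n, t = τ (n + 1) := by
  constructor
  · intro hcont
    obtain ⟨n, h1, h2⟩ := hτ.exists_mem_Ico h t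
    by_contra! hne
    refine hcont ?_
    have hmem : Ico (τ n) (τ (n + 1)) ∈ 𝓝 t := by
      cases n with
      | zero =>
        rw [hτ.zero]
        exact mem_of_superset (Iio_mem_nhds h2) fun v hv => ⟨zero_le, hv⟩
      | succ n => exact Ico_mem_nhds (lt_of_le_of_ne h1 (hne n).symm) h2
    refine (continuousAt_const (y := x t)).congr ?_
    filter_upwards [hmem] with v hv
    rw [hτ.state_eq h h1 h2, hτ.state_eq h hv.1 hv.2]
  · rintro ⟨n, rfl⟩ hcont
    have hlt := (hτ.next n).1
    have h1 : ∀ᶠ v in 𝓝 (τ (n + 1)), x v = x (τ (n + 1)) :=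
      hcont.eventually (IsOpen.mem_nhds (isOpen_discrete {x (τ (n + 1))}) rfl)
    have hnebot : (𝓝[<] (τ (n + 1))).NeBot := nhdsLT_neBot_of_exists_lt ⟨_, hlt⟩
    obtain ⟨v, hv1, hv2⟩ := ((h1.filter_mono nhdsWithin_le_nhds).and
      (Ico_mem_nhdsLT hlt)).exists
    exact (hτ.next n).2.2.2 (hv1.symm.trans (hτ.state_eq h hv2.1 hv2.2))

end IsJumpSequence

lemma continuousWithinAt_Ici [TopologicalSpace α] (h : IsStepPath x l) (t : ℝ≥0) :
    ContinuousWithinAt x (Ici t) t := by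
  obtain ⟨r, hr, H⟩ := h.right t
  refine (continuousWithinAt_const (b := x t)).congr_of_eventuallyEq ?_ rfl
  filter_upwards [Ico_mem_nhdsGE hr] with s hs
  exact (H s hs.1 hs.2).1

lemma exists_tendsto_left [TopologicalSpace α] (h : IsStepPath x l) (t : ℝ≥0) :
    ∃ a, Tendsto x (𝓝[<] t) (𝓝 a) := by
  rcases eq_or_lt_of_le (zero_le : 0 ≤ t) with rfl | ht
  · refine ⟨x 0, ?_⟩
    have : Iio (0 : ℝ≥0) = ∅ := Set.Iio_bot
    rw [this, nhdsWithin_empty]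
    exact tendsto_bot
  · obtain ⟨s, hst, hs, -⟩ := h.left t ht
    refine ⟨x s, tendsto_const_nhds.congr' ?_⟩
    filter_upwards [Ico_mem_nhdsLT hst] with r hr
    exact (hs r hr.1 hr.2).1.symm

end IsStepPath

/-! ### Jump times and states of the solution -/

section JumpProcess

variable {Ω : Type*} {k : ℕ}

/-- The time of the last jump before `t`, when the age at time `t` is `Y t`. -/
def lastJump (Y : ℝ≥0 → Ω → ℝ) (t : ℝ≥0) (ω : Ω) : ℝ := t - Y t ω

/-- The jump times, with `jumpTimes Y 0 = -Y 0`. -/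
noncomputable def jumpTimes (Y : ℝ≥0 → Ω → ℝ) (n : ℕ) (ω : Ω) : ℝ :=
  (jumpTime (lastJump Y 0 ω)
    (fun m => lastJump Y (TopologicalSpace.denseSeq ℝ≥0 m) ω) n).toReal

/-- The successive states. -/
noncomputable def jumpStates (X : ℝ≥0 → Ω → Fin k) (Y : ℝ≥0 → Ω → ℝ) (n : ℕ) (ω : Ω) : Fin k :=
  jumpState (lastJump Y 0 ω) (fun m => lastJump Y (TopologicalSpace.denseSeq ℝ≥0 m) ω)
    (fun m => X (TopologicalSpace.denseSeq ℝ≥0 m) ω) n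

/-- The history of the jumps up to the `n`-th one. -/
noncomputable def jumpHistory (X : ℝ≥0 → Ω → Fin k) (Y : ℝ≥0 → Ω → ℝ) (n : ℕ) (ω : Ω)
    (m : Fin (n + 1)) : Fin k × ℝ :=
  (jumpStates X Y m ω, jumpTimes Y m ω)

lemma jumpTimes_zero (Y : ℝ≥0 → Ω → ℝ) : jumpTimes Y 0 = fun ω => -(Y 0 ω) := by
  ext ω
  simp [jumpTimes, jumpTime, lastJump]

/-- The paths of a solution with their jump times `τ`. -/
structure IsGoodPath (lam : Fin k → Fin k → ℝ → ℝ) (K : ℝ) (m : Measure (ℝ≥0 × ℝ))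
    (X : ℝ≥0 → Ω → Fin k) (Y : ℝ≥0 → Ω → ℝ) (ω : Ω) (τ : ℕ → ℝ≥0) : Prop where
  configuration : IsSimpleConfiguration m K
  solves : SolvesEquations lam m (fun t => X t ω) (fun t => Y t ω)
  step : IsStepPath (fun t => X t ω) (fun t => lastJump Y t ω)
  jumps : IsStepPath.IsJumpSequence (fun t => X t ω) (fun t => lastJump Y t ω) τ
  time : ∀ n, jumpTimes Y n ω = lastJump Y (τ n) ω
  state : ∀ n, jumpStates X Y n ω = X (τ n) ω

namespace IsGoodPath

variable {lam : Fin k → Fin k → ℝ → ℝ} {K : ℝ} {m : Measure (ℝ≥0 × ℝ)}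
  {X : ℝ≥0 → Ω → Fin k} {Y : ℝ≥0 → Ω → ℝ} {ω : Ω} {τ : ℕ → ℝ≥0}

lemma time_succ (h : IsGoodPath lam K m X Y ω τ) (n : ℕ) : jumpTimes Y (n + 1) ω = τ (n + 1) :=
  (h.time _).trans (h.jumps.apply_succ n)

lemma toNNReal_time (h : IsGoodPath lam K m X Y ω τ) (n : ℕ) :
    (jumpTimes Y n ω).toNNReal = τ n := by
  rw [h.time]
  exact h.jumps.toNNReal_apply h.step n

end IsGoodPath

variable {mΩ : MeasurableSpace Ω} {P : Measure Ω} {𝓕 : Filtration ℝ≥0 mΩ}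
  {N : Ω → Measure (ℝ≥0 × ℝ)} {lam : Fin k → Fin k → ℝ → ℝ}
  {X : ℝ≥0 → Ω → Fin k} {Y : ℝ≥0 → Ω → ℝ}

namespace IsStrongSolution

lemma ae_isGoodPath [IsProbabilityMeasure P] (hN : IsPoissonNoise P 𝓕 N)
    (hlam : IsRateFunction lam) (h : IsStrongSolution P 𝓕 N lam X Y) {K : ℝ}
    (hstrip : ∀ i j y, i ≠ j → rateInterval lam i j y ⊆ Ico 0 K) :
    ∀ᵐ ω ∂P, ∃ τ, IsGoodPath lam K (N ω) X Y ω τ := by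
  filter_upwards [hN.poisson.ae_isSimpleConfiguration K, h.ae_solvesEquations,
    h.ae_exists_isNext hN hlam] with ω h1 h2 h3
  have hstep : IsStepPath (fun t => X t ω) (fun t => lastJump Y t ω) :=
    h2.isStepPath h1 hlam hstrip
  obtain ⟨τ, hτ⟩ : ∃ τ, IsStepPath.IsJumpSequence (fun t => X t ω) (fun t => lastJump Y t ω) τ :=
    IsStepPath.exists_isJumpSequence h3
  refine ⟨τ, h1, h2, hstep, hτ, fun n => ?_, fun n => ?_⟩
  · rw [jumpTimes, hτ.jumpTime_eq hstep fun m _ => approaches_denseSeq _]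
    rfl
  · exact hτ.jumpState_eq hstep fun m _ => approaches_denseSeq _

lemma measurable_lastJump' (h : IsStrongSolution P 𝓕 N lam X Y) (t : ℝ≥0) :
    Measurable (lastJump Y t) :=
  (h.measurable_lastJump t).mono (𝓕.le t) le_rfl

lemma measurable_jumpTimes (h : IsStrongSolution P 𝓕 N lam X Y) (n : ℕ) :
    Measurable (jumpTimes Y n) :=
  (measurable_jumpTime (h.measurable_lastJump' 0) (fun _ => h.measurable_lastJump' _)
    n).ereal_toReal

lemma measurable_jumpStates (h : IsStrongSolution P 𝓕 N lam X Y) (n : ℕ) :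
    Measurable (jumpStates X Y n) :=
  measurable_jumpState (h.measurable_lastJump' 0) (fun _ => h.measurable_lastJump' _)
    (fun _ => (h.adapted_X _).mono (𝓕.le _) le_rfl) n

lemma measurable_jumpHistory (h : IsStrongSolution P 𝓕 N lam X Y) (n : ℕ) :
    Measurable (jumpHistory X Y n) :=
  measurable_pi_lambda _ fun m => (h.measurable_jumpStates m).prodMk (h.measurable_jumpTimes m)

lemma isPiecewiseConstant [IsProbabilityMeasure P] (hN : IsPoissonNoise P 𝓕 N)
    (hlam : IsRateFunction lam) (h : IsStrongSolution P 𝓕 N lam X Y) :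
    IsPiecewiseConstant P X (jumpTimes Y) (jumpStates X Y) := by
  obtain ⟨K, -, hstrip, -⟩ := hlam.exists_strip
  have hgood := h.ae_isGoodPath hN hlam hstrip
  refine ⟨h.measurable_jumpTimes, h.measurable_jumpStates, ?_, ?_, ?_, ?_, ?_⟩
  · filter_upwards [hgood] with ω ⟨τ, hτ⟩ t
    exact ⟨hτ.step.continuousWithinAt_Ici t, hτ.step.exists_tendsto_left t⟩
  · filter_upwards [hgood] with ω ⟨τ, hτ⟩
    refine ⟨?_, ?_⟩
    · rw [hτ.time, hτ.jumps.zero]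
      exact hτ.step.init
    · rw [hτ.time_succ 0]
      exact_mod_cast zero_le.trans_lt (hτ.jumps.next 0).1
  · filter_upwards [hgood] with ω ⟨τ, hτ⟩
    have hmono : StrictMono fun n => jumpTimes Y n ω := by
      simp_rw [hτ.time]
      exact hτ.jumps.strictMono_apply hτ.step
    refine ⟨hmono, tendsto_atTop_atTop_of_monotone hmono.monotone fun b => ?_⟩
    obtain ⟨n, hn⟩ := hτ.jumps.exists_lt hτ.step b.toNNReal
    refine ⟨n + 1, ?_⟩
    rw [hτ.time_succ]
    have h1 : b.toNNReal ≤ τ (n + 1) := (hn.trans (hτ.jumps.next n).1).le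
    exact Real.toNNReal_le_iff_le_coe.1 h1
  · filter_upwards [hgood] with ω ⟨τ, hτ⟩
    ext s
    constructor
    · rintro ⟨t, rfl, ht⟩
      obtain ⟨n, rfl⟩ := (hτ.jumps.continuousAt_iff hτ.step t).1 ht
      exact ⟨n + 1, by omega, (hτ.time_succ n).symm⟩
    · rintro ⟨n, hn, rfl⟩
      obtain ⟨n, rfl⟩ := Nat.exists_eq_add_of_le' hn
      exact ⟨τ (n + 1), (hτ.time_succ n).symm, (hτ.jumps.continuousAt_iff hτ.step _).2 ⟨n, rfl⟩⟩
  · filter_upwards [hgood] with ω ⟨τ, hτ⟩ n t h1 h2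
    rw [hτ.state]
    refine hτ.jumps.state_eq hτ.step ?_ ?_
    · rw [← hτ.toNNReal_time]
      exact Real.toNNReal_le_iff_le_coe.2 h1
    · rw [hτ.time_succ] at h2
      exact_mod_cast h2

/-- The history up to the `n`-th jump is known at time `t` if the `n`-th jump has occurred. -/
lemma measurableSet_jumpHistory [IsProbabilityMeasure P] (hN : IsPoissonNoise P 𝓕 N)
    (hlam : IsRateFunction lam) (h : IsStrongSolution P 𝓕 N lam X Y) (n : ℕ) (t : ℝ≥0)
    {H : Set (Fin (n + 1) → Fin k × ℝ)} (hH : MeasurableSet H) :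
    MeasurableSet[augmentedFiltration 𝓕 P t]
      {ω | jumpHistory X Y n ω ∈ H ∧ (jumpTimes Y n ω).toNNReal ≤ t} := by
  obtain ⟨K, -, hstrip, -⟩ := hlam.exists_strip
  set d := TopologicalSpace.denseSeq ℝ≥0 with hd
  -- `J` and `U` reconstruct the jumps from the path sampled at times `min (d m) t`, so they are `𝓕
  -- t`-measurable. On good paths they agree with the true jumps up to time `t`; elsewhere nothing
  -- is known, whence the augmentation.
  let J : ℕ → Ω → EReal := fun m ω =>
    jumpTime (lastJump Y 0 ω) (fun m => lastJump Y (min (d m) t) ω) m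
  let U : ℕ → Ω → Fin k := fun m ω =>
    jumpState (lastJump Y 0 ω) (fun m => lastJump Y (min (d m) t) ω)
      (fun m => X (min (d m) t) ω) m
  have hb : Measurable[𝓕 t] (lastJump Y 0) :=
    (h.measurable_lastJump 0).mono (𝓕.mono zero_le) le_rfl
  have ha : ∀ m, Measurable[𝓕 t] (lastJump Y (min (d m) t)) := fun m =>
    (h.measurable_lastJump _).mono (𝓕.mono (min_le_right _ _)) le_rfl
  have hx : ∀ m, Measurable[𝓕 t] (X (min (d m) t)) := fun m =>
    (h.adapted_X _).mono (𝓕.mono (min_le_right _ _)) le_rfl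
  have hJ : ∀ m, Measurable[𝓕 t] (J m) := fun m =>
    @measurable_jumpTime Ω (𝓕 t) _ _ hb ha m
  have hU : ∀ m, Measurable[𝓕 t] (U m) := fun m =>
    @measurable_jumpState Ω (𝓕 t) _ _ _ _ hb ha _ hx m
  have hhist : Measurable[𝓕 t] fun ω (m : Fin (n + 1)) => (U m ω, (J m ω).toReal) :=
    @measurable_pi_lambda _ _ _ (𝓕 t) _ _ fun m => (hU m).prodMk (hJ m).ereal_toReal
  refine measurableSet_augmentedFiltration.2 ⟨⟨{ω | (fun m : Fin (n + 1) =>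
    (U m ω, (J m ω).toReal)) ∈ H} ∩ {ω | J n ω = ⊤}ᶜ, ?_, ?_⟩, ?_⟩
  · exact (hhist hH).inter (hJ n (measurableSet_singleton ⊤)).compl
  · filter_upwards [h.ae_isGoodPath hN hlam hstrip] with ω ⟨τ, hτ⟩
    refine propext ?_
    change (jumpHistory X Y n ω ∈ H ∧ (jumpTimes Y n ω).toNNReal ≤ t) ↔
      ((fun m : Fin (n + 1) => (U m ω, (J m ω).toReal)) ∈ H ∧ J n ω ≠ ⊤)
    rw [hτ.toNNReal_time]
    rcases le_or_gt (τ n) t with hle | hlt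
    · have happ : ∀ m ≤ n, ∀ m' ≤ m, Approaches (fun m => min (d m) t) (τ m') := fun m hm m' hm' =>
        approaches_min_denseSeq ((hτ.jumps.strictMono.monotone (hm'.trans hm)).trans hle)
      have h1 : ∀ m ≤ n, J m ω = (jumpTimes Y m ω : EReal) := fun m hm => by
        rw [hτ.time]
        exact hτ.jumps.jumpTime_eq hτ.step (happ m hm)
      have h2 : ∀ m ≤ n, U m ω = jumpStates X Y m ω := fun m hm => by
        rw [hτ.state]
        exact hτ.jumps.jumpState_eq hτ.step (happ m hm)
      have h3 : (fun m : Fin (n + 1) => (U m ω, (J m ω).toReal)) = jumpHistory X Y n ω := by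
        ext m : 1
        have hm : (m : ℕ) ≤ n := Nat.lt_succ_iff.1 m.2
        rw [h1 m hm, h2 m hm]
        rfl
      rw [h3, h1 n le_rfl]
      simp [hle]
    · have h1 : J n ω = ⊤ := hτ.jumps.jumpTime_min_eq_top hτ.step
        (fun u hu => approaches_min_denseSeq hu) hlt
      simp [h1, hlt]
  · exact (h.measurable_jumpHistory n hH).inter
      ((measurable_real_toNNReal.comp (h.measurable_jumpTimes n)) measurableSet_Iic)

end IsStrongSolution

end JumpProcess

/-! ### Volterra uniqueness and elementary conditional probabilities -/

/-- Uniqueness for the Volterra equation `w(y) = -∫_0^y r w` among bounded functions. -/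
lemma eq_zero_of_volterra {r w : ℝ → ℝ} {K C : ℝ} (hK : ∀ v, |r v| ≤ K) (hC : ∀ v, |w v| ≤ C)
    (h : ∀ y, 0 < y → w y = -∫ v in Ioc 0 y, r v * w v) {y : ℝ} (hy : 0 < y) : w y = 0 := by
  have hK0 : 0 ≤ K := (abs_nonneg _).trans (hK 0)
  -- Iterating the equation improves the constant bound to the terms of an exponential series, which
  -- tend to `0`.
  have hbound : ∀ n : ℕ, ∀ y : ℝ, 0 < y → |w y| ≤ C * ((K * y) ^ n / n.factorial) := by
    intro n
    induction n with
    | zero => intro y _; simpa using hC y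
    | succ n ih =>
      intro y hy
      rw [h y hy, abs_neg]
      have hcont : Continuous fun v : ℝ => K * (C * ((K * v) ^ n / n.factorial)) := by fun_prop
      calc |∫ v in Ioc 0 y, r v * w v|
          ≤ ∫ v in Ioc 0 y, K * (C * ((K * v) ^ n / n.factorial)) := by
            rw [← Real.norm_eq_abs]
            refine norm_integral_le_of_norm_le (hcont.integrableOn_Ioc (μ := volume)) ?_
            filter_upwards [ae_restrict_mem measurableSet_Ioc] with v hv
            rw [Real.norm_eq_abs, abs_mul]
            exact mul_le_mul (hK v) (ih v hv.1) (abs_nonneg _) hK0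
        _ = C * ((K * y) ^ (n + 1) / (n + 1).factorial) := by
            rw [← intervalIntegral.integral_of_le hy.le]
            have : ∀ v : ℝ, K * (C * ((K * v) ^ n / n.factorial)) =
                (K ^ (n + 1) * C / n.factorial) * v ^ n := fun v => by
              rw [mul_pow]; ring
            simp_rw [this]
            rw [intervalIntegral.integral_const_mul, integral_pow, Nat.factorial_succ]
            push_cast
            field_simp
            ring
  have hlim : Tendsto (fun n : ℕ => C * ((K * y) ^ n / n.factorial)) atTop (𝓝 0) := by
    simpa using (FloorSemiring.tendsto_pow_div_factorial_atTop (K * y)).const_mul C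
  exact abs_eq_zero.1 (le_antisymm (ge_of_tendsto' hlim fun n => hbound n y hy) (abs_nonneg _))

/-- If, given the state `ξ`, the event `E` is independent of the events of `m`, then the conditional
probability of `E` given `m` is an elementary conditional probability. -/
lemma condExp_eq_of_forall_inter {Ω : Type*} {m mΩ : MeasurableSpace Ω} {P : Measure Ω}
    [IsProbabilityMeasure P] {k : ℕ} (hm : m ≤ mΩ) {ξ : Ω → Fin k}
    (hξ : Measurable[m] ξ) {E : Set Ω} (hE : MeasurableSet[mΩ] E)
    (h : ∀ A, MeasurableSet[m] A → ∀ i, P (A ∩ ξ ⁻¹' {i} ∩ E) * P (ξ ⁻¹' {i}) =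
      P (A ∩ ξ ⁻¹' {i}) * P (ξ ⁻¹' {i} ∩ E)) :
    P⟦E | m⟧ =ᵐ[P] fun ω => P.real (ξ ⁻¹' {ξ ω} ∩ E) / P.real (ξ ⁻¹' {ξ ω}) := by
  set q : Fin k → ℝ := fun i => P.real (ξ ⁻¹' {i} ∩ E) / P.real (ξ ⁻¹' {i}) with hq
  have hqm : Measurable[m] fun ω => q (ξ ω) := (measurable_of_finite q).comp hξ
  have hξi : ∀ i, MeasurableSet[mΩ] (ξ ⁻¹' {i}) := fun i => hm _ (hξ (measurableSet_singleton i))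
  have hint : Integrable (fun ω => q (ξ ω)) P := by
    refine Integrable.of_bound (hqm.mono hm le_rfl).aestronglyMeasurable (∑ i, |q i|)
      (ae_of_all _ fun ω => ?_)
    exact Finset.single_le_sum (f := fun i => |q i|) (fun i _ => abs_nonneg _)
      (Finset.mem_univ (ξ ω))
  refine (ae_eq_condExp_of_forall_setIntegral_eq hm ((integrable_const (1 : ℝ)).indicator hE)
    (fun A _ _ => hint.integrableOn) (fun A hA _ => ?_)
    hqm.stronglyMeasurable.aestronglyMeasurable).symm
  have hAm : MeasurableSet[mΩ] A := hm _ hA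
  have hAU : A = ⋃ i, A ∩ ξ ⁻¹' {i} := by
    ext ω; simp
  have hdisj : Pairwise (Function.onFun Disjoint fun i => A ∩ ξ ⁻¹' {i}) := by
    intro i j hij
    refine Set.disjoint_left.2 ?_
    rintro ω ⟨-, hi⟩ ⟨-, hj⟩
    exact hij (hi.symm.trans hj)
  have hmeas : ∀ i, MeasurableSet[mΩ] (A ∩ ξ ⁻¹' {i}) := fun i => hAm.inter (hξi i)
  rw [hAU, integral_iUnion_fintype hmeas hdisj fun i => hint.integrableOn,
    integral_iUnion_fintype hmeas hdisj
      fun i => ((integrable_const (1 : ℝ)).indicator hE).integrableOn]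
  refine Finset.sum_congr rfl fun i _ => ?_
  rw [setIntegral_congr_fun (g := fun _ => q i) (hmeas i)
    fun ω hω => by simp only [show ξ ω = i from hω.2], setIntegral_const,
    setIntegral_indicator hE, setIntegral_const, smul_eq_mul, smul_eq_mul, mul_one]
  have hi := congrArg ENNReal.toReal (h A hA i)
  rw [ENNReal.toReal_mul, ENNReal.toReal_mul] at hi
  simp only [← measureReal_def] at hi
  -- If the state `i` has probability `0`, the quotient has a default value, but both sides are
  -- integrals over null sets.
  rcases eq_or_ne (P.real (ξ ⁻¹' {i})) 0 with h0 | h0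
  · have h1 : P.real (A ∩ ξ ⁻¹' {i}) = 0 :=
      le_antisymm (h0 ▸ measureReal_mono inter_subset_right) measureReal_nonneg
    have h2 : P.real (A ∩ ξ ⁻¹' {i} ∩ E) = 0 :=
      le_antisymm (h1 ▸ measureReal_mono inter_subset_left) measureReal_nonneg
    rw [h1, h2, zero_mul]
  · rw [hq]
    field_simp
    rw [← hi, mul_comm]

/-! ### The law of the next transition and the semi-Markov property -/

section Transition

variable {Ω : Type*} {mΩ : MeasurableSpace Ω} {P : Measure Ω}
  {𝓕 : Filtration ℝ≥0 mΩ} {N : Ω → Measure (ℝ≥0 × ℝ)} {k : ℕ} {lam : Fin k → Fin k → ℝ → ℝ}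
  {X : ℝ≥0 → Ω → Fin k} {Y : ℝ≥0 → Ω → ℝ}

/-- The sojourn time after the `n`-th jump. -/
noncomputable def sojourn (Y : ℝ≥0 → Ω → ℝ) (n : ℕ) (ω : Ω) : ℝ :=
  jumpTimes Y (n + 1) ω - jumpTimes Y n ω

namespace IsStrongSolution

lemma measurable_sojourn (h : IsStrongSolution P 𝓕 N lam X Y) (n : ℕ) :
    Measurable (sojourn Y n) :=
  (h.measurable_jumpTimes _).sub (h.measurable_jumpTimes _)

variable [IsProbabilityMeasure P]

/-- The joint law of the sojourn time after the jump number `n + 1` and of the next state, on an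
event `A` which depends on the history and on which the current state is `i`. -/
lemma measure_transition (hN : IsPoissonNoise P 𝓕 N) (hlam : IsRateFunction lam)
    (h : IsStrongSolution P 𝓕 N lam X Y) (n : ℕ) {H : Set (Fin (n + 1 + 1) → Fin k × ℝ)}
    (hH : MeasurableSet H) (i j : Fin k) {A : Set Ω}
    (hA : A = jumpHistory X Y (n + 1) ⁻¹' H ∩ jumpStates X Y (n + 1) ⁻¹' {i})
    {R : Set ℝ} (hR : MeasurableSet R) :
    P (A ∩ {ω | jumpStates X Y (n + 2) ω = j ∧ sojourn Y (n + 1) ω ∈ R}) =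
      ∫⁻ v in R ∩ Ioi 0, ENNReal.ofReal (cutRate lam i j v) *
        P (A ∩ {ω | v ≤ sojourn Y (n + 1) ω}) := by
  classical
  obtain ⟨K, -, hstrip, -⟩ := hlam.exists_strip
  have hgood := h.ae_isGoodPath hN hlam hstrip
  have hAm : MeasurableSet A := by
    rw [hA]
    exact (h.measurable_jumpHistory _ hH).inter
      (h.measurable_jumpStates _ (measurableSet_singleton i))
  have hD := h.measurable_sojourn (n + 1)
  -- Every jump changes the state, so the left side vanishes on the diagonal, as does the cut-off
  -- rate.
  by_cases hij : i = j
  · have hnull : P (A ∩ {ω | jumpStates X Y (n + 2) ω = j ∧ sojourn Y (n + 1) ω ∈ R}) = 0 := by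
      rw [measure_eq_zero_iff_ae_notMem]
      filter_upwards [hgood] with ω ⟨τ, hτ⟩ hω
      rw [hA] at hω
      refine (hτ.jumps.next (n + 1)).2.2.2 ?_
      simp only
      rw [← hτ.state, ← hτ.state, hω.2.1, ← hij]
      exact hω.1.2.symm
    rw [hnull]
    simp [cutRate, hij]
  set σ : Ω → ℝ≥0 := fun ω => (jumpTimes Y (n + 1) ω).toNNReal with hσ
  set S := predictableRegion A σ (jumpTimes Y (n + 1)) (lastJump Y) R (rateInterval lam i j) with hS
  have hSm : MeasurableSet[(augmentedFiltration 𝓕 P).predictable.prod inferInstance] S := by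
    refine measurableSet_predictableRegion hlam hij
      (fun t => (h.measurable_lastJump t).mono (le_augmentedFiltration 𝓕 P t) le_rfl)
      (fun t B hB => ?_) hR
    have hlast : Measurable fun x : Fin (n + 1 + 1) → Fin k × ℝ =>
        ((x (Fin.last _)).2.toNNReal, (x (Fin.last _)).2) := by fun_prop
    have hstate : Measurable fun x : Fin (n + 1 + 1) → Fin k × ℝ => (x (Fin.last _)).1 := by
      fun_prop
    convert h.measurableSet_jumpHistory hN hlam (n + 1) t
      ((hH.inter (hstate (measurableSet_singleton i))).inter (hlast hB)) using 1
    ext ω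
    rw [hA]
    exact ⟨fun hω => ⟨⟨hω.1.1, hω.2⟩, hω.1.2⟩, fun hω => ⟨⟨hω.1.1, hω.2⟩, hω.1.2⟩⟩
  have hSK : ∀ p ∈ S, 0 < p.1.1 ∧ p.2 ∈ Ico 0 K := fun p hp =>
    ⟨zero_le.trans_lt hp.2.1, hstrip i j _ hij hp.2.2.2.2⟩
  have hsec : ∀ ω τ, IsGoodPath lam K (N ω) X Y ω τ → ω ∈ A → pathSection S ω =
      jumpRegion (fun t => lastJump Y t ω) (τ (n + 1)) R (rateInterval lam i j) := by
    intro ω τ hτ hω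
    rw [← hτ.toNNReal_time]
    refine pathSection_predictableRegion_of_mem hω ?_ hτ.step R _
    change jumpTimes Y (n + 1) ω = lastJump Y (jumpTimes Y (n + 1) ω).toNNReal ω
    rw [hτ.toNNReal_time]
    exact hτ.time _
  have hDτ : ∀ ω τ, IsGoodPath lam K (N ω) X Y ω τ →
      (τ (n + 2) : ℝ) - τ (n + 1) = sojourn Y (n + 1) ω := by
    intro ω τ hτ
    rw [sojourn, hτ.time_succ, hτ.time_succ]
  have hEm : MeasurableSet
      (A ∩ {ω | jumpStates X Y (n + 2) ω = j ∧ sojourn Y (n + 1) ω ∈ R}) :=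
    hAm.inter ((h.measurable_jumpStates _ (measurableSet_singleton j)).inter (hD hR))
  -- On `A` the region contains exactly one point if the next jump leads to `j` after a sojourn in
  -- `R`, and none otherwise.
  have hleft : ∫⁻ ω, N ω (pathSection S ω) ∂P =
      P (A ∩ {ω | jumpStates X Y (n + 2) ω = j ∧ sojourn Y (n + 1) ω ∈ R}) := by
    rw [← lintegral_indicator_one hEm]
    refine lintegral_congr_ae ?_
    filter_upwards [hgood] with ω ⟨τ, hτ⟩
    by_cases hω : ω ∈ A
    · have hXi : X (τ (n + 1)) ω = i := by
        rw [← hτ.state]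
        rw [hA] at hω
        exact hω.2
      have := hτ.solves.measure_jumpRegion_of_isNext hτ.configuration hlam hstrip
        (hτ.jumps.next (n + 1)) R (j := j) (by rwa [hXi])
      rw [hXi] at this
      rw [hsec ω τ hτ hω]
      refine this.trans ?_
      rw [hDτ ω τ hτ, indicator_apply]
      refine if_congr ?_ rfl rfl
      rw [← hτ.state]
      exact ⟨fun hc => ⟨hω, hc⟩, fun hc => hc.2⟩
    · rw [hS, pathSection_predictableRegion_of_notMem hω, measure_empty,
        indicator_of_notMem fun hc => hω hc.1]
  set f : Ω → ℝ → ℝ≥0∞ := fun ω v =>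
    {q : Ω × ℝ | q.1 ∈ A ∧ q.2 ≤ sojourn Y (n + 1) q.1}.indicator
      (fun q => ENNReal.ofReal (cutRate lam i j q.2)) (ω, v) with hf
  have hset : MeasurableSet {q : Ω × ℝ | q.1 ∈ A ∧ q.2 ≤ sojourn Y (n + 1) q.1} :=
    (measurable_fst hAm).inter (measurableSet_le measurable_snd (hD.comp measurable_fst))
  have hfm : Measurable (Function.uncurry f) := by
    have : Measurable fun q : Ω × ℝ => ENNReal.ofReal (cutRate lam i j q.2) :=
      ((hlam.measurable_cutRate i j).comp measurable_snd).ennreal_ofReal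
    exact this.indicator hset
  have hright : ∫⁻ ω, lebesgueIntensity (pathSection S ω) ∂P =
      ∫⁻ ω, (∫⁻ v in R ∩ Ioi 0, f ω v) ∂P := by
    refine lintegral_congr_ae ?_
    filter_upwards [hgood] with ω ⟨τ, hτ⟩
    by_cases hω : ω ∈ A
    -- After an actual jump the age is `0`, so the rates depend on the elapsed time alone. This
    -- fails for the initial time, where the age is `Y_0`.
    · have hls : lastJump Y (τ (n + 1)) ω = τ (n + 1) := hτ.jumps.apply_succ n
      rw [hsec ω τ hτ hω]
      refine (lebesgueIntensity_jumpRegion_of_isNext hlam hij hτ.step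
        (hτ.jumps.next (n + 1)) hR).trans ?_
      simp only [hls, add_sub_cancel_left, hDτ ω τ hτ]
      rw [← lintegral_indicator (hR.inter measurableSet_Ioc),
        ← lintegral_indicator (hR.inter measurableSet_Ioi)]
      refine lintegral_congr fun v => ?_
      by_cases hv : v ∈ R ∩ Ioi 0
      · rw [indicator_of_mem hv, hf]
        by_cases hv' : v ≤ sojourn Y (n + 1) ω
        · rw [indicator_of_mem (show v ∈ R ∩ Ioc 0 (sojourn Y (n + 1) ω) from ⟨hv.1, hv.2, hv'⟩)]
          exact (indicator_of_mem (s := {q : Ω × ℝ | q.1 ∈ A ∧ q.2 ≤ sojourn Y (n + 1) q.1})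
            (a := (ω, v)) ⟨hω, hv'⟩ fun q => ENNReal.ofReal (cutRate lam i j q.2)).symm
        · rw [indicator_of_notMem (s := R ∩ Ioc 0 (sojourn Y (n + 1) ω)) fun hc => hv' hc.2.2]
          exact (indicator_of_notMem (s := {q : Ω × ℝ | q.1 ∈ A ∧ q.2 ≤ sojourn Y (n + 1) q.1})
            (a := (ω, v)) (fun hc => hv' hc.2)
            fun q => ENNReal.ofReal (cutRate lam i j q.2)).symm
      · rw [indicator_of_notMem hv, indicator_of_notMem
          (s := R ∩ Ioc 0 (sojourn Y (n + 1) ω)) fun hc => hv ⟨hc.1, hc.2.1⟩]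
    · have hf0 : ∀ v, f ω v = 0 := fun v => indicator_of_notMem (fun hc => hω hc.1) _
      rw [hS, pathSection_predictableRegion_of_notMem hω, measure_empty]
      simp [hf0]
  rw [← hleft, hN.lintegral_pathSection hSm hSK, hright,
    lintegral_lintegral_swap hfm.aemeasurable]
  refine lintegral_congr fun v => ?_
  have hAv : MeasurableSet (A ∩ {ω | v ≤ sojourn Y (n + 1) ω}) :=
    hAm.inter (hD measurableSet_Ici)
  rw [← lintegral_indicator_const hAv]
  rfl

/-- The law of the sojourn time after the jump number `n + 1`, as a Volterra equation. -/
lemma measureReal_sojourn (hN : IsPoissonNoise P 𝓕 N) (hlam : IsRateFunction lam)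
    (h : IsStrongSolution P 𝓕 N lam X Y) (n : ℕ) {H : Set (Fin (n + 1 + 1) → Fin k × ℝ)}
    (hH : MeasurableSet H) (i : Fin k) {A : Set Ω}
    (hA : A = jumpHistory X Y (n + 1) ⁻¹' H ∩ jumpStates X Y (n + 1) ⁻¹' {i}) (y : ℝ) :
    P.real A - P.real (A ∩ {ω | y ≤ sojourn Y (n + 1) ω}) =
      ∫ v in Ioc 0 y, (∑ j, cutRate lam i j v) * P.real (A ∩ {ω | v ≤ sojourn Y (n + 1) ω}) := by
  have hD := h.measurable_sojourn (n + 1)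
  have hAm : MeasurableSet A := by
    rw [hA]
    exact (h.measurable_jumpHistory _ hH).inter
      (h.measurable_jumpStates _ (measurableSet_singleton i))
  have hanti : Antitone fun v => P (A ∩ {ω | v ≤ sojourn Y (n + 1) ω}) := fun a b hab =>
    measure_mono (inter_subset_inter_right _ fun ω hω => hab.trans hω)
  have hcm : ∀ j, Measurable fun v => ENNReal.ofReal (cutRate lam i j v) *
      P (A ∩ {ω | v ≤ sojourn Y (n + 1) ω}) := fun j =>
    (hlam.measurable_cutRate i j).ennreal_ofReal.mul hanti.measurable
  -- Summing the transition formula over the next state turns it into a closed equation for the tail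
  -- of the sojourn time.
  have hsplit : P (A ∩ {ω | sojourn Y (n + 1) ω < y}) =
      ∑ j, P (A ∩ {ω | jumpStates X Y (n + 2) ω = j ∧ sojourn Y (n + 1) ω ∈ Iio y}) := by
    rw [← measure_biUnion_finset]
    · congr 1
      ext ω; simp
    · intro a _ b _ hab
      refine Set.disjoint_left.2 ?_
      rintro ω ⟨-, ha, -⟩ ⟨-, hb, -⟩
      exact hab (ha.symm.trans hb)
    · intro j _
      exact hAm.inter ((h.measurable_jumpStates _ (measurableSet_singleton j)).inter
        (hD measurableSet_Iio))
  have hcompl : P A = P (A ∩ {ω | sojourn Y (n + 1) ω < y}) +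
      P (A ∩ {ω | y ≤ sojourn Y (n + 1) ω}) := by
    rw [← measure_inter_add_sdiff A (hD measurableSet_Iio : MeasurableSet (_ ⁻¹' Iio y))]
    congr 2
    ext ω
    simp
  have hreal : P.real A - P.real (A ∩ {ω | y ≤ sojourn Y (n + 1) ω}) =
      (P (A ∩ {ω | sojourn Y (n + 1) ω < y})).toReal := by
    rw [measureReal_def, measureReal_def, hcompl,
      ENNReal.toReal_add (measure_ne_top _ _) (measure_ne_top _ _), add_sub_cancel_right]
  have hr0 : ∀ v, 0 ≤ (∑ j, cutRate lam i j v) * P.real (A ∩ {ω | v ≤ sojourn Y (n + 1) ω}) :=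
    fun v => mul_nonneg (Finset.sum_nonneg fun j _ => hlam.cutRate_nonneg i j v) measureReal_nonneg
  rw [hreal, integral_eq_lintegral_of_nonneg_ae (ae_of_all _ hr0)]
  swap
  · exact ((Finset.measurable_sum _ fun j _ => hlam.measurable_cutRate i j).mul
      hanti.measurable.ennreal_toReal).aestronglyMeasurable
  congr 1
  rw [hsplit]
  simp_rw [h.measure_transition hN hlam n hH i _ hA measurableSet_Iio]
  rw [← lintegral_finsetSum _ fun j _ => hcm j]
  have hIoo : (Iio y ∩ Ioi 0 : Set ℝ) = Ioo 0 y := by rw [inter_comm]; rfl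
  rw [hIoo, setLIntegral_congr Ioo_ae_eq_Ioc]
  refine lintegral_congr fun v => ?_
  rw [ENNReal.ofReal_mul (Finset.sum_nonneg fun j _ => hlam.cutRate_nonneg i j v),
    ENNReal.ofReal_sum_of_nonneg fun j _ => hlam.cutRate_nonneg i j v, Finset.sum_mul,
    ofReal_measureReal]

/-- Given the current state, the sojourn time and the next state are independent of the history. -/
lemma measure_transition_mul (hN : IsPoissonNoise P 𝓕 N) (hlam : IsRateFunction lam)
    (h : IsStrongSolution P 𝓕 N lam X Y) (n : ℕ) {H : Set (Fin (n + 1 + 1) → Fin k × ℝ)}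
    (hH : MeasurableSet H) (i j : Fin k) {A B : Set Ω}
    (hA : A = jumpHistory X Y (n + 1) ⁻¹' H ∩ jumpStates X Y (n + 1) ⁻¹' {i})
    (hB : B = jumpStates X Y (n + 1) ⁻¹' {i}) {R : Set ℝ} (hR : MeasurableSet R) :
    P (A ∩ {ω | jumpStates X Y (n + 2) ω = j ∧ sojourn Y (n + 1) ω ∈ R}) * P B =
      P A * P (B ∩ {ω | jumpStates X Y (n + 2) ω = j ∧ sojourn Y (n + 1) ω ∈ R}) := by
  obtain ⟨K, -, -, hK⟩ := hlam.exists_strip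
  have hB' : B = jumpHistory X Y (n + 1) ⁻¹' univ ∩ jumpStates X Y (n + 1) ⁻¹' {i} := by
    rw [hB]; simp
  set a : ℝ → ℝ := fun v => P.real (A ∩ {ω | v ≤ sojourn Y (n + 1) ω}) with ha
  set b : ℝ → ℝ := fun v => P.real (B ∩ {ω | v ≤ sojourn Y (n + 1) ω}) with hb
  have hinteg : ∀ (C : Set Ω) (y : ℝ), IntegrableOn (fun v => (∑ j, cutRate lam i j v) *
      P.real (C ∩ {ω | v ≤ sojourn Y (n + 1) ω})) (Ioc 0 y) := by
    intro C y
    have hanti : Antitone fun v => P.real (C ∩ {ω | v ≤ sojourn Y (n + 1) ω}) := fun a b hab =>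
      measureReal_mono (inter_subset_inter_right _ fun ω hω => hab.trans hω)
    refine Measure.integrableOn_of_bounded (M := K) (by simp)
      ((Finset.measurable_sum _ fun j _ => hlam.measurable_cutRate i j).mul
        hanti.measurable).aestronglyMeasurable (ae_of_all _ fun v => ?_)
    rw [Real.norm_eq_abs, abs_of_nonneg (mul_nonneg
      (Finset.sum_nonneg fun j _ => hlam.cutRate_nonneg i j v) measureReal_nonneg)]
    calc _ ≤ K * 1 := mul_le_mul (hK i v) measureReal_le_one measureReal_nonneg
            ((Finset.sum_nonneg fun j _ => hlam.cutRate_nonneg i j v).trans (hK i v))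
      _ = K := mul_one K
  -- The tails for `A` and for `B` solve the same linear equation with initial values `P A` and `P
  -- B`; the cross-combination solves the homogeneous one, so it vanishes.
  have hw : ∀ v, 0 < v → a v * P.real B - P.real A * b v = 0 := by
    intro v hv
    refine eq_zero_of_volterra (r := fun v => ∑ j, cutRate lam i j v)
      (w := fun v => a v * P.real B - P.real A * b v) (K := K) (C := 1) (fun v => ?_) (fun v => ?_)
      (fun y _ => ?_) hv
    · rw [abs_of_nonneg (Finset.sum_nonneg fun j _ => hlam.cutRate_nonneg i j v)]
      exact hK i v
    · have h1 : a v * P.real B ≤ 1 := mul_le_one₀ measureReal_le_one measureReal_nonneg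
        measureReal_le_one
      have h2 : P.real A * b v ≤ 1 := mul_le_one₀ measureReal_le_one measureReal_nonneg
        measureReal_le_one
      have h3 : 0 ≤ a v * P.real B := mul_nonneg measureReal_nonneg measureReal_nonneg
      have h4 : 0 ≤ P.real A * b v := mul_nonneg measureReal_nonneg measureReal_nonneg
      exact abs_le.2 ⟨by linarith, by linarith⟩
    · have e1 := h.measureReal_sojourn hN hlam n hH i hA y
      have e2 := h.measureReal_sojourn hN hlam n MeasurableSet.univ i hB' y
      have e3 : ∫ v in Ioc 0 y, (∑ j, cutRate lam i j v) * (a v * P.real B - P.real A * b v) =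
          (P.real A - a y) * P.real B - P.real A * (P.real B - b y) := by
        rw [e1, e2, ← integral_mul_const, ← integral_const_mul,
          ← integral_sub ((hinteg A y).mul_const _) ((hinteg B y).const_mul _)]
        refine integral_congr_ae (ae_of_all _ fun v => ?_)
        simp only [ha, hb]
        ring
      rw [e3]
      ring
  rw [h.measure_transition hN hlam n hH i j hA hR,
    h.measure_transition hN hlam n MeasurableSet.univ i j hB' hR,
    ← lintegral_mul_const' _ _ (measure_ne_top _ _), ← lintegral_const_mul' _ _ (measure_ne_top _ _)]
  refine setLIntegral_congr_fun (hR.inter measurableSet_Ioi) fun v hv => ?_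
  have hv' : P (A ∩ {ω | v ≤ sojourn Y (n + 1) ω}) * P B =
      P A * P (B ∩ {ω | v ≤ sojourn Y (n + 1) ω}) := by
    have := sub_eq_zero.1 (hw v hv.2)
    rw [← ENNReal.toReal_eq_toReal_iff' (ENNReal.mul_ne_top (measure_ne_top _ _)
      (measure_ne_top _ _)) (ENNReal.mul_ne_top (measure_ne_top _ _) (measure_ne_top _ _)),
      ENNReal.toReal_mul, ENNReal.toReal_mul]
    exact this
  rw [mul_assoc, hv', mul_left_comm]

lemma measurable_jumpStates_comap (n : ℕ) :
    Measurable[MeasurableSpace.comap (jumpHistory X Y n) inferInstance] (jumpStates X Y n) := by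
  have h1 : Measurable fun x : Fin (n + 1) → Fin k × ℝ => (x (Fin.last n)).1 := by fun_prop
  exact h1.comp (comap_measurable (jumpHistory X Y n))

/-- The semi-Markov property follows from conditional independence of the history and the next
jump, given the current state. -/
lemma semiMarkovPropertyAt_of_forall (h : IsStrongSolution P 𝓕 N lam X Y) (n : ℕ)
    (hind : ∀ (H : Set (Fin (n + 1) → Fin k × ℝ)), MeasurableSet H → ∀ (i j : Fin k) (y : ℝ),
      P (jumpHistory X Y n ⁻¹' H ∩ jumpStates X Y n ⁻¹' {i} ∩
          {ω | jumpStates X Y (n + 1) ω = j ∧ sojourn Y n ω ≤ y}) * P (jumpStates X Y n ⁻¹' {i}) =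
        P (jumpHistory X Y n ⁻¹' H ∩ jumpStates X Y n ⁻¹' {i}) *
          P (jumpStates X Y n ⁻¹' {i} ∩
            {ω | jumpStates X Y (n + 1) ω = j ∧ sojourn Y n ω ≤ y})) :
    SemiMarkovPropertyAt P (jumpTimes Y) (jumpStates X Y) n := by
  intro j y
  have hE : MeasurableSet {ω | jumpStates X Y (n + 1) ω = j ∧ sojourn Y n ω ≤ y} :=
    (h.measurable_jumpStates _ (measurableSet_singleton j)).inter
      (h.measurable_sojourn n measurableSet_Iic)
  have hle := (measurable_jumpStates_comap (X := X) (Y := Y) n).comap_le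
  have hall : ∀ A, MeasurableSet[MeasurableSpace.comap (jumpHistory X Y n) inferInstance] A →
      ∀ i, P (A ∩ jumpStates X Y n ⁻¹' {i} ∩
          {ω | jumpStates X Y (n + 1) ω = j ∧ sojourn Y n ω ≤ y}) * P (jumpStates X Y n ⁻¹' {i}) =
        P (A ∩ jumpStates X Y n ⁻¹' {i}) * P (jumpStates X Y n ⁻¹' {i} ∩
            {ω | jumpStates X Y (n + 1) ω = j ∧ sojourn Y n ω ≤ y}) := by
    rintro _ ⟨H, hH, rfl⟩ i
    exact hind H hH i j y
  -- Conditioning on the history and on the current state alone yields the same elementary quotient,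
  -- since the second σ-algebra is contained in the first.
  have h1 := condExp_eq_of_forall_inter (h.measurable_jumpHistory n).comap_le
    (measurable_jumpStates_comap n) hE hall
  have h2 := condExp_eq_of_forall_inter (h.measurable_jumpStates n).comap_le
    (comap_measurable _) hE fun A hA => hall A (hle A hA)
  exact h1.trans h2.symm

lemma semiMarkovPropertyAt_succ (hN : IsPoissonNoise P 𝓕 N) (hlam : IsRateFunction lam)
    (h : IsStrongSolution P 𝓕 N lam X Y) (n : ℕ) :
    SemiMarkovPropertyAt P (jumpTimes Y) (jumpStates X Y) (n + 1) :=
  h.semiMarkovPropertyAt_of_forall (n + 1) fun _ hH i j _ =>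
    h.measure_transition_mul hN hlam n hH i j rfl rfl measurableSet_Iic

/-- Here `T_0 = -Y_0` is almost surely a function of `ξ_0`. On `{ξ_0 = i}` each event of the initial
history is thus null or almost sure, and the conditional independence is trivial. -/
lemma semiMarkovPropertyAt_zero (hN : IsPoissonNoise P 𝓕 N) (hlam : IsRateFunction lam)
    (h : IsStrongSolution P 𝓕 N lam X Y) {φ : Fin k → ℝ} (hφ : ∀ᵐ ω ∂P, Y 0 ω = φ (X 0 ω)) :
    SemiMarkovPropertyAt P (jumpTimes Y) (jumpStates X Y) 0 := by
  obtain ⟨K, -, hstrip, -⟩ := hlam.exists_strip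
  refine h.semiMarkovPropertyAt_of_forall 0 fun H hH i j y => ?_
  have hhist : ∀ᵐ ω ∂P, jumpHistory X Y 0 ω =
      fun _ => (jumpStates X Y 0 ω, -φ (jumpStates X Y 0 ω)) := by
    filter_upwards [h.ae_isGoodPath hN hlam hstrip, hφ] with ω ⟨τ, hτ⟩ hω
    have hX0 : jumpStates X Y 0 ω = X 0 ω := by rw [hτ.state, hτ.jumps.zero]
    ext m : 1
    obtain rfl : m = 0 := Fin.ext (by omega)
    simp only [jumpHistory, Fin.val_zero, jumpTimes_zero, hX0, hω]
  have hmem : ∀ᵐ ω ∂P, jumpStates X Y 0 ω = i →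
      (ω ∈ jumpHistory X Y 0 ⁻¹' H ↔ (fun _ : Fin (0 + 1) => (i, -φ i)) ∈ H) := by
    filter_upwards [hhist] with ω hω hi
    rw [mem_preimage, hω, hi]
  by_cases hi : (fun _ : Fin (0 + 1) => (i, -φ i)) ∈ H
  · have hae : (jumpHistory X Y 0 ⁻¹' H ∩ jumpStates X Y 0 ⁻¹' {i} : Set Ω) =ᵐ[P]
        (jumpStates X Y 0 ⁻¹' {i} : Set Ω) := by
      filter_upwards [hmem] with ω hω
      exact propext ⟨fun hc => hc.2, fun hc => ⟨(hω hc).2 hi, hc⟩⟩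
    have hae' := measure_congr (hae.inter (ae_eq_refl
      {ω | jumpStates X Y (0 + 1) ω = j ∧ sojourn Y 0 ω ≤ y}))
    rw [hae', measure_congr hae, mul_comm]
  · have hzero : P (jumpHistory X Y 0 ⁻¹' H ∩ jumpStates X Y 0 ⁻¹' {i}) = 0 := by
      rw [measure_eq_zero_iff_ae_notMem]
      filter_upwards [hmem] with ω hω hc
      exact hi ((hω hc.2).1 hc.1)
    rw [hzero, measure_mono_null inter_subset_left hzero, zero_mul, zero_mul]

end IsStrongSolution

end Transition

end AgeDependent

theorem mainTheorem6 {Ω : Type*} {mΩ : MeasurableSpace Ω} (P : Measure Ω)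
    [IsProbabilityMeasure P] (𝓕 : Filtration ℝ≥0 mΩ) (N : Ω → Measure (ℝ≥0 × ℝ))
    (hN : AgeDependent.IsPoissonNoise P 𝓕 N)
    {k : ℕ} (lam : Fin k → Fin k → ℝ → ℝ) (hlam : AgeDependent.IsRateFunction lam)
    (X : ℝ≥0 → Ω → Fin k) (Y : ℝ≥0 → Ω → ℝ)
    (hXY : AgeDependent.IsStrongSolution P 𝓕 N lam X Y) :
    AgeDependent.IsSemiMarkovFrom P 1 X (fun ω => -(Y 0 ω)) ∧
      ((∃ φ : Fin k → ℝ, ∀ᵐ ω ∂P, Y 0 ω = φ (X 0 ω)) →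
        AgeDependent.IsSemiMarkovFrom P 0 X (fun ω => -(Y 0 ω))) := by
  have hpc := hXY.isPiecewiseConstant hN hlam
  refine ⟨⟨_, _, AgeDependent.jumpTimes_zero Y, hpc, fun n hn => ?_⟩,
    fun ⟨φ, hφ⟩ => ⟨_, _, AgeDependent.jumpTimes_zero Y, hpc, fun n _ => ?_⟩⟩
  · obtain ⟨n, rfl⟩ := Nat.exists_eq_add_of_le' hn
    exact hXY.semiMarkovPropertyAt_succ hN hlam n
  · cases n with
    | zero => exact hXY.semiMarkovPropertyAt_zero hN hlam hφ
    | succ n => exact hXY.semiMarkovPropertyAt_succ hN hlam n
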